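/- **Setting.** Let $G=(W\sqcup F,E)$ be a finite bipartite graph without multiple edges. Each worker $w\in W$ has quota one and a strict linear order $>_w$ on the set $E_w$ of its incident edges, so its choice function $C_w$ picks the best edge of a subset of $E_w$ (and nothing from the empty set). Each firm $f\in F$ has a choice function $C_f:2^{E_f}\to 2^{E_f}$ with $C_f(Z)\subseteq Z$ such that, for all $Z'\subseteq Z\subseteq E_f$: (A1) if $C_f(Z)\subseteq Z'$ then $C_f(Z')=C_f(Z)$; (A2) $C_f(Z)\cap Z'\subseteq C_f(Z')$; (A3) $|C_f(Z)|\ge|C_f(Z')|$. For $X\subseteq E$ put $X_v=X\cap E_v$. $X$ is *acceptable* if $C_v(X_v)=X_v$ for all $v\in W\sqcup F$. An edge $e\in E_v\setminus X$ is *interesting* for $v$ under $X$ if $e\in C_v(X_v\cup\{e\})$. An acceptable $X$ is *stable* if no edge is interesting under $X$ for both of its ends. Stable sets are ordered by $X\succeq_F Y$ iff $C_f(X_f\cup Y_f)=X_f$ for all $f\in F$; $X_{\min}$ and $X_{\max}$ denote the least and the greatest stable set. **Rotations.** Let $X$ be stable. If $X_w=\{x_w\}$, let $a_w$ be the best (for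 $>_w$) edge $e\in E_w$, if there is one, such that $x_w>_w e$ and $e$ is interesting under $X$ for its firm. If $a_w=wf$ and $C_f(X_f\cup\{a_w\})=(X_f\setminus\{b\})\cup\{a_w\}$ with $b\in X_f$, then $(a_w,b)$ is called a *tandem*. Let $D(X)$ be the digraph formed by the edges $a_w$, directed from $W$ to $F$, and the edges $b$ of tandems, directed from $F$ to $W$. As long as some $w$ has the leaving edge $a_w$ but no entering edge, delete $a_w$, and also delete the edge $b$ with $(a_w,b)$ a tandem, if it exists and occurs in no other tandem of the current graph. The final graph is the *active graph* $\Gamma(X)$. The *rotations* generated by $X$ are the edge-simple directed cycles $L$ of $\Gamma(X)$ in which every two edges that are consecutive at a firm form a tandem; $L^+$ and $L^-$ are the sets of edges of $L$ directed from $W$ to $F$ and from $F$ to $W$, respectively, and $L$ is identified with $(L^+,L^-)$. Applying $L$ to $X$ gives $(X\setminus L^-)\cup L^+$. A *full route* is a sequence from $X_{\min}$ to $X_{\max}$ in which each term arises from the preceding one by applying a rotation generated by the preceding term. Let $\mathcal R$ be the set of rotations applied in full routes; for $R,R'\in\mathcal R$ write $R\lessdot R'$ if $R$ is applied earlier than $R'$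 in every full route. Let $H$ be the Hasse diagram of the poset $(\mathcal R,\lessdot)$, i.e. the digraph on $\mathcal R$ whose arcs are the pairs $(R,R')$ such that $R\lessdot R'$ and there is no $R''\in\mathcal R$ with $R\lessdot R''\lessdot R'$. **Proposition.** There is an algorithm (one fixed program of a random access machine, with oracles for the choice functions $C_f$) that, given the graph $G$, the orders $>_w$ (as lists of $E_w$ in decreasing preference) and $X_{\min}$, constructs the graph $H$, including the edge sets $R^+,R^-$ of its vertices $R$, in time $O(|E|^2)$. Here every elementary operation, and every oracle call (which, for $f\in F$ and $Z\subseteq E_f$, outputs $C_f(Z)$), counts as one step. For the degenerate case $E=\emptyset$, $O(|E|^2)$ is read as $O(|E|^2+1)$. -/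

import Mathlib

/-- An instance of the combined boolean model of stability with unit quotas on the workers:
a finite bipartite simple graph with workers `0, …, p - 1`, firms `0, …, q - 1` and edges
`0, …, m - 1`, where edge `e` joins the worker `wk e` to the firm `fm e`.
Worker `w` has a strict linear order `gt w` on the set `E_w` of its edges
(`gt w e e'` means that `e` is preferred to `e'`), and firm `f` has a choice function `C f` on the
subsets of the set `E_f` of its edges that is consistent, substitutable and cardinally monotone. -/
structure CBM (p q m : ℕ) where
  wk : Fin m → Fin p
  fm : Fin m → Fin q
  simple : ∀ e e', wk e = wk e' → fm e = fm e' → e = e'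
  gt : Fin p → Fin m → Fin m → Prop
  gt_irrefl : ∀ w e, wk e = w → ¬ gt w e e
  gt_trans : ∀ w e₁ e₂ e₃, wk e₁ = w → wk e₂ = w → wk e₃ = w →
    gt w e₁ e₂ → gt w e₂ e₃ → gt w e₁ e₃
  gt_total : ∀ w e e', wk e = w → wk e' = w → e ≠ e' → gt w e e' ∨ gt w e' e
  C : Fin q → Finset (Fin m) → Finset (Fin m)
  C_subset : ∀ f Z, (∀ e ∈ Z, fm e = f) → C f Z ⊆ Z
  consistent : ∀ f Z Z', (∀ e ∈ Z, fm e = f) → Z' ⊆ Z → C f Z ⊆ Z' → C f Z' = C f Z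
  substitutable : ∀ f Z Z', (∀ e ∈ Z, fm e = f) → Z' ⊆ Z → C f Z ∩ Z' ⊆ C f Z'
  cardMonotone : ∀ f Z Z', (∀ e ∈ Z, fm e = f) → Z' ⊆ Z → (C f Z').card ≤ (C f Z).card

/-- The pair `(L⁺, L⁻)` of edge sets that represents a rotation `L`. -/
structure Rotation (m : ℕ) where
  plus : Finset (Fin m)
  minus : Finset (Fin m)

namespace CBM

variable {p q m : ℕ} (M : CBM p q m)

/-- The restriction `X_w` of a set of edges to the edges at the worker `w`. -/
def atW (X : Finset (Fin m)) (w : Fin p) : Finset (Fin m) := X.filter fun e => M.wk e = w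

/-- The restriction `X_f` of a set of edges to the edges at the firm `f`. -/
def atF (X : Finset (Fin m)) (f : Fin q) : Finset (Fin m) := X.filter fun e => M.fm e = f

open Classical in
/-- The choice function of the worker `w` with quota one: it takes the most preferred edge of
`Z ⊆ E_w` (and nothing if `Z` is empty). -/
noncomputable def Cw (w : Fin p) (Z : Finset (Fin m)) : Finset (Fin m) :=
  Z.filter fun e => ∀ e' ∈ Z, e' ≠ e → M.gt w e e'

/-- `X` is acceptable for all workers and all firms. -/
def Acceptable (X : Finset (Fin m)) : Prop :=
  (∀ w, M.Cw w (M.atW X w) = M.atW X w) ∧ (∀ f, M.C f (M.atF X f) = M.atF X f)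

/-- The edge `e` is interesting under `X` for its worker. -/
def InterestingW (X : Finset (Fin m)) (e : Fin m) : Prop :=
  e ∉ X ∧ e ∈ M.Cw (M.wk e) (M.atW X (M.wk e) ∪ {e})

/-- The edge `e` is interesting under `X` for its firm. -/
def InterestingF (X : Finset (Fin m)) (e : Fin m) : Prop :=
  e ∉ X ∧ e ∈ M.C (M.fm e) (M.atF X (M.fm e) ∪ {e})

/-- Stable matchings: acceptable sets of edges that are blocked by no edge. -/
def Stable (X : Finset (Fin m)) : Prop :=
  M.Acceptable X ∧ ∀ e, ¬ (M.InterestingW X e ∧ M.InterestingF X e)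

/-- `X` is weakly preferred to `Y` by all firms. -/
def FirmsPrefer (X Y : Finset (Fin m)) : Prop :=
  ∀ f, M.C f (M.atF X f ∪ M.atF Y f) = M.atF X f

/-- `X` is the least stable matching with respect to the firms. -/
def IsXmin (X : Finset (Fin m)) : Prop :=
  M.Stable X ∧ ∀ Y, M.Stable Y → M.FirmsPrefer Y X

/-- `X` is the greatest stable matching with respect to the firms. -/
def IsXmax (X : Finset (Fin m)) : Prop :=
  M.Stable X ∧ ∀ Y, M.Stable Y → M.FirmsPrefer X Y

/-- The worker of `e` is fully filled, `e` is less preferred by this worker than its edge `x` in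
`X`, and `e` is interesting for its firm under `X`. -/
def WCandidate (X : Finset (Fin m)) (e : Fin m) : Prop :=
  (∃ x, M.atW X (M.wk e) = {x} ∧ M.gt (M.wk e) x e) ∧ M.InterestingF X e

/-- `a` is the `W`-admissible edge `a_w` of its worker `w`: the best of the candidates at `w`. -/
def WAdmissible (X : Finset (Fin m)) (a : Fin m) : Prop :=
  M.WCandidate X a ∧
    ∀ e, M.wk e = M.wk a → M.WCandidate X e → e ≠ a → M.gt (M.wk a) a e

/-- `(a, b)` is a tandem: `a` is `W`-admissible and `b` is the `F`-admissible edge associated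
with it. -/
def Tandem (X : Finset (Fin m)) (a b : Fin m) : Prop :=
  M.WAdmissible X a ∧ b ∈ M.atF X (M.fm a) ∧
    M.C (M.fm a) (M.atF X (M.fm a) ∪ {a}) = (M.atF X (M.fm a) \ {b}) ∪ {a}

/-- The directed graph `D(X)`, given by its two sets of edges: the `W`-admissible edges (directed
from `W` to `F`) and the `F`-admissible edges (directed from `F` to `W`). -/
def graphD (X : Finset (Fin m)) : Set (Fin m) × Set (Fin m) :=
  ({a | M.WAdmissible X a}, {b | ∃ a, M.Tandem X a b})

/-- One step of the cleaning procedure: some worker has a leaving edge `a` but no entering edge;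
then `a` is deleted, together with its associated edge if the latter occurs in no other tandem
of the current graph. -/
def CleanStep (X : Finset (Fin m)) (D D' : Set (Fin m) × Set (Fin m)) : Prop :=
  ∃ a ∈ D.1, (∀ b ∈ D.2, M.wk b ≠ M.wk a) ∧
    D'.1 = D.1 \ {a} ∧
    D'.2 = D.2 \ {b | M.Tandem X a b ∧ ¬ ∃ a' ∈ D.1, a' ≠ a ∧ M.Tandem X a' b}

/-- `G` is the active graph of `X`: the graph `D(X)` upon termination of the cleaning procedure. -/
def IsActiveGraph (X : Finset (Fin m)) (G : Set (Fin m) × Set (Fin m)) : Prop :=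
  Relation.ReflTransGen (M.CleanStep X) (M.graphD X) G ∧ ∀ G', ¬ M.CleanStep X G G'

/-- `L` belongs to the set `𝓛(X)` of rotations generated by `X`: it is an edge-simple directed cycle
`a 0, b 0, a 1, b 1, …, a k, b k` of the active graph in which the edges `a i, b i` that are
consecutive at a firm form a tandem. (The index `i + 1` is taken modulo `k + 1`.) -/
def IsRotation (X : Finset (Fin m)) (L : Rotation m) : Prop :=
  ∃ G, M.IsActiveGraph X G ∧ ∃ (k : ℕ) (a b : Fin (k + 1) → Fin m),
    Function.Injective a ∧ Function.Injective b ∧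
    (∀ i, a i ∈ G.1 ∧ b i ∈ G.2 ∧ M.Tandem X (a i) (b i) ∧ M.wk (b i) = M.wk (a (i + 1))) ∧
    L.plus = Finset.univ.image a ∧ L.minus = Finset.univ.image b

/-- `M.Route X Y T`: a route goes from `X` to `Y` and applies the rotations of the list `T`,
in this order. Applying `L` to `X` gives `(X - L⁻) ∪ L⁺`. -/
inductive Route : Finset (Fin m) → Finset (Fin m) → List (Rotation m) → Prop
  | nil (X : Finset (Fin m)) : Route X X []
  | cons {X Y : Finset (Fin m)} {L : Rotation m} {T : List (Rotation m)}
      (hL : M.IsRotation X L) (h : Route ((X \ L.minus) ∪ L.plus) Y T) : Route X Y (L :: T)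

/-- `T` lists the rotations of a full route, i.e. of a route going from `Xmin` to `Xmax`. -/
def FullRoute (T : List (Rotation m)) : Prop :=
  ∃ X Y, M.IsXmin X ∧ M.IsXmax Y ∧ M.Route X Y T

/-- The set `𝓡` of rotations. -/
def rotations : Set (Rotation m) := {R | ∃ T, M.FullRoute T ∧ R ∈ T}

/-- The order of the poset of rotations: `R` is applied earlier than `R'` in every full route. -/
def Precedes (R R' : Rotation m) : Prop :=
  R ∈ M.rotations ∧ R' ∈ M.rotations ∧ ∀ T, M.FullRoute T → [R, R'].Sublist T

/-- `R` immediately precedes `R'`, i.e. `(R, R')` is an arc of the Hasse diagram. -/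
def ImmediatelyPrecedes (R R' : Rotation m) : Prop :=
  M.Precedes R R' ∧ ¬ ∃ R'', M.Precedes R R'' ∧ M.Precedes R'' R'

/-- `e'` is the edge next to `e` in the order of decreasing preference of their worker. -/
def IsNext (e e' : Fin m) : Prop :=
  M.wk e' = M.wk e ∧ M.gt (M.wk e) e e' ∧
    ∀ d, M.wk d = M.wk e → M.gt (M.wk e) e d → d ≠ e' → M.gt (M.wk e) e' d

/-- `e` is the most preferred edge of the worker `w`. -/
def IsFirst (w : Fin p) (e : Fin m) : Prop :=
  M.wk e = w ∧ ∀ d, M.wk d = w → d ≠ e → M.gt w e d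

end CBM

/-- The memory of a random access machine: registers, and finitely many arrays used by a program
(numbered by the first argument of `arr`), all holding natural numbers. -/
structure Memory where
  reg : ℕ → ℕ
  arr : ℕ → ℕ → ℕ

namespace Memory

def setReg (s : Memory) (x v : ℕ) : Memory where
  reg := fun y => if y = x then v else s.reg y
  arr := s.arr

def setArr (s : Memory) (a i v : ℕ) : Memory where
  reg := s.reg
  arr := fun a' i' => if a' = a ∧ i' = i then v else s.arr a' i'

/-- Effect of an oracle call. The set `Z ⊆ E_f` of the edges of the firm number `f` whose entries
in the array `z` are nonzero is given to the choice function of this firm, and the value `C_f(Z)`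
is written, as a 0-1-vector indexed by `E_f`, into the array `o`. All else is unchanged. -/
def callOracle {p q m : ℕ} (M : CBM p q m) (s : Memory) (f z o : ℕ) : Memory where
  reg := s.reg
  arr := fun a i =>
    if a = o then
      if h : i < m then
        if (M.fm ⟨i, h⟩ : ℕ) = f then
          if (⟨i, h⟩ : Fin m) ∈ M.C (M.fm ⟨i, h⟩)
              (Finset.univ.filter fun e => M.fm e = M.fm ⟨i, h⟩ ∧ s.arr z e ≠ 0)
          then 1 else 0
        else s.arr a i
      else s.arr a i
    else s.arr a i

end Memory

/-- Comparisons of two registers. -/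
inductive Test
  | eq (x y : ℕ)
  | lt (x y : ℕ)

def Test.Holds : Test → Memory → Prop
  | .eq x y, s => s.reg x = s.reg y
  | .lt x y, s => s.reg x < s.reg y

/-- Programs of a random access machine with a choice function oracle. The arguments `x`, `y` name
registers and `a`, `z`, `o` name arrays. The only arithmetic operations are successor and
predecessor, so that all numbers stay below a constant plus the largest input number plus the
number of steps. -/
inductive Program
  | skip
  | const (x k : ℕ)
  | copy (x y : ℕ)
  | inc (x : ℕ)
  | dec (x : ℕ)
  | load (x a y : ℕ)
  | store (a y x : ℕ)
  | oracle (y z o : ℕ)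
  | seq (P Q : Program)
  | cond (b : Test) (P Q : Program)
  | loop (b : Test) (P : Program)

/-- `Exec M P s t s'`: started on the memory `s`, with oracles for the choice functions of `M`,
the program `P` halts after `t` steps, with the memory `s'`. Each elementary operation, each
comparison and each oracle call counts as one step. -/
inductive Exec {p q m : ℕ} (M : CBM p q m) : Program → Memory → ℕ → Memory → Prop
  | skip (s) : Exec M .skip s 1 s
  | const (x k s) : Exec M (.const x k) s 1 (s.setReg x k)
  | copy (x y s) : Exec M (.copy x y) s 1 (s.setReg x (s.reg y))
  | inc (x s) : Exec M (.inc x) s 1 (s.setReg x (s.reg x + 1))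
  | dec (x s) : Exec M (.dec x) s 1 (s.setReg x (s.reg x - 1))
  | load (x a y s) : Exec M (.load x a y) s 1 (s.setReg x (s.arr a (s.reg y)))
  | store (a y x s) : Exec M (.store a y x) s 1 (s.setArr a (s.reg y) (s.reg x))
  | oracle (y z o s) : Exec M (.oracle y z o) s 1 (s.callOracle M (s.reg y) z o)
  | seq {P Q s₀ s₁ s₂ t₁ t₂} (h₁ : Exec M P s₀ t₁ s₁) (h₂ : Exec M Q s₁ t₂ s₂) :
      Exec M (.seq P Q) s₀ (t₁ + t₂) s₂
  | condTrue {b P Q s s' t} (hb : b.Holds s) (h : Exec M P s t s') :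
      Exec M (.cond b P Q) s (1 + t) s'
  | condFalse {b P Q s s' t} (hb : ¬ b.Holds s) (h : Exec M Q s t s') :
      Exec M (.cond b P Q) s (1 + t) s'
  | loopStop {b P s} (hb : ¬ b.Holds s) : Exec M (.loop b P) s 1 s
  | loopStep {b P s₀ s₁ s₂ t₁ t₂} (hb : b.Holds s₀) (h₁ : Exec M P s₀ t₁ s₁)
      (h₂ : Exec M (.loop b P) s₁ t₂ s₂) : Exec M (.loop b P) s₀ (1 + t₁ + t₂) s₂

open Classical in
/-- The input memory for the instance `M` and the matching `X`. Registers `0`, `1`, `2` hold the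
numbers of edges, workers and firms. Arrays `0` and `1` hold the worker and the firm of each edge.
Arrays `2` and `3` hold the edges of each worker as a linked list in the order of decreasing
preference: array `2` holds the first edge of each worker, and array `3` the edge next to each
edge, where the number `m` stands for none. Array `4` holds the 0-1-vector of `X`. All other cells
are zero. In particular nothing but the graph, the linear orders and `X` is contained in it. -/
noncomputable def inputMemory {p q m : ℕ} (M : CBM p q m) (X : Finset (Fin m)) : Memory where
  reg := fun x => if x = 0 then m else if x = 1 then p else if x = 2 then q else 0
  arr := fun a i =>
    if a = 2 then
      if h : i < p then
        if h' : ∃ e, M.IsFirst ⟨i, h⟩ e then (h'.choose : ℕ) else m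
      else 0
    else if h : i < m then
      if a = 0 then (M.wk ⟨i, h⟩ : ℕ)
      else if a = 1 then (M.fm ⟨i, h⟩ : ℕ)
      else if a = 3 then
        if h' : ∃ e', M.IsNext ⟨i, h⟩ e' then (h'.choose : ℕ) else m
      else if a = 4 then
        if (⟨i, h⟩ : Fin m) ∈ X then 1 else 0
      else 0
    else 0

/-- The memory `s` contains the Hasse diagram of the poset of rotations of `M`.
Its vertices are numbered `0, …, N - 1`, where `N` is the content of register `0`, and vertex `i`
is a rotation `ρ i` whose sets `L⁺` and `L⁻` are listed without repetition in the arrays `1` and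
`2`, respectively, in the cells from `u i` to `u (i + 1) - 1`, where `u` is array `0`.
The arcs are listed without repetition: the `k`-th one goes from the `k`-th entry of array `3` to
the `k`-th entry of array `4`, and their number is the content of register `1`. -/
def ContainsHasseDiagram {p q m : ℕ} (M : CBM p q m) (s : Memory) : Prop :=
  ∃ ρ : ℕ → Rotation m,
    Set.BijOn ρ (Set.Iio (s.reg 0)) M.rotations ∧
    (∀ i < s.reg 0,
      Set.BijOn (s.arr 1) (Set.Ico (s.arr 0 i) (s.arr 0 (i + 1)))
        ((fun e : Fin m => (e : ℕ)) '' {e | e ∈ (ρ i).plus}) ∧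
      Set.BijOn (s.arr 2) (Set.Ico (s.arr 0 i) (s.arr 0 (i + 1)))
        ((fun e : Fin m => (e : ℕ)) '' {e | e ∈ (ρ i).minus})) ∧
    Set.BijOn (fun k => (s.arr 3 k, s.arr 4 k)) (Set.Iio (s.reg 1))
      {ij | ij.1 < s.reg 0 ∧ ij.2 < s.reg 0 ∧ M.ImmediatelyPrecedes (ρ ij.1) (ρ ij.2)}

/-! The edge sets of the firms partition the edges, so all firms together act as one agent with
choice function `ch`, and a worker is described by the rank `rk` of its edge. Under a stable `X`, an
edge `x` has at most one `Link`: the best worse edge `a` of its worker that the firm of `a` would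
accept, and the edge `b` displaced by `a`. If a stable `Y` lies above `X` and no longer contains
`x`, it cannot contain the successor `b` either (`Le.exists_link`), because `X` and `Y` have the
same size. Hence rotations are just the cycles of the successor map (`isRotation_iff`; cleaning
never touches a cycle), applying one gives a stable set (`IsCycle.stable_app`), and below any larger
stable set there is a rotation leading towards it (`Le.exists_isCycle`).

The order theory rests on two exchange properties. A rotation generated by `X` either stays
generated in a larger stable set or already leads towards it (`IsCycle.persist`), so all full routes
use the same rotations. Conversely, a rotation generated after each of two different rotations was
generated before them (`IsCycle.of_app_of_app`). Therefore a rotation generated after two routes is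
generated after some of their common rotations (`Route.exists_common`), so that it has a least set
of prerequisites. It is generated exactly when it is unused and all its predecessors are used
(`isCycle_iff`). If everything that need not wait for `R` is applied, and then `R`, the rotations
now generated are the immediate successors of `R` (`isCycle_after_iff`). This reads off the Hasse
diagram without transitive reduction.

A full route is found by following successors and keeping the visited edges on a stack. If the
successor is on the stack, a rotation has been found; after its application the rest of the stack is
still a chain of links. If there is no successor, or one that can never be given up (`Dead`), then
the whole stack is dead. No edge is pushed twice, so there are O(m) steps of cost O(m) each.

For the arcs, each of the at most m rotations must be handled in time O(m), although this includes
testing all rotations. The links of a rotation are the same wherever it is generated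
(`Route.link_iff`), so a test only scans, for each moved edge, the list of its worker from the old
to the new edge. Its cost is the loss of rank in the rotation. These losses add up along a route to
at most the initial rank sum, which is at most m because the workers' lists are disjoint
(`Stable.sum_rk_le`, `Recorded.sum_le`). So one pass of tests costs O(m). -/

namespace CBM

/-! ### Joint choice of the firms, ranks, and stability in these terms. -/

variable {p q m : ℕ} (M : CBM p q m)

/-- The union of the choices of all firms from their parts of `X`. -/
def ch (X : Finset (Fin m)) : Finset (Fin m) :=
  Finset.univ.filter fun e => e ∈ M.C (M.fm e) (M.atF X (M.fm e))

lemma mem_ch {X : Finset (Fin m)} {e : Fin m} :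
    e ∈ M.ch X ↔ e ∈ M.C (M.fm e) (M.atF X (M.fm e)) := by
  simp [ch]

lemma fm_of_mem_atF {X : Finset (Fin m)} {f : Fin q} : ∀ e ∈ M.atF X f, M.fm e = f := by
  intro e he
  exact (Finset.mem_filter.1 he).2

lemma atF_mono {X Y : Finset (Fin m)} (h : X ⊆ Y) (f : Fin q) : M.atF X f ⊆ M.atF Y f :=
  Finset.filter_subset_filter _ h

lemma atF_ch (X : Finset (Fin m)) (f : Fin q) : M.atF (M.ch X) f = M.C f (M.atF X f) := by
  ext e
  simp only [atF, Finset.mem_filter, mem_ch]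
  constructor
  · rintro ⟨h, rfl⟩
    exact h
  · intro h
    have hf : M.fm e = f := M.fm_of_mem_atF e (M.C_subset f _ M.fm_of_mem_atF h)
    subst hf
    exact ⟨h, rfl⟩

lemma ch_subset (X : Finset (Fin m)) : M.ch X ⊆ X := by
  intro e he
  exact (Finset.mem_filter.1 (M.C_subset _ _ M.fm_of_mem_atF (M.mem_ch.1 he))).1

/-- (A1) and, below, (A2) and (A3) pass from the single firms to `ch` because each firm only sees
its own part; from then on no individual firm is needed for the theory. -/
lemma ch_consistent {Z Z' : Finset (Fin m)} (h : Z' ⊆ Z) (h' : M.ch Z ⊆ Z') :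
    M.ch Z' = M.ch Z := by
  ext e
  rw [mem_ch, mem_ch, M.consistent _ (M.atF Z (M.fm e)) _ M.fm_of_mem_atF (M.atF_mono h _)]
  rw [← atF_ch]
  exact M.atF_mono h' _

lemma ch_subst {Z Z' : Finset (Fin m)} (h : Z' ⊆ Z) {e : Fin m} (he : e ∈ M.ch Z) (he' : e ∈ Z') :
    e ∈ M.ch Z' := by
  rw [mem_ch] at *
  exact M.substitutable _ _ _ M.fm_of_mem_atF (M.atF_mono h _)
    (Finset.mem_inter.2 ⟨he, Finset.mem_filter.2 ⟨he', rfl⟩⟩)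

lemma card_eq_sum_atF (X : Finset (Fin m)) : X.card = ∑ f, (M.atF X f).card :=
  Finset.card_eq_sum_card_fiberwise (fun _ _ => Finset.mem_coe.2 (Finset.mem_univ _))

lemma ch_card {Z Z' : Finset (Fin m)} (h : Z' ⊆ Z) : (M.ch Z').card ≤ (M.ch Z).card := by
  rw [M.card_eq_sum_atF, M.card_eq_sum_atF (M.ch Z)]
  refine Finset.sum_le_sum fun f _ => ?_
  rw [atF_ch, atF_ch]
  exact M.cardMonotone _ _ _ M.fm_of_mem_atF (M.atF_mono h _)

lemma eq_of_atF_eq {X Y : Finset (Fin m)} (h : ∀ f, M.atF X f = M.atF Y f) : X = Y := by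
  ext e
  have := Finset.ext_iff.1 (h (M.fm e)) e
  simpa [atF] using this

lemma atF_union (X Y : Finset (Fin m)) (f : Fin q) :
    M.atF (X ∪ Y) f = M.atF X f ∪ M.atF Y f := Finset.filter_union _ _ _

open Classical in
/-- The number of edges that are worse than `e` for the worker of `e`. -/
noncomputable def rk (e : Fin m) : ℕ :=
  (Finset.univ.filter fun d => M.wk d = M.wk e ∧ M.gt (M.wk e) e d).card

lemma rk_lt {e d : Fin m} (h : M.wk d = M.wk e) (hg : M.gt (M.wk e) e d) : M.rk d < M.rk e := by
  classical
  apply Finset.card_lt_card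
  refine ⟨fun x hx => ?_, fun hs => ?_⟩
  · simp only [Finset.mem_filter, Finset.mem_univ, true_and] at hx ⊢
    refine ⟨hx.1.trans h, M.gt_trans _ e d x rfl h (hx.1.trans h) hg ?_⟩
    rw [← h]
    exact hx.2
  · have := hs (Finset.mem_filter.2 ⟨Finset.mem_univ d, h, hg⟩)
    exact M.gt_irrefl _ d rfl (Finset.mem_filter.1 this).2.2

lemma gt_iff {w : Fin p} {e d : Fin m} (he : M.wk e = w) (hd : M.wk d = w) :
    M.gt w e d ↔ M.rk d < M.rk e := by
  subst he
  refine ⟨M.rk_lt hd, fun h => ?_⟩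
  have hne : e ≠ d := by rintro rfl; exact lt_irrefl _ h
  rcases M.gt_total _ e d rfl hd hne with h1 | h1
  · exact h1
  · have := M.rk_lt (e := d) (d := e) hd.symm (by rwa [hd])
    omega

lemma rk_inj {e d : Fin m} (h : M.wk e = M.wk d) (hr : M.rk e = M.rk d) : e = d := by
  by_contra hne
  rcases M.gt_total _ e d h rfl hne with h1 | h1
  · have := (M.gt_iff h rfl).1 h1
    omega
  · have := (M.gt_iff rfl h).1 h1
    omega

lemma Cw_atW_eq_iff (X : Finset (Fin m)) (w : Fin p) :
    M.Cw w (M.atW X w) = M.atW X w ↔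
      ∀ x ∈ X, ∀ y ∈ X, M.wk x = w → M.wk y = w → x = y := by
  classical
  unfold Cw
  rw [Finset.filter_eq_self]
  simp only [atW, Finset.mem_filter]
  constructor
  · intro h x hx y hy hxw hyw
    by_contra hne
    have h1 := h x ⟨hx, hxw⟩ y ⟨hy, hyw⟩ (Ne.symm hne)
    have h2 := h y ⟨hy, hyw⟩ x ⟨hx, hxw⟩ hne
    rw [M.gt_iff hxw hyw] at h1
    rw [M.gt_iff hyw hxw] at h2
    omega
  · intro h x hx y hy hne
    exact absurd (h y hy.1 x hx.1 hy.2 hx.2) hne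

lemma interestingW_iff (X : Finset (Fin m)) (e : Fin m) :
    M.InterestingW X e ↔ e ∉ X ∧ ∀ x ∈ X, M.wk x = M.wk e → M.rk x < M.rk e := by
  classical
  unfold InterestingW Cw atW
  refine and_congr_right fun he => ?_
  simp only [Finset.mem_filter, Finset.mem_union, Finset.mem_singleton, or_true, true_and]
  constructor
  · intro h x hx hw
    exact (M.gt_iff rfl hw).1 (h x (Or.inl ⟨hx, hw⟩) (by rintro rfl; exact he hx))
  · rintro h x (⟨hx, hw⟩ | rfl) hne
    · exact (M.gt_iff rfl hw).2 (h x hx hw)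
    · exact absurd rfl hne

lemma atF_insert_self (X : Finset (Fin m)) (e : Fin m) :
    M.atF (insert e X) (M.fm e) = M.atF X (M.fm e) ∪ {e} := by
  ext d
  simp only [atF, Finset.mem_filter, Finset.mem_insert, Finset.mem_union, Finset.mem_singleton]
  constructor
  · rintro ⟨rfl | h, h'⟩
    · exact Or.inr rfl
    · exact Or.inl ⟨h, h'⟩
  · rintro (⟨h, h'⟩ | rfl)
    · exact ⟨Or.inr h, h'⟩
    · exact ⟨Or.inl rfl, rfl⟩

lemma interestingF_iff (X : Finset (Fin m)) (e : Fin m) :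
    M.InterestingF X e ↔ e ∉ X ∧ e ∈ M.ch (insert e X) := by
  rw [mem_ch, atF_insert_self, InterestingF]

lemma ch_eq_self_iff (X : Finset (Fin m)) :
    (∀ f, M.C f (M.atF X f) = M.atF X f) ↔ M.ch X = X := by
  constructor
  · intro h
    exact M.eq_of_atF_eq fun f => by rw [atF_ch, h]
  · intro h f
    rw [← atF_ch, h]

/-- The working form of stability. The strict inequality is free, since two edges of one worker with
equal rank coincide. -/
lemma stable_iff (X : Finset (Fin m)) :
    M.Stable X ↔ (∀ x ∈ X, ∀ y ∈ X, M.wk x = M.wk y → x = y) ∧ M.ch X = X ∧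
      ∀ e, e ∉ X → e ∈ M.ch (insert e X) → ∃ x ∈ X, M.wk x = M.wk e ∧ M.rk e < M.rk x := by
  unfold Stable Acceptable
  rw [ch_eq_self_iff, and_assoc]
  refine and_congr ?_ (and_congr_right fun _ => forall_congr' fun e => ?_)
  · simp only [Cw_atW_eq_iff]
    exact ⟨fun h x hx y hy hw => h _ x hx y hy hw rfl,
      fun h w x hx y hy h1 h2 => h x hx y hy (h1.trans h2.symm)⟩
  · rw [interestingW_iff, interestingF_iff]
    constructor
    · intro h he hc
      by_contra! hn
      refine h ⟨⟨he, fun x hx hw => lt_of_le_of_ne (hn x hx hw) fun heq => he ?_⟩, he, hc⟩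
      rwa [← M.rk_inj hw heq]
    · rintro h ⟨⟨he, h1⟩, -, hc⟩
      obtain ⟨x, hx, hw, hr⟩ := h he hc
      have := h1 x hx hw
      omega

/-! ### The order of the firms on stable sets. -/

/-- `X` is weakly below `Y` in the order of the firms. -/
def Le (X Y : Finset (Fin m)) : Prop := M.ch (X ∪ Y) = Y

lemma firmsPrefer_iff (X Y : Finset (Fin m)) : M.FirmsPrefer X Y ↔ M.Le Y X := by
  unfold FirmsPrefer Le
  constructor
  · intro h
    exact M.eq_of_atF_eq fun f => by rw [atF_ch, Finset.union_comm, atF_union, h]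
  · intro h f
    rw [← atF_union, ← atF_ch, Finset.union_comm, h]

variable {M}

namespace Stable

variable {X : Finset (Fin m)} (h : M.Stable X)
include h

lemma eq_of_wk {x y : Fin m} (hx : x ∈ X) (hy : y ∈ X) (hw : M.wk x = M.wk y) : x = y :=
  ((M.stable_iff X).1 h).1 x hx y hy hw

lemma ch_self : M.ch X = X := ((M.stable_iff X).1 h).2.1

lemma exists_better {e : Fin m} (he : e ∉ X) (hc : e ∈ M.ch (insert e X)) :
    ∃ x ∈ X, M.wk x = M.wk e ∧ M.rk e < M.rk x :=
  ((M.stable_iff X).1 h).2.2 e he hc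

lemma le_refl : M.Le X X := by
  rw [Le, Finset.union_idempotent, h.ch_self]

end Stable

/-- Edges of `X` outside `Y` are already rejected from `X ∪ Y`, hence from every larger set, and
consistency allows dropping them. -/
lemma Le.ch_union {X Y : Finset (Fin m)} (h : M.Le X Y) (A : Finset (Fin m)) :
    M.ch (X ∪ Y ∪ A) = M.ch (Y ∪ A) := by
  refine (M.ch_consistent (Finset.union_subset_union_left Finset.subset_union_right) ?_).symm
  intro e he
  have h1 := M.ch_subset _ he
  rw [Finset.mem_union] at h1 ⊢
  refine h1.imp_left fun h2 => ?_
  rw [← h]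
  exact M.ch_subst Finset.subset_union_left he h2

lemma Le.trans {X Y Z : Finset (Fin m)} (h : M.Le X Y) (h' : M.Le Y Z) : M.Le X Z := by
  have h1 : M.ch (X ∪ Y ∪ Z) = Z := (h.ch_union Z).trans h'
  unfold Le
  rw [M.ch_consistent (Z := X ∪ Y ∪ Z), h1]
  · exact Finset.union_subset_union_left Finset.subset_union_left
  · rw [h1]
    exact Finset.subset_union_right

lemma Le.antisymm {X Y : Finset (Fin m)} (h : M.Le X Y) (h' : M.Le Y X) : X = Y := by
  unfold Le at *
  rw [← h', Finset.union_comm, h]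

/-- An edge that is not interesting for its firm stays so when the firms get better off. -/
lemma Le.not_mem_ch {X Y : Finset (Fin m)} (h : M.Le X Y) {e : Fin m}
    (he : e ∉ M.ch (insert e X)) : e ∉ M.ch (insert e Y) := by
  intro h1
  apply he
  have h2 : M.ch (X ∪ Y ∪ {e}) = M.ch (insert e Y) := by
    rw [h.ch_union, Finset.union_comm, Finset.insert_eq]
  rw [← h2] at h1
  refine M.ch_subst ?_ h1 (Finset.mem_insert_self _ _)
  intro d
  simp only [Finset.mem_insert, Finset.mem_union, Finset.mem_singleton]
  tauto

/-- When the firms get better off, a worker whose edge changes gets a worse one. -/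
lemma Le.exists_worse_of_mem_right {X Y : Finset (Fin m)} (h : M.Le X Y) (hX : M.Stable X)
    {y : Fin m} (hy : y ∈ Y) : ∃ x ∈ X, M.wk x = M.wk y ∧ M.rk y ≤ M.rk x := by
  by_cases hyX : y ∈ X
  · exact ⟨y, hyX, rfl, le_rfl⟩
  · have h1 : y ∈ M.ch (insert y X) := by
      refine M.ch_subst (Z := X ∪ Y) ?_ (by rwa [h]) (Finset.mem_insert_self _ _)
      exact Finset.insert_subset (Finset.mem_union_right _ hy) Finset.subset_union_left
    obtain ⟨x, hx, hw, hr⟩ := hX.exists_better hyX h1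
    exact ⟨x, hx, hw, hr.le⟩

/-- Size monotonicity on `X ⊆ X ∪ Y` gives one inequality. For the other, each edge of `Y` is sent
to the edge of the same worker in `X`, which is injective because `Y` gives a worker at most one
edge. -/
lemma Le.card_eq {X Y : Finset (Fin m)} (h : M.Le X Y) (hX : M.Stable X) (hY : M.Stable Y) :
    X.card = Y.card := by
  apply le_antisymm
  · have := M.ch_card (Z := X ∪ Y) (Z' := X) Finset.subset_union_left
    rwa [h, hX.ch_self] at this
  · choose! f hf using fun y (hy : y ∈ Y) => h.exists_worse_of_mem_right hX hy
    refine Finset.card_le_card_of_injOn f (fun y hy => (hf y hy).1) fun y hy y' hy' heq => ?_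
    refine hY.eq_of_wk hy hy' ?_
    rw [← (hf y hy).2.1, ← (hf y' hy').2.1, heq]

/-- The injection from `Y` to `X` is onto because the sizes agree, so it can be inverted: every
worker matched in `X` stays matched. -/
lemma Le.exists_worse {X Y : Finset (Fin m)} (h : M.Le X Y) (hX : M.Stable X) (hY : M.Stable Y)
    {x : Fin m} (hx : x ∈ X) : ∃ y ∈ Y, M.wk y = M.wk x ∧ M.rk y ≤ M.rk x := by
  choose! f hf using fun y (hy : y ∈ Y) => h.exists_worse_of_mem_right hX hy
  have hinj : Set.InjOn f Y := fun y hy y' hy' heq => by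
    refine hY.eq_of_wk hy hy' ?_
    rw [← (hf y hy).2.1, ← (hf y' hy').2.1, heq]
  obtain ⟨y, hy, rfl⟩ := Finset.surj_on_of_inj_on_of_card_le (fun y _ => f y)
    (fun y hy => (hf y hy).1) (fun y y' hy hy' => hinj hy hy') (h.card_eq hX hY).le x hx
  exact ⟨y, hy, (hf y hy).2.1.symm, (hf y hy).2.2⟩

lemma Le.exists_worse_of_not_mem {X Y : Finset (Fin m)} (h : M.Le X Y) (hX : M.Stable X)
    (hY : M.Stable Y) {x : Fin m} (hx : x ∈ X) (hxY : x ∉ Y) :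
    ∃ y ∈ Y, y ∉ X ∧ M.wk y = M.wk x ∧ M.rk y < M.rk x := by
  obtain ⟨y, hy, hw, hr⟩ := h.exists_worse hX hY hx
  have hne : y ≠ x := by rintro rfl; exact hxY hy
  exact ⟨y, hy, fun hyX => hne (hX.eq_of_wk hyX hx hw), hw,
    lt_of_le_of_ne hr fun heq => hne (M.rk_inj hw heq)⟩

/-- The worker's rank only decreases from `X` to `Y` to `Z`; equal ends force equality in between.
So an edge that has been given up never returns. -/
lemma Le.mem_of_mem_of_mem {X Y Z : Finset (Fin m)} (h : M.Le X Y) (h' : M.Le Y Z)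
    (hX : M.Stable X) (hY : M.Stable Y) (hZ : M.Stable Z) {x : Fin m} (hx : x ∈ X) (hz : x ∈ Z) :
    x ∈ Y := by
  obtain ⟨y, hy, hw, hr⟩ := h.exists_worse hX hY hx
  obtain ⟨z, hz', hw', hr'⟩ := h'.exists_worse hY hZ hy
  have : z = x := hZ.eq_of_wk hz' hz (hw'.trans hw)
  subst this
  rwa [← M.rk_inj hw (le_antisymm hr hr')]

/-! ### Links: the successor relation on a stable set. -/

variable (M) in
/-- At its edge `x ∈ X` the worker has the admissible edge `a`, and `(a, b)` is a tandem. -/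
structure Link (X : Finset (Fin m)) (x a b : Fin m) : Prop where
  mem : x ∈ X
  wk_eq : M.wk a = M.wk x
  rk_lt : M.rk a < M.rk x
  between : ∀ e, M.wk e = M.wk x → M.rk a < M.rk e → M.rk e < M.rk x → e ∉ M.ch (insert e X)
  mem' : b ∈ X
  ch_eq : M.ch (insert a X) = insert a (X.erase b)

lemma wCandidate_iff {X : Finset (Fin m)} (e : Fin m) (hX : M.Stable X) :
    M.WCandidate X e ↔ ∃ x ∈ X, M.wk x = M.wk e ∧ M.rk e < M.rk x ∧ e ∈ M.ch (insert e X) := by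
  unfold WCandidate
  rw [interestingF_iff]
  constructor
  · rintro ⟨⟨x, hx, hg⟩, he, hc⟩
    have hx' : x ∈ M.atW X (M.wk e) := by rw [hx]; exact Finset.mem_singleton_self x
    rw [atW, Finset.mem_filter] at hx'
    exact ⟨x, hx'.1, hx'.2, (M.gt_iff hx'.2 rfl).1 hg, hc⟩
  · rintro ⟨x, hx, hw, hr, hc⟩
    refine ⟨⟨x, ?_, (M.gt_iff hw rfl).2 hr⟩, ?_, hc⟩
    · ext d
      simp only [atW, Finset.mem_filter, Finset.mem_singleton]
      constructor
      · rintro ⟨hd, hdw⟩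
        exact hX.eq_of_wk hd hx (hdw.trans hw.symm)
      · rintro rfl
        exact ⟨hx, hw⟩
    · intro he
      have := hX.eq_of_wk he hx hw.symm
      subst this
      exact lt_irrefl _ hr

lemma Stable.not_mem_of_rk_lt {X : Finset (Fin m)} (hX : M.Stable X) {x e : Fin m} (hx : x ∈ X)
    (hw : M.wk e = M.wk x) (hr : M.rk e < M.rk x) : e ∉ X := fun he => by
  have := hX.eq_of_wk he hx hw
  subst this
  exact lt_irrefl _ hr

lemma wAdmissible_iff {X : Finset (Fin m)} (a : Fin m) (hX : M.Stable X) :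
    M.WAdmissible X a ↔ ∃ x ∈ X, M.wk a = M.wk x ∧ M.rk a < M.rk x ∧ a ∈ M.ch (insert a X) ∧
      ∀ e, M.wk e = M.wk x → M.rk a < M.rk e → M.rk e < M.rk x → e ∉ M.ch (insert e X) := by
  unfold WAdmissible
  simp only [wCandidate_iff _ hX]
  constructor
  · rintro ⟨⟨x, hx, hw, hr, hc⟩, h⟩
    refine ⟨x, hx, hw.symm, hr, hc, fun e he h1 h2 h3 => ?_⟩
    have hew := he.trans hw
    have := h e hew ⟨x, hx, he.symm, h2, h3⟩ (by rintro rfl; exact lt_irrefl _ h1)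
    rw [M.gt_iff rfl hew] at this
    omega
  · rintro ⟨x, hx, hw, hr, hc, h⟩
    refine ⟨⟨x, hx, hw.symm, hr, hc⟩, ?_⟩
    rintro e he ⟨x', hx', hw', hr', hc'⟩ hne
    have : x' = x := hX.eq_of_wk hx' hx (by rw [hw', he, hw])
    subst this
    rw [M.gt_iff rfl he]
    by_contra hn
    refine h e (he.trans hw) ?_ hr' hc'
    exact lt_of_le_of_ne (not_lt.1 hn) fun heq => hne (M.rk_inj he heq.symm)

/-- Turns the condition at one firm into a condition on `ch`: all other firms see the same offers
with and without `a`. -/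
lemma tandem_iff {X : Finset (Fin m)} {a b : Fin m} (hX : M.Stable X) :
    M.Tandem X a b ↔ ∃ x, M.Link X x a b := by
  unfold Tandem
  rw [wAdmissible_iff a hX]
  constructor
  · rintro ⟨⟨x, hx, hw, hr, hc, h⟩, hb, hC⟩
    refine ⟨x, hx, hw, hr, h, (Finset.mem_filter.1 hb).1, M.eq_of_atF_eq fun f => ?_⟩
    have hbf := (Finset.mem_filter.1 hb).2
    rw [atF_ch]
    by_cases hf : f = M.fm a
    · subst hf
      rw [atF_insert_self, hC]
      ext d
      simp only [atF, Finset.mem_union, Finset.mem_sdiff, Finset.mem_filter, Finset.mem_singleton,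
        Finset.mem_insert, Finset.mem_erase]
      constructor
      · rintro (⟨⟨h1, h2⟩, h3⟩ | rfl)
        · exact ⟨Or.inr ⟨h3, h1⟩, h2⟩
        · exact ⟨Or.inl rfl, rfl⟩
      · tauto
    · have h1 : M.atF (insert a X) f = M.atF X f := by
        ext d
        simp only [atF, Finset.mem_filter, Finset.mem_insert]
        constructor
        · rintro ⟨rfl | h1, h2⟩
          · exact absurd h2.symm hf
          · exact ⟨h1, h2⟩
        · tauto
      rw [h1, (M.ch_eq_self_iff X).2 hX.ch_self]
      ext d
      simp only [atF, Finset.mem_filter, Finset.mem_insert, Finset.mem_erase]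
      constructor
      · rintro ⟨h1, h2⟩
        refine ⟨Or.inr ⟨?_, h1⟩, h2⟩
        rintro rfl
        exact hf (h2.symm.trans hbf)
      · rintro ⟨rfl | h1, h2⟩
        · exact absurd h2.symm hf
        · exact ⟨h1.2, h2⟩
  · rintro ⟨x, hL⟩
    have ha : a ∈ M.ch (insert a X) := by rw [hL.ch_eq]; exact Finset.mem_insert_self _ _
    have haX := hX.not_mem_of_rk_lt hL.mem hL.wk_eq hL.rk_lt
    have hba : b ≠ a := by rintro rfl; exact haX hL.mem'
    -- At a different firm, `b` would face unchanged offers and would be kept.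
    have hf : M.fm b = M.fm a := by
      by_contra hf
      have hb : b ∉ M.ch (insert a X) := by simp [hL.ch_eq, hba]
      apply hb
      rw [mem_ch]
      have h1 : M.atF (insert a X) (M.fm b) = M.atF X (M.fm b) := by
        ext d
        simp only [atF, Finset.mem_filter, Finset.mem_insert]
        constructor
        · rintro ⟨rfl | h1, h2⟩
          · exact absurd h2.symm hf
          · exact ⟨h1, h2⟩
        · tauto
      rw [h1, ← mem_ch, hX.ch_self]
      exact hL.mem'
    refine ⟨⟨x, hL.mem, hL.wk_eq, hL.rk_lt, ha, hL.between⟩, Finset.mem_filter.2 ⟨hL.mem', hf⟩, ?_⟩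
    rw [← atF_insert_self, ← atF_ch, hL.ch_eq]
    ext d
    simp only [atF, Finset.mem_union, Finset.mem_sdiff, Finset.mem_filter, Finset.mem_singleton,
      Finset.mem_insert, Finset.mem_erase]
    constructor
    · tauto
    · rintro (⟨⟨h1, h2⟩, h3⟩ | rfl)
      · exact ⟨Or.inr ⟨h3, h1⟩, h2⟩
      · exact ⟨Or.inl rfl, rfl⟩

namespace Link

variable {X : Finset (Fin m)} {x a b : Fin m}

lemma mem_ch (h : M.Link X x a b) : a ∈ M.ch (insert a X) := by
  rw [h.ch_eq]; exact Finset.mem_insert_self _ _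

lemma not_mem (h : M.Link X x a b) (hX : M.Stable X) : a ∉ X :=
  hX.not_mem_of_rk_lt h.mem h.wk_eq h.rk_lt

lemma not_mem_ch (h : M.Link X x a b) (hX : M.Stable X) : b ∉ M.ch (insert a X) := by
  rw [h.ch_eq]
  have : b ≠ a := by rintro rfl; exact h.not_mem hX h.mem'
  simp [this]

lemma fm_eq (h : M.Link X x a b) (hX : M.Stable X) : M.fm b = M.fm a :=
  M.fm_of_mem_atF b (((tandem_iff hX).2 ⟨x, h⟩).2.1)

/-- Of two different candidates for `a` the better one would lie in the gap excluded by the link of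
the worse one. So links form a partial function on `X`, and its cycles are determined by any of
their elements. -/
lemma unique {a' b' : Fin m} (h : M.Link X x a b) (h' : M.Link X x a' b') (hX : M.Stable X) :
    a = a' ∧ b = b' := by
  have haa : a = a' := by
    apply M.rk_inj (h.wk_eq.trans h'.wk_eq.symm)
    rcases lt_trichotomy (M.rk a) (M.rk a') with h1 | h1 | h1
    · exact absurd h'.mem_ch (h.between a' h'.wk_eq h1 h'.rk_lt)
    · exact h1
    · exact absurd h.mem_ch (h'.between a h.wk_eq h1 h.rk_lt)
  subst haa
  refine ⟨rfl, ?_⟩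
  by_contra hne
  have h1 : b ∈ M.ch (insert a X) := by
    rw [h'.ch_eq]
    exact Finset.mem_insert_of_mem (Finset.mem_erase.2 ⟨hne, h.mem'⟩)
  exact h.not_mem_ch hX h1

end Link

/-- A link is given by an admissible edge `a` and an edge `b` that is rejected by its firm. -/
lemma Stable.link_of_not_mem {X : Finset (Fin m)} (hX : M.Stable X) {x a b : Fin m} (hx : x ∈ X)
    (hw : M.wk a = M.wk x) (hr : M.rk a < M.rk x)
    (hbt : ∀ e, M.wk e = M.wk x → M.rk a < M.rk e → M.rk e < M.rk x → e ∉ M.ch (insert e X))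
    (ha : a ∈ M.ch (insert a X)) (hb : b ∈ X) (hb' : b ∉ M.ch (insert a X)) :
    M.Link X x a b := by
  refine ⟨hx, hw, hr, hbt, hb, ?_⟩
  have haX := hX.not_mem_of_rk_lt hx hw hr
  have hba : b ≠ a := by rintro rfl; exact haX hb
  apply Finset.eq_of_subset_of_card_le
  · intro d hd
    have := M.ch_subset _ hd
    rw [Finset.mem_insert] at this ⊢
    refine this.imp_right fun h => Finset.mem_erase.2 ⟨?_, h⟩
    rintro rfl
    exact hb' hd
  -- By size monotonicity, adding one edge displaces at most one edge.
  · have := M.ch_card (Z := insert a X) (Z' := X) (Finset.subset_insert _ _)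
    rw [hX.ch_self] at this
    rw [Finset.card_insert_of_notMem (by simp [haX]), Finset.card_erase_add_one hb]
    exact this

/-- If no edge is rejected when `a` is added, then the firm of `a` just accepts it. -/
lemma Stable.ch_insert_of_forall {X : Finset (Fin m)} (a : Fin m)
    (ha : a ∈ M.ch (insert a X)) (hb : ∀ b ∈ X, b ∈ M.ch (insert a X)) :
    M.ch (insert a X) = insert a X := by
  refine (M.ch_subset _).antisymm fun d hd => ?_
  rcases Finset.mem_insert.1 hd with rfl | h
  · exact ha
  · exact hb d h

/-- Links persist when the firms get better off, as long as their edges of `X` stay. -/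
lemma Link.persist {X Y : Finset (Fin m)} {x a b : Fin m} (h : M.Link X x a b) (hX : M.Stable X)
    (hY : M.Stable Y) (hle : M.Le X Y) (hx : x ∈ Y) (hb : b ∈ Y) : M.Link Y x a b := by
  have hxa : insert a X ⊆ X ∪ Y ∪ {a} := by
    intro d
    simp only [Finset.mem_insert, Finset.mem_union, Finset.mem_singleton]
    tauto
  have hu : M.ch (X ∪ Y ∪ {a}) = M.ch (insert a Y) := by
    rw [hle.ch_union, Finset.union_comm, Finset.insert_eq]
  have hb' : b ∉ M.ch (insert a Y) := by
    rw [← hu]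
    exact fun h1 => h.not_mem_ch hX (M.ch_subst hxa h1 (Finset.mem_insert_of_mem h.mem'))
  have haY := hY.not_mem_of_rk_lt hx h.wk_eq h.rk_lt
  refine hY.link_of_not_mem hx h.wk_eq h.rk_lt
    (fun e h1 h2 h3 => hle.not_mem_ch (h.between e h1 h2 h3)) ?_ hb hb'
  -- If `a` were rejected too, the firms would lose `b` without compensation, against size
  -- monotonicity.
  by_contra ha
  have h1 : M.ch (insert a Y) ⊆ Y.erase b := by
    intro d hd
    rcases Finset.mem_insert.1 (M.ch_subset _ hd) with rfl | h2
    · exact absurd hd ha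
    · refine Finset.mem_erase.2 ⟨?_, h2⟩
      rintro rfl
      exact hb' hd
  have h2 := M.ch_card (Z := insert a Y) (Z' := Y) (Finset.subset_insert _ _)
  rw [hY.ch_self] at h2
  have h3 := Finset.card_le_card h1
  have h4 := Finset.card_erase_add_one hb
  omega

/-- If `x ∈ X` is given up on the way to `Y`, then so is its successor `b`. -/
lemma Le.exists_link {X Y : Finset (Fin m)} (h : M.Le X Y) (hX : M.Stable X) (hY : M.Stable Y)
    {x : Fin m} (hx : x ∈ X) (hxY : x ∉ Y) :
    ∃ a b, M.Link X x a b ∧ b ∉ Y ∧ M.ch (insert a (X ∪ Y)) = Y := by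
  classical
  -- The new edge `y` of the worker is itself a candidate under `X`, so the best candidate `a`
  -- exists and is at least as good as `y`.
  obtain ⟨y, hy, hyX, hyw, hyr⟩ := h.exists_worse_of_not_mem hX hY hx hxY
  have hyc : y ∈ M.ch (insert y X) := by
    refine M.ch_subst (Z := X ∪ Y) ?_ (by rwa [h]) (Finset.mem_insert_self _ _)
    exact Finset.insert_subset (Finset.mem_union_right _ hy) Finset.subset_union_left
  obtain ⟨a, ha, hmax⟩ := Finset.exists_max_image
    (Finset.univ.filter fun e => M.wk e = M.wk x ∧ M.rk e < M.rk x ∧ e ∈ M.ch (insert e X)) M.rk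
    ⟨y, by simp [hyw, hyr, hyc]⟩
  simp only [Finset.mem_filter, Finset.mem_univ, true_and] at ha hmax
  obtain ⟨haw, har, hac⟩ := ha
  have hay : M.rk y ≤ M.rk a := hmax y ⟨hyw, hyr, hyc⟩
  have hu : M.ch (insert a (X ∪ Y)) = M.ch (insert a Y) := by
    rw [Finset.insert_eq, Finset.insert_eq, Finset.union_comm, h.ch_union, Finset.union_comm]
  have hcY : M.ch (insert a (X ∪ Y)) = Y := by
    rw [hu]
    by_cases haY : a ∈ Y
    · rw [Finset.insert_eq_self.2 haY, hY.ch_self]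
    -- Otherwise stability of `Y` gives the worker an edge of `Y` better than `a`; but that edge is
    -- `y`.
    · have : a ∉ M.ch (insert a Y) := by
        intro h1
        obtain ⟨y', hy', hw', hr'⟩ := hY.exists_better haY h1
        have := hY.eq_of_wk hy' hy (by rw [hw', haw, hyw])
        subst this
        omega
      rw [← M.ch_consistent (Z := insert a Y) (Z' := Y) (Finset.subset_insert _ _), hY.ch_self]
      intro d hd
      rcases Finset.mem_insert.1 (M.ch_subset _ hd) with rfl | h2
      · exact absurd hd this
      · exact h2
  have haX := hX.not_mem_of_rk_lt hx haw har
  have hsub : insert a X ⊆ insert a (X ∪ Y) :=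
    Finset.insert_subset_insert _ Finset.subset_union_left
  obtain ⟨b, hb, hb'⟩ : ∃ b ∈ X, b ∉ M.ch (insert a X) := by
    -- If adding `a` displaced nothing, the choice from `insert a X` would have more elements than
    -- `Y`, the choice from a larger set.
    by_contra! hn
    have h1 := Stable.ch_insert_of_forall a hac hn
    have h2 := M.ch_card hsub
    rw [hcY, h1, Finset.card_insert_of_notMem haX, h.card_eq hX hY] at h2
    omega
  refine ⟨a, b, hX.link_of_not_mem hx haw har ?_ hac hb hb', ?_, hcY⟩
  · intro e h1 h2 h3 h4
    have := hmax e ⟨h1, h3, h4⟩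
    omega
  · intro hbY
    refine hb' (M.ch_subst hsub ?_ (Finset.mem_insert_of_mem hb))
    rwa [hcY]

end CBM

/-! ### Rotations as cycles of links, and their application. -/

lemma Rotation.eq_of {m : ℕ} {L L' : Rotation m} (h : L.plus = L'.plus) (h' : L.minus = L'.minus) :
    L = L' := by
  cases L; cases L'
  simp_all

/-- The result of applying a rotation. -/
def Rotation.app {m : ℕ} (L : Rotation m) (X : Finset (Fin m)) : Finset (Fin m) :=
  (X \ L.minus) ∪ L.plus

namespace CBM

variable {p q m : ℕ} (M : CBM p q m)

/-- A cycle of links, which describes a rotation without reference to the active graph. -/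
def IsCycle (X : Finset (Fin m)) (L : Rotation m) : Prop :=
  ∃ (k : ℕ) (x a : Fin (k + 1) → Fin m), Function.Injective x ∧
    (∀ i, M.Link X (x i) (a i) (x (i + 1))) ∧
    L.plus = Finset.univ.image a ∧ L.minus = Finset.univ.image x

variable {M}

/-- Each `a i` has the entering edge `b (i - 1)` at its worker, so it is never the edge to be
deleted; and `b i` survives because its tandem with `a i` does. -/
lemma cleanStep_preserves {X : Finset (Fin m)} {k : ℕ} {a b : Fin (k + 1) → Fin m}
    (h : ∀ i, M.Tandem X (a i) (b i) ∧ M.wk (b i) = M.wk (a (i + 1)))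
    {D D' : Set (Fin m) × Set (Fin m)} (hs : M.CleanStep X D D')
    (hD : ∀ i, a i ∈ D.1 ∧ b i ∈ D.2) : ∀ i, a i ∈ D'.1 ∧ b i ∈ D'.2 := by
  obtain ⟨d, hd, hn, h1, h2⟩ := hs
  have hne : ∀ i, a i ≠ d := by
    rintro i rfl
    have := hn (b (i - 1)) (hD _).2
    rw [(h (i - 1)).2, sub_add_cancel] at this
    exact this rfl
  intro i
  rw [h1, h2]
  refine ⟨⟨(hD i).1, hne i⟩, (hD i).2, ?_⟩
  rintro ⟨-, hn'⟩
  exact hn' ⟨a i, (hD i).1, hne i, (h i).1⟩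

lemma exists_clean (X : Finset (Fin m)) (D : Set (Fin m) × Set (Fin m)) :
    ∃ G, Relation.ReflTransGen (M.CleanStep X) D G ∧ ∀ G', ¬ M.CleanStep X G G' := by
  induction hn : D.1.ncard using Nat.strong_induction_on generalizing D with
  | _ n ih =>
    by_cases h : ∃ D', M.CleanStep X D D'
    · obtain ⟨D', hD'⟩ := h
      have hlt : D'.1.ncard < n := by
        obtain ⟨a, ha, -, h1, -⟩ := hD'
        rw [h1, ← hn]
        exact Set.ncard_sdiff_singleton_lt_of_mem ha (Set.toFinite _)
      obtain ⟨G, hG, hG'⟩ := ih _ hlt D' rfl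
      exact ⟨G, Relation.ReflTransGen.head hD' hG, hG'⟩
    · push Not at h
      exact ⟨D, Relation.ReflTransGen.refl, h⟩

/-- Consecutive edges at a worker share the unique edge of `X` there, so tandems chain up to links.
Conversely a cycle of links survives every run of the cleaning, so the choice of the active graph is
immaterial. -/
lemma isRotation_iff {X : Finset (Fin m)} (hX : M.Stable X) (L : Rotation m) :
    M.IsRotation X L ↔ M.IsCycle X L := by
  constructor
  · rintro ⟨G, -, k, a, b, -, hb, h, hp, hm⟩
    have hl : ∀ i, M.Link X (b (i - 1)) (a i) (b i) := by
      intro i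
      obtain ⟨x, hx⟩ := (tandem_iff hX).1 (h i).2.2.1
      obtain ⟨x', hx'⟩ := (tandem_iff hX).1 (h (i - 1)).2.2.1
      have hw := (h (i - 1)).2.2.2
      rw [sub_add_cancel] at hw
      have : b (i - 1) = x := hX.eq_of_wk hx'.mem' hx.mem (hw.trans hx.wk_eq)
      rwa [this]
    -- The index shifts by one because a cycle is indexed by the edge that is left, a rotation by
    -- the edge that is displaced.
    refine ⟨k, fun i => b (i - 1), a, fun i j hij => sub_left_injective (hb hij), fun i => ?_, hp, ?_⟩
    · simpa using hl i
    · rw [hm]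
      ext e
      simp only [Finset.mem_image, Finset.mem_univ, true_and]
      constructor
      · rintro ⟨i, rfl⟩
        exact ⟨i + 1, by simp⟩
      · rintro ⟨i, rfl⟩
        exact ⟨i - 1, rfl⟩
  · rintro ⟨k, x, a, hx, hl, hp, hm⟩
    have ht : ∀ i, M.Tandem X (a i) (x (i + 1)) ∧ M.wk (x (i + 1)) = M.wk (a (i + 1)) :=
      fun i => ⟨(tandem_iff hX).2 ⟨_, hl i⟩, (hl (i + 1)).wk_eq.symm⟩
    obtain ⟨G, hG, hG'⟩ := exists_clean (M := M) X (M.graphD X)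
    refine ⟨G, ⟨hG, hG'⟩, k, a, fun i => x (i + 1), ?_, fun i j hij => add_left_injective 1 (hx hij),
      ?_, hp, ?_⟩
    · intro i j hij
      apply hx
      refine hX.eq_of_wk (hl i).mem (hl j).mem ?_
      rw [← (hl i).wk_eq, ← (hl j).wk_eq, hij]
    · have hmem : ∀ i, a i ∈ G.1 ∧ x (i + 1) ∈ G.2 := by
        clear hG'
        induction hG with
        | refl => exact fun i => ⟨(ht i).1.1, a i, (ht i).1⟩
        | tail _ hs ih => exact cleanStep_preserves ht hs ih
      exact fun i => ⟨(hmem i).1, (hmem i).2, ht i⟩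
    · rw [hm]
      ext e
      simp only [Finset.mem_image, Finset.mem_univ, true_and]
      constructor
      · rintro ⟨i, rfl⟩
        exact ⟨i - 1, by simp⟩
      · rintro ⟨i, rfl⟩
        exact ⟨i + 1, rfl⟩

namespace IsCycle

variable {X : Finset (Fin m)} {L : Rotation m}

lemma exists_link (h : M.IsCycle X L) {x : Fin m} (hx : x ∈ L.minus) :
    ∃ a b, M.Link X x a b ∧ a ∈ L.plus ∧ b ∈ L.minus := by
  obtain ⟨k, x, a, -, hl, hp, hm⟩ := h
  rw [hm] at hx
  obtain ⟨i, -, rfl⟩ := Finset.mem_image.1 hx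
  exact ⟨_, _, hl i, by simp [hp], by simp [hm]⟩

lemma exists_link_of_plus (h : M.IsCycle X L) {a : Fin m} (ha : a ∈ L.plus) :
    ∃ x b, M.Link X x a b ∧ x ∈ L.minus ∧ b ∈ L.minus := by
  obtain ⟨k, x, a, -, hl, hp, hm⟩ := h
  rw [hp] at ha
  obtain ⟨i, -, rfl⟩ := Finset.mem_image.1 ha
  exact ⟨_, _, hl i, by simp [hm], by simp [hm]⟩

lemma exists_link_to (h : M.IsCycle X L) {b : Fin m} (hb : b ∈ L.minus) :
    ∃ x a, M.Link X x a b ∧ x ∈ L.minus ∧ a ∈ L.plus := by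
  obtain ⟨k, x, a, -, hl, hp, hm⟩ := h
  rw [hm] at hb
  obtain ⟨i, -, rfl⟩ := Finset.mem_image.1 hb
  have := hl (i - 1)
  rw [sub_add_cancel] at this
  exact ⟨_, _, this, by simp [hm], by simp [hp]⟩

lemma minus_nonempty (h : M.IsCycle X L) : L.minus.Nonempty := by
  obtain ⟨k, x, a, -, hl, hp, hm⟩ := h
  exact ⟨x 0, by simp [hm]⟩

lemma minus_subset (h : M.IsCycle X L) : L.minus ⊆ X := by
  intro x hx
  obtain ⟨a, b, hl, -⟩ := h.exists_link hx
  exact hl.mem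

lemma not_mem_plus (h : M.IsCycle X L) (hX : M.Stable X) {a : Fin m} (ha : a ∈ L.plus) :
    a ∉ X := by
  obtain ⟨x, b, hl, -⟩ := h.exists_link_of_plus ha
  exact hl.not_mem hX

/-- A set that is closed under successors contains all of the cycle or nothing of it. -/
lemma forall_mem (h : M.IsCycle X L) (P : Fin m → Prop)
    (hP : ∀ x a b, x ∈ L.minus → M.Link X x a b → P x → P b) {x₀ : Fin m} (hx₀ : x₀ ∈ L.minus)
    (h₀ : P x₀) : ∀ x ∈ L.minus, P x := by
  obtain ⟨k, x, a, -, hl, hp, hm⟩ := h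
  rw [hm] at hx₀
  obtain ⟨i, -, rfl⟩ := Finset.mem_image.1 hx₀
  have key : ∀ j, P (x (i + j)) := by
    intro j
    induction j using Fin.induction with
    | zero => simpa using h₀
    | succ j ih =>
      have := hP _ _ _ (by simp [hm]) (hl (i + j.castSucc)) ih
      rwa [add_assoc, Fin.coeSucc_eq_succ] at this
  intro y hy
  rw [hm] at hy
  obtain ⟨j, -, rfl⟩ := Finset.mem_image.1 hy
  have := key (j - i)
  rwa [add_sub_cancel] at this

/-- Both rotations are orbits of the same successor map, so a common element makes them equal. -/
lemma eq_of_subset {L' : Rotation m} (h : M.IsCycle X L) (h' : M.IsCycle X L') (hX : M.Stable X)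
    {x : Fin m} (hx : x ∈ L.minus) (hx' : x ∈ L'.minus) : L = L' := by
  have key : ∀ {L L' : Rotation m}, M.IsCycle X L → M.IsCycle X L' → x ∈ L.minus → x ∈ L'.minus →
      L.minus ⊆ L'.minus ∧ L.plus ⊆ L'.plus := by
    intro L L' h h' hx hx'
    have h1 : L.minus ⊆ L'.minus := by
      intro y hy
      refine h.forall_mem (· ∈ L'.minus) (fun x a b _ hl hx => ?_) hx hx' y hy
      obtain ⟨a', b', hl', -, hb'⟩ := h'.exists_link hx
      rwa [(hl.unique hl' hX).2]
    refine ⟨h1, fun a ha => ?_⟩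
    obtain ⟨y, b, hl, hy, -⟩ := h.exists_link_of_plus ha
    obtain ⟨a', b', hl', ha', -⟩ := h'.exists_link (h1 hy)
    rwa [(hl.unique hl' hX).1]
  exact Rotation.eq_of ((key h h' hx hx').2.antisymm (key h' h hx' hx).2)
    ((key h h' hx hx').1.antisymm (key h' h hx' hx).1)

lemma eq_of_wk_plus (h : M.IsCycle X L) (hX : M.Stable X) {a a' : Fin m} (ha : a ∈ L.plus)
    (ha' : a' ∈ L.plus) (hw : M.wk a = M.wk a') : a = a' := by
  obtain ⟨x, b, hl, -⟩ := h.exists_link_of_plus ha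
  obtain ⟨x', b', hl', -⟩ := h.exists_link_of_plus ha'
  have : x = x' := hX.eq_of_wk hl.mem hl'.mem (by rw [← hl.wk_eq, ← hl'.wk_eq, hw])
  subst this
  exact (hl.unique hl' hX).1

lemma card_eq (h : M.IsCycle X L) (hX : M.Stable X) : L.plus.card = L.minus.card := by
  obtain ⟨k, x, a, hx, hl, hp, hm⟩ := h
  rw [hp, hm, Finset.card_image_of_injective _ hx, Finset.card_image_of_injective]
  intro i j hij
  apply hx
  refine hX.eq_of_wk (hl i).mem (hl j).mem ?_
  rw [← (hl i).wk_eq, ← (hl j).wk_eq, hij]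

lemma disjoint_plus (h : M.IsCycle X L) (hX : M.Stable X) {X' : Finset (Fin m)} (hX' : X' ⊆ X) :
    Disjoint X' L.plus := by
  rw [Finset.disjoint_left]
  exact fun e he he' => h.not_mem_plus hX he' (hX' he)

lemma card_app (h : M.IsCycle X L) (hX : M.Stable X) : (L.app X).card = X.card := by
  rw [Rotation.app, Finset.card_union_of_disjoint (h.disjoint_plus hX Finset.sdiff_subset),
    h.card_eq hX, Finset.card_sdiff_add_card_eq_card h.minus_subset]

/-- Every edge of `L.minus` is displaced by some single edge of `L.plus`, hence also by all of them
together; size monotonicity leaves no room for further rejections. -/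
lemma ch_union (h : M.IsCycle X L) (hX : M.Stable X) : M.ch (X ∪ L.plus) = L.app X := by
  apply Finset.eq_of_subset_of_card_le
  · intro e he
    have h1 := M.ch_subset _ he
    rw [Rotation.app, Finset.mem_union, Finset.mem_sdiff]
    rw [Finset.mem_union] at h1
    refine h1.imp_left fun h2 => ⟨h2, fun h3 => ?_⟩
    obtain ⟨x, a, hl, -, ha⟩ := h.exists_link_to h3
    refine hl.not_mem_ch hX (M.ch_subst ?_ he (Finset.mem_insert_of_mem h2))
    exact Finset.insert_subset (Finset.mem_union_right _ ha) Finset.subset_union_left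
  · rw [h.card_app hX]
    have := M.ch_card (Z := X ∪ L.plus) (Z' := X) Finset.subset_union_left
    rwa [hX.ch_self] at this

lemma union_app (X : Finset (Fin m)) (L : Rotation m) : X ∪ L.app X = X ∪ L.plus := by
  ext e
  simp only [Rotation.app, Finset.mem_union, Finset.mem_sdiff]
  tauto

lemma le_app (h : M.IsCycle X L) (hX : M.Stable X) : M.Le X (L.app X) := by
  rw [Le, union_app, h.ch_union hX]

lemma not_mem_app (h : M.IsCycle X L) (hX : M.Stable X) {x : Fin m} (hx : x ∈ L.minus) :
    x ∉ L.app X := by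
  rw [Rotation.app, Finset.mem_union, Finset.mem_sdiff]
  rintro (h1 | h1)
  · exact h1.2 hx
  · exact h.not_mem_plus hX h1 (h.minus_subset hx)

/-- An edge wanted by its firm afterwards was wanted before, so its worker had a better edge `x` in
`X`. If `x` was exchanged for `a`, the edge cannot lie between `a` and `x`, as `a` was the best
candidate; so `a` is better as well. -/
lemma stable_app (h : M.IsCycle X L) (hX : M.Stable X) : M.Stable (L.app X) := by
  have hle := h.le_app hX
  have hch : M.ch (L.app X) = L.app X := by
    rw [M.ch_consistent (Z := X ∪ L.app X) Finset.subset_union_right, hle]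
    rw [hle]
  have huniq : ∀ x ∈ X \ L.minus, ∀ a ∈ L.plus, M.wk x ≠ M.wk a := by
    intro x hx a ha hw
    obtain ⟨x', b, hl, hx', -⟩ := h.exists_link_of_plus ha
    have := hX.eq_of_wk (Finset.mem_sdiff.1 hx).1 hl.mem (hw.trans hl.wk_eq)
    subst this
    exact (Finset.mem_sdiff.1 hx).2 hx'
  rw [stable_iff]
  refine ⟨fun x hx y hy hw => ?_, hch, fun e he hc => ?_⟩
  · rw [Rotation.app, Finset.mem_union] at hx hy
    rcases hx with hx | hx <;> rcases hy with hy | hy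
    · exact hX.eq_of_wk (Finset.mem_sdiff.1 hx).1 (Finset.mem_sdiff.1 hy).1 hw
    · exact absurd hw (huniq x hx y hy)
    · exact absurd hw.symm (huniq y hy x hx)
    · exact h.eq_of_wk_plus hX hx hy hw
  · have hcX : e ∈ M.ch (insert e X) := by
      by_contra hn
      exact hle.not_mem_ch hn hc
    by_cases heX : e ∈ X
    · exfalso
      have h1 : M.ch (insert e (L.app X)) = L.app X := by
        rw [M.ch_consistent (Z := X ∪ L.app X), hle]
        · exact Finset.insert_subset (Finset.mem_union_left _ heX) Finset.subset_union_right
        · rw [hle]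
          exact Finset.subset_insert _ _
      rw [h1] at hc
      exact he hc
    · obtain ⟨x, hx, hw, hr⟩ := hX.exists_better heX hcX
      by_cases hxm : x ∈ L.minus
      · obtain ⟨a, b, hl, ha, -⟩ := h.exists_link hxm
        have haX' : a ∈ L.app X := Finset.mem_union_right _ ha
        have haw := hl.wk_eq.trans hw
        refine ⟨a, haX', haw, ?_⟩
        rcases lt_trichotomy (M.rk e) (M.rk a) with h1 | h1 | h1
        · exact h1
        · exact absurd haX' (by rwa [← M.rk_inj haw.symm h1])
        · exact absurd hcX (hl.between e hw.symm h1 hr)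
      · exact ⟨x, Finset.mem_union_left _ (Finset.mem_sdiff.2 ⟨hx, hxm⟩), hw, hr⟩

/-- A rotation that moves nothing fixed by `Y` does not lead beyond `Y`. -/
lemma app_le (h : M.IsCycle X L) (hX : M.Stable X) {Y : Finset (Fin m)} (hY : M.Stable Y)
    (hle : M.Le X Y) (hd : ∀ x ∈ L.minus, x ∉ Y) : M.Le (L.app X) Y := by
  -- Adding any one edge of `L.plus` to `X ∪ Y` leaves the choice `Y` unchanged by `Le.exists_link`;
  -- substitutability then handles all of them at once.
  have h1 : M.ch (X ∪ Y ∪ L.plus) ⊆ Y := by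
    intro e he
    have key : ∀ a ∈ L.plus, e ∈ insert a (X ∪ Y) → e ∈ Y := by
      intro a ha hea
      obtain ⟨x, b, hl, hx, -⟩ := h.exists_link_of_plus ha
      obtain ⟨a', b', hl', -, hc⟩ := hle.exists_link hX hY hl.mem (hd x hx)
      rw [← (hl.unique hl' hX).1] at hc
      rw [← hc]
      refine M.ch_subst ?_ he hea
      exact Finset.insert_subset (Finset.mem_union_right _ ha) Finset.subset_union_left
    obtain ⟨x, hx⟩ := h.minus_nonempty
    obtain ⟨a, -, -, ha, -⟩ := h.exists_link hx
    rcases Finset.mem_union.1 (M.ch_subset _ he) with h2 | h2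
    · exact key a ha (Finset.mem_insert_of_mem h2)
    · exact key e h2 (Finset.mem_insert_self _ _)
  have h2 : M.ch (X ∪ Y ∪ L.plus) = Y := by
    rw [← M.ch_consistent (Z' := Y) _ h1, hY.ch_self]
    exact Finset.subset_union_right.trans Finset.subset_union_left
  rw [Le, M.ch_consistent (Z := X ∪ Y ∪ L.plus), h2]
  · intro e
    simp only [Rotation.app, Finset.mem_union, Finset.mem_sdiff]
    tauto
  · rw [h2]
    exact Finset.subset_union_right

end IsCycle

lemma IsCycle.of_links {X Y : Finset (Fin m)} {L : Rotation m} (h : M.IsCycle X L)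
    (hl : ∀ x a b, x ∈ L.minus → a ∈ L.plus → b ∈ L.minus → M.Link X x a b → M.Link Y x a b) :
    M.IsCycle Y L := by
  obtain ⟨k, x, a, hx, h, hp, hm⟩ := h
  exact ⟨k, x, a, hx, fun i => hl _ _ _ (by simp [hm]) (by simp [hp]) (by simp [hm]) (h i), hp, hm⟩

/-- A rotation generated by `X` is generated by every greater `Y` or leads towards it. -/
lemma IsCycle.persist {X Y : Finset (Fin m)} {L : Rotation m} (h : M.IsCycle X L)
    (hX : M.Stable X) (hY : M.Stable Y) (hle : M.Le X Y) :
    M.IsCycle Y L ∨ (∀ x ∈ L.minus, x ∉ Y) ∧ M.Le (L.app X) Y := by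
  by_cases hall : ∀ x ∈ L.minus, x ∈ Y
  · left
    exact h.of_links fun x a b hx _ hb hl => hl.persist hX hY hle (hall x hx) (hall b hb)
  · right
    push Not at hall
    obtain ⟨x₀, hx₀, hx₀Y⟩ := hall
    have : ∀ x ∈ L.minus, x ∉ Y := by
      -- Once one edge of the cycle is given up on the way to `Y`, so is its successor, and thus the
      -- whole cycle.
      refine h.forall_mem (· ∉ Y) (fun x a b hx hl hxY => ?_) hx₀ hx₀Y
      obtain ⟨a', b', hl', hb', -⟩ := hle.exists_link hX hY hl.mem hxY
      rwa [(hl.unique hl' hX).2]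
    exact ⟨this, h.app_le hX hY hle this⟩

/-- The other alternative of `IsCycle.persist` would put an edge of `L.minus` into `L'.minus`, and
then the two rotations coincide. -/
lemma IsCycle.diamond {X : Finset (Fin m)} {L L' : Rotation m} (h : M.IsCycle X L)
    (h' : M.IsCycle X L') (hX : M.Stable X) (hne : L ≠ L') : M.IsCycle (L'.app X) L := by
  rcases h.persist hX (h'.stable_app hX) (h'.le_app hX) with h1 | ⟨h1, -⟩
  · exact h1
  · exfalso
    apply hne
    obtain ⟨x, hx⟩ := h.minus_nonempty
    refine h.eq_of_subset h' hX hx ?_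
    by_contra hx'
    exact h1 x hx (Finset.mem_union_left _ (Finset.mem_sdiff.2 ⟨h.minus_subset hx, hx'⟩))

/-- Added edges lie outside `X` and removed ones inside, so neither rotation undoes the other. -/
lemma IsCycle.app_comm {X : Finset (Fin m)} {L L' : Rotation m} (h : M.IsCycle X L)
    (h' : M.IsCycle X L') (hX : M.Stable X) : L.app (L'.app X) = L'.app (L.app X) := by
  ext e
  have h1 : e ∈ L.plus → e ∉ L'.minus := fun h1 h2 => h.not_mem_plus hX h1 (h'.minus_subset h2)
  have h2 : e ∈ L'.plus → e ∉ L.minus := fun h1 h2 => h'.not_mem_plus hX h1 (h.minus_subset h2)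
  simp only [Rotation.app, Finset.mem_union, Finset.mem_sdiff]
  tauto

/-! ### The converse exchange property, and existence of rotations. -/

lemma Stable.ch_insert_cases {X : Finset (Fin m)} (hX : M.Stable X) {e : Fin m} (he : e ∉ X)
    (hc : e ∈ M.ch (insert e X)) :
    M.ch (insert e X) = insert e X ∨ ∃ b ∈ X, M.ch (insert e X) = insert e (X.erase b) := by
  by_cases h : ∀ b ∈ X, b ∈ M.ch (insert e X)
  · exact Or.inl (Stable.ch_insert_of_forall e hc h)
  · push Not at h
    obtain ⟨b, hb, hb'⟩ := h
    refine Or.inr ⟨b, hb, Finset.eq_of_subset_of_card_le (fun d hd => ?_) ?_⟩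
    · have := M.ch_subset _ hd
      rw [Finset.mem_insert] at this ⊢
      refine this.imp_right fun h => Finset.mem_erase.2 ⟨?_, h⟩
      rintro rfl
      exact hb' hd
    · have := M.ch_card (Z := insert e X) (Z' := X) (Finset.subset_insert _ _)
      rw [hX.ch_self] at this
      rw [Finset.card_insert_of_notMem (by simp [he]), Finset.card_erase_add_one hb]
      exact this

lemma Le.ch_insert {X Y : Finset (Fin m)} (hle : M.Le X Y) (e : Fin m) :
    M.ch (insert e (X ∪ Y)) = M.ch (insert e Y) := by
  rw [Finset.insert_eq, Finset.insert_eq, Finset.union_comm, hle.ch_union, Finset.union_comm]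

/-- Whether `e` stays interesting for its firm depends only on the edge that it replaces. -/
lemma Le.mem_ch_of_forall {X Y : Finset (Fin m)} (hle : M.Le X Y) (hX : M.Stable X)
    (hY : M.Stable Y) {e : Fin m} (heX : e ∉ X) (hc : e ∈ M.ch (insert e X))
    (hb : ∀ b ∈ X, b ∉ M.ch (insert e X) → b ∈ Y) : e ∈ M.ch (insert e Y) := by
  by_contra hn
  have hsub : insert e X ⊆ insert e (X ∪ Y) :=
    Finset.insert_subset_insert _ Finset.subset_union_left
  have hD : M.ch (insert e Y) ⊆ Y := by
    intro d hd
    rcases Finset.mem_insert.1 (M.ch_subset _ hd) with rfl | h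
    · exact absurd hd hn
    · exact h
  have hcard := hle.card_eq hX hY
  -- Either way the rejection of `e` would make the choice too small: when nothing is displaced
  -- under `X`, a choice inside `Y` cannot reach the required size `X.card + 1`; when `b` is
  -- displaced, it would be lost on top of `e`.
  by_cases h : ∀ b ∈ X, b ∈ M.ch (insert e X)
  · have h1 := M.ch_card hsub
    rw [hle.ch_insert, Stable.ch_insert_of_forall e hc h, Finset.card_insert_of_notMem heX] at h1
    have := Finset.card_le_card hD
    omega
  · push Not at h
    obtain ⟨b, hbX, hb'⟩ := h
    have hbY := hb b hbX hb'
    have h1 : M.ch (insert e Y) ⊆ Y.erase b := by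
      intro d hd
      refine Finset.mem_erase.2 ⟨?_, hD hd⟩
      rintro rfl
      rw [← hle.ch_insert] at hd
      exact hb' (M.ch_subst hsub hd (Finset.mem_insert_of_mem hbX))
    have h2 := Finset.card_le_card h1
    have h3 := M.ch_card (Z := insert e Y) (Z' := Y) (Finset.subset_insert _ _)
    rw [hY.ch_self] at h3
    have := Finset.card_erase_add_one hbY
    omega

/-- If a link appears after each of two rotations, it was there before. -/
lemma Link.of_app_of_app {X : Finset (Fin m)} {L₁ L₂ : Rotation m} (h₁ : M.IsCycle X L₁)
    (h₂ : M.IsCycle X L₂) (hX : M.Stable X) (hne : L₁ ≠ L₂) {x a b₁ b₂ : Fin m}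
    (hl₁ : M.Link (L₁.app X) x a b₁) (hl₂ : M.Link (L₂.app X) x a b₂) (hx : x ∈ X) (hb₁ : b₁ ∈ X)
    (hb : b₂ ∈ L₁.app X) : M.Link X x a b₁ := by
  have hle₁ := h₁.le_app hX
  have hle₂ := h₂.le_app hX
  have hs₁ := h₁.stable_app hX
  have hs₂ := h₂.stable_app hX
  -- Distinct rotations generated by `X` remove disjoint sets, so each edge of `X` survives at least
  -- one of them.
  have hmem : ∀ d ∈ X, d ∈ L₁.app X ∨ d ∈ L₂.app X := by
    intro d hd
    simp only [Rotation.app, Finset.mem_union, Finset.mem_sdiff]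
    have := fun hd hd' => hne (h₁.eq_of_subset h₂ hX (x := d) hd hd')
    tauto
  have hsub : ∀ Y, insert a X ⊆ insert a (X ∪ Y) := fun Y =>
    Finset.insert_subset_insert _ Finset.subset_union_left
  have haX : a ∉ X := hX.not_mem_of_rk_lt hx hl₁.wk_eq hl₁.rk_lt
  have hac : a ∈ M.ch (insert a X) := by
    by_contra h
    exact hle₁.not_mem_ch h hl₁.mem_ch
  refine ⟨hx, hl₁.wk_eq, hl₁.rk_lt, fun e hw hr hr' hc => ?_, hb₁, ?_⟩
  · have heX : e ∉ X := hX.not_mem_of_rk_lt hx hw hr'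
    -- At most one edge would be displaced by `e`. Wherever it survives, `e` stays interesting,
    -- which contradicts the link there.
    have : (∀ b ∈ X, b ∉ M.ch (insert e X) → b ∈ L₁.app X) ∨
        (∀ b ∈ X, b ∉ M.ch (insert e X) → b ∈ L₂.app X) := by
      rcases hX.ch_insert_cases heX hc with h | ⟨b, hb, h⟩
      · left
        intro b hb hb'
        rw [h] at hb'
        exact absurd (Finset.mem_insert_of_mem hb) hb'
      · refine (hmem b hb).imp (fun hb'' d hd hd' => ?_) (fun hb'' d hd hd' => ?_) <;>
        · rw [h] at hd'
          have : d = b := by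
            by_contra hne
            exact hd' (Finset.mem_insert_of_mem (Finset.mem_erase.2 ⟨hne, hd⟩))
          rwa [this]
    rcases this with h | h
    · exact hl₁.between e hw hr hr' (hle₁.mem_ch_of_forall hX hs₁ heX hc h)
    · exact hl₂.between e hw hr hr' (hle₂.mem_ch_of_forall hX hs₂ heX hc h)
  · rcases hX.ch_insert_cases haX hac with h | ⟨b, hbX, h⟩
    · exfalso
      have h1 := M.ch_card (hsub (L₁.app X))
      rw [h, hle₁.ch_insert, hl₁.ch_eq, Finset.card_insert_of_notMem haX,
        Finset.card_insert_of_notMem (by simp [hl₁.not_mem hs₁])] at h1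
      have h2 := Finset.card_erase_add_one hl₁.mem'
      rw [h₁.card_app hX] at h2
      omega
    · have hbc : b ∉ M.ch (insert a X) := by
        rw [h]
        have : b ≠ a := by rintro rfl; exact haX hbX
        simp [this]
      have key : ∀ Y d, M.Le X Y → M.Link Y x a d → b ∈ Y → b = d := by
        intro Y d hle hl hbY
        by_contra hbd
        apply hbc
        refine M.ch_subst (hsub Y) ?_ (Finset.mem_insert_of_mem hbX)
        rw [hle.ch_insert, hl.ch_eq]
        exact Finset.mem_insert_of_mem (Finset.mem_erase.2 ⟨hbd, hbY⟩)
      -- The edge `b` displaced under `X` survives one of the rotations and is the displaced edge of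
      -- the link there. If it is `b₂`, then `hb` puts it into `L₁.app X` too, where the displaced
      -- edge is `b₁`.
      have : b = b₁ := by
        rcases hmem b hbX with h' | h'
        · exact key _ _ hle₁ hl₁ h'
        · have := key _ _ hle₂ hl₂ h'
          subst this
          exact key _ _ hle₁ hl₁ hb
      rw [h, this]

/-- A rotation that is generated after each of two rotations is generated before them. -/
lemma IsCycle.of_app_of_app {X : Finset (Fin m)} {L L₁ L₂ : Rotation m} (h₁ : M.IsCycle X L₁)
    (h₂ : M.IsCycle X L₂) (hX : M.Stable X) (hne : L₁ ≠ L₂) (h : M.IsCycle (L₁.app X) L)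
    (h' : M.IsCycle (L₂.app X) L) : M.IsCycle X L := by
  have hs₁ := h₁.stable_app hX
  have hsub : ∀ d ∈ L.minus, d ∈ X := by
    intro d hd
    have hd₁ := h.minus_subset hd
    have hd₂ := h'.minus_subset hd
    -- Such an edge would be added by both rotations, so that both move the edge of the same worker
    -- and coincide.
    by_contra hdX
    simp only [Rotation.app, Finset.mem_union, Finset.mem_sdiff, hdX, false_and, false_or]
      at hd₁ hd₂
    obtain ⟨x, b, hl, hx, -⟩ := h₁.exists_link_of_plus hd₁
    obtain ⟨x', b', hl', hx', -⟩ := h₂.exists_link_of_plus hd₂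
    have := hX.eq_of_wk hl.mem hl'.mem (hl.wk_eq.symm.trans hl'.wk_eq)
    subst this
    exact hne (h₁.eq_of_subset h₂ hX hx hx')
  refine h.of_links fun x a b hx ha hb hl => ?_
  obtain ⟨a', b', hl', ha', hb'⟩ := h'.exists_link hx
  have := h.eq_of_wk_plus hs₁ ha ha' (hl.wk_eq.trans hl'.wk_eq.symm)
  subst this
  exact Link.of_app_of_app h₁ h₂ hX hne hl hl' (hsub x hx) (hsub b hb) (h.minus_subset hb')

/-- A finite nonempty set on which every element has a successor contains a cycle. -/
lemma exists_cycle {α : Type*} (S : Finset α) (hS : S.Nonempty) (g : α → α)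
    (hg : ∀ x ∈ S, g x ∈ S) :
    ∃ (k : ℕ) (x : Fin (k + 1) → α), Function.Injective x ∧ (∀ i, x i ∈ S) ∧
      ∀ i, x (i + 1) = g (x i) := by
  obtain ⟨x₀, hx₀⟩ := hS
  have hit : ∀ n, g^[n] x₀ ∈ S := by
    intro n
    induction n with
    | zero => exact hx₀
    | succ n ih => rw [Function.iterate_succ_apply']; exact hg _ ih
  obtain ⟨i, -, j, -, hij, heq⟩ := Set.infinite_univ.exists_ne_map_eq_of_mapsTo (f := fun n => g^[n] x₀)
    (t := (S : Set α)) (fun n _ => hit n) S.finite_toSet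
  wlog hlt : i < j generalizing i j
  · exact this j i hij.symm heq.symm (lt_of_le_of_ne (not_lt.1 hlt) hij.symm)
  have hper : g^[i] x₀ ∈ Function.periodicPts g := by
    refine ⟨j - i, by omega, ?_⟩
    rw [Function.IsPeriodicPt, Function.IsFixedPt, ← Function.iterate_add_apply]
    rw [show j - i + i = j by omega]
    exact heq.symm
  set y := g^[i] x₀
  have hpos := Function.minimalPeriod_pos_of_mem_periodicPts hper
  obtain ⟨k, hk⟩ : ∃ k, Function.minimalPeriod g y = k + 1 := ⟨_, (Nat.succ_pred_eq_of_pos hpos).symm⟩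
  refine ⟨k, fun i => g^[i] y, fun i j hij => ?_, fun n => ?_, fun i => ?_⟩
  · apply Fin.ext
    exact Function.iterate_injOn_Iio_minimalPeriod (f := g) (x := y) (by simp [hk]; omega) (by simp [hk]; omega) hij
  · dsimp only [y]
    rw [← Function.iterate_add_apply]
    exact hit _
  · have : g (g^[i] y) = g^[i + 1] y := (Function.iterate_succ_apply' g i y).symm
    dsimp only
    rw [this, ← Function.iterate_mod_minimalPeriod_eq (n := (i : ℕ) + 1), hk, Fin.val_add]
    simp

/-- Below a greater stable matching `Y` there is a rotation that leads towards `Y`. -/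
lemma Le.exists_isCycle {X Y : Finset (Fin m)} (hle : M.Le X Y) (hX : M.Stable X)
    (hY : M.Stable Y) (hne : X ≠ Y) : ∃ L, M.IsCycle X L ∧ M.Le (L.app X) Y := by
  classical
  have hS : (X \ Y).Nonempty := by
    rw [Finset.sdiff_nonempty]
    intro h
    exact hne (Finset.eq_of_subset_of_card_le h (hle.card_eq hX hY).ge)
  choose! a b hl hb _ using fun x (hx : x ∈ X \ Y) =>
    hle.exists_link hX hY (Finset.mem_sdiff.1 hx).1 (Finset.mem_sdiff.1 hx).2
  -- The successor map sends `X \ Y` into itself, so one of its cycles consists of edges that `Y`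
  -- gives up.
  obtain ⟨k, x, hx, hxS, hxg⟩ := exists_cycle (X \ Y) hS b
    (fun x hx => Finset.mem_sdiff.2 ⟨(hl x hx).mem', hb x hx⟩)
  have hc : M.IsCycle X ⟨Finset.univ.image (a ∘ x), Finset.univ.image x⟩ :=
    ⟨k, x, a ∘ x, hx, fun i => by rw [hxg]; exact hl _ (hxS i), rfl, rfl⟩
  refine ⟨_, hc, hc.app_le hX hY hle fun d hd => ?_⟩
  obtain ⟨i, -, rfl⟩ := Finset.mem_image.1 hd
  exact (Finset.mem_sdiff.1 (hxS i)).2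

end CBM

/-! ### Routes and the exchange of rotations along them. -/

namespace CBM

variable {p q m : ℕ} {M : CBM p q m}

noncomputable instance : DecidableEq (Rotation m) := Classical.decEq _

lemma route_cons_iff {X Y : Finset (Fin m)} {L : Rotation m} {T : List (Rotation m)} :
    M.Route X Y (L :: T) ↔ M.IsRotation X L ∧ M.Route (L.app X) Y T := by
  constructor
  · rintro (_ | ⟨hL, h⟩)
    exact ⟨hL, h⟩
  · rintro ⟨hL, h⟩
    exact Route.cons hL h

lemma route_nil_iff {X Y : Finset (Fin m)} : M.Route X Y [] ↔ Y = X := by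
  constructor
  · rintro ⟨⟩
    rfl
  · rintro rfl
    exact Route.nil _

lemma route_append_iff {X Z : Finset (Fin m)} {T T' : List (Rotation m)} :
    M.Route X Z (T ++ T') ↔ ∃ Y, M.Route X Y T ∧ M.Route Y Z T' := by
  induction T generalizing X with
  | nil => simp [route_nil_iff]
  | cons L T ih =>
    simp only [List.cons_append, route_cons_iff, ih]
    constructor
    · rintro ⟨h, Y, h1, h2⟩
      exact ⟨Y, ⟨h, h1⟩, h2⟩
    · rintro ⟨Y, ⟨h, h1⟩, h2⟩
      exact ⟨h, Y, h1, h2⟩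

namespace Route

variable {X Y Z : Finset (Fin m)} {T T' : List (Rotation m)} {L : Rotation m}

lemma stable_and_le (h : M.Route X Y T) (hX : M.Stable X) : M.Stable Y ∧ M.Le X Y := by
  induction T generalizing X with
  | nil =>
    rw [route_nil_iff] at h
    subst h
    exact ⟨hX, hX.le_refl⟩
  | cons L T ih =>
    rw [route_cons_iff, isRotation_iff hX] at h
    obtain ⟨h1, h2⟩ := ih h.2 (h.1.stable_app hX)
    exact ⟨h1, (h.1.le_app hX).trans h2⟩

lemma stable (h : M.Route X Y T) (hX : M.Stable X) : M.Stable Y := (h.stable_and_le hX).1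

lemma le (h : M.Route X Y T) (hX : M.Stable X) : M.Le X Y := (h.stable_and_le hX).2

lemma eq_end (h : M.Route X Y T) (h' : M.Route X Z T) : Y = Z := by
  induction T generalizing X with
  | nil => rw [route_nil_iff] at h h'; rw [h, h']
  | cons L T ih =>
    rw [route_cons_iff] at h h'
    exact ih h.2 h'.2

/-- The edges removed by an applied rotation never come back, but generating it again would need
them. -/
lemma not_isCycle (h : M.Route X Y T) (hX : M.Stable X) (hL : L ∈ T) : ¬ M.IsCycle Y L := by
  intro hY
  obtain ⟨T₁, T₂, rfl⟩ := List.append_of_mem hL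
  obtain ⟨Z, h₁, h₂⟩ := route_append_iff.1 h
  have hZ := h₁.stable hX
  rw [route_cons_iff, isRotation_iff hZ] at h₂
  obtain ⟨hc, h₂⟩ := h₂
  have hs := hc.stable_app hZ
  obtain ⟨x, hx⟩ := hc.minus_nonempty
  exact hc.not_mem_app hZ hx ((hc.le_app hZ).mem_of_mem_of_mem (h₂.le hs) hZ hs (h₂.stable hs)
    (hc.minus_subset hx) (hY.minus_subset hx))

lemma nodup (h : M.Route X Y T) (hX : M.Stable X) : T.Nodup := by
  induction T generalizing X with
  | nil => exact List.nodup_nil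
  | cons L T ih =>
    have h0 := h
    rw [route_cons_iff, isRotation_iff hX] at h
    refine List.nodup_cons.2 ⟨fun hL => ?_, ih h.2 (h.1.stable_app hX)⟩
    obtain ⟨T₁, T₂, rfl⟩ := List.append_of_mem hL
    rw [← List.cons_append] at h0
    obtain ⟨Z, h₁, h₂⟩ := route_append_iff.1 h0
    rw [route_cons_iff, isRotation_iff (h₁.stable hX)] at h₂
    exact h₁.not_isCycle hX List.mem_cons_self h₂.1

/-- Iteration of `IsCycle.diamond`: a generated rotation can be carried past a route that does not
use it, and the route can be run after it. -/
lemma persist (h : M.Route X Y T) (hX : M.Stable X) (hL : M.IsCycle X L) (hLT : L ∉ T) :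
    M.IsCycle Y L ∧ M.Route (L.app X) (L.app Y) T := by
  induction T generalizing X with
  | nil =>
    rw [route_nil_iff] at h
    subst h
    exact ⟨hL, Route.nil _⟩
  | cons L₁ T ih =>
    rw [route_cons_iff, isRotation_iff hX] at h
    rw [List.mem_cons, not_or] at hLT
    obtain ⟨h1, h2⟩ := ih h.2 (h.1.stable_app hX) (hL.diamond h.1 hX hLT.1) hLT.2
    refine ⟨h1, route_cons_iff.2 ⟨?_, ?_⟩⟩
    · rw [isRotation_iff (hL.stable_app hX)]
      exact h.1.diamond hL hX (Ne.symm hLT.1)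
    · rwa [h.1.app_comm hL hX]

/-- By the diamond property, a rotation generated at the start can be moved to the front of a route
that uses it later. -/
lemma erase (h : M.Route X Y T) (hX : M.Stable X) (hL : M.IsCycle X L) (hLT : L ∈ T) :
    M.Route (L.app X) Y (T.erase L) := by
  induction T generalizing X with
  | nil => simp at hLT
  | cons L₁ T ih =>
    rw [route_cons_iff, isRotation_iff hX] at h
    by_cases he : L₁ = L
    · subst he
      rw [List.erase_cons_head]
      exact h.2
    · rw [List.erase_cons_tail (by simpa using he), route_cons_iff,
        isRotation_iff (hL.stable_app hX), h.1.app_comm hL hX]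
      refine ⟨h.1.diamond hL hX he, ?_⟩
      have hLT' : L ∈ T := (List.mem_cons.1 hLT).resolve_left (Ne.symm he)
      exact ih h.2 (h.1.stable_app hX) (hL.diamond h.1 hX (Ne.symm he)) hLT'

/-- A route to a state at which no rotation outside of `T'` is generated absorbs `T'`. -/
lemma exists_extension (h : M.Route X Y T) (h' : M.Route X Z T') (hX : M.Stable X)
    (hT : ∀ L ∈ T', L ∈ T ∨ ¬ M.IsCycle Y L) :
    ∃ T'', M.Route Z Y T'' ∧ (T' ++ T'').Perm T := by
  induction T' generalizing X T with
  | nil =>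
    rw [route_nil_iff] at h'
    subst h'
    exact ⟨T, h, List.Perm.refl _⟩
  | cons L T' ih =>
    have hnd := h'.nodup hX
    rw [route_cons_iff, isRotation_iff hX] at h'
    -- If `L` were not used in `T`, it would persist to the end `Y`, where `hT` forbids it.
    have hLT : L ∈ T := by
      by_contra hn
      exact (hT L List.mem_cons_self).elim hn fun h2 => h2 (h.persist hX h'.1 hn).1
    obtain ⟨T'', h1, h2⟩ := ih (h.erase hX h'.1 hLT) h'.2 (h'.1.stable_app hX) fun L₁ hL₁ =>
      (hT L₁ (List.mem_cons_of_mem _ hL₁)).imp_left fun h3 => by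
        refine (List.mem_erase_of_ne ?_).2 h3
        rintro rfl
        exact (List.nodup_cons.1 hnd).1 hL₁
    exact ⟨T'', h1, (List.Perm.cons L h2).trans (List.perm_cons_erase hLT).symm⟩

/-- Both first rotations are generated by `X`; each is carried past the other route. By induction
`L` is generated right after either of them, and `IsCycle.of_app_of_app` moves it back to `X`. -/
lemma isCycle_of_disjoint {Y₁ Y₂ : Finset (Fin m)} {T₁ T₂ : List (Rotation m)}
    (h₁ : M.Route X Y₁ T₁) (h₂ : M.Route X Y₂ T₂) (hX : M.Stable X) (hd : List.Disjoint T₁ T₂)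
    (hL₁ : M.IsCycle Y₁ L) (hL₂ : M.IsCycle Y₂ L) : M.IsCycle X L := by
  induction hn : T₁.length + T₂.length using Nat.strong_induction_on
    generalizing X Y₁ Y₂ T₁ T₂ with
  | _ n ih =>
    cases T₁ with
    | nil =>
      rw [route_nil_iff] at h₁
      rwa [← h₁]
    | cons L₁ T₁ =>
      cases T₂ with
      | nil =>
        rw [route_nil_iff] at h₂
        rwa [← h₂]
      | cons L₂ T₂ =>
        have hne₁ : L ≠ L₁ := by
          rintro rfl
          exact h₁.not_isCycle hX List.mem_cons_self hL₁
        have hne₂ : L ≠ L₂ := by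
          rintro rfl
          exact h₂.not_isCycle hX List.mem_cons_self hL₂
        have h₁' := h₁
        have h₂' := h₂
        rw [route_cons_iff, isRotation_iff hX] at h₁' h₂'
        have hn₁ : L₁ ∉ L₂ :: T₂ := hd List.mem_cons_self
        have hn₂ : L₂ ∉ L₁ :: T₁ := fun h => hd h List.mem_cons_self
        have hne : L₁ ≠ L₂ := fun h => hn₁ (h ▸ List.mem_cons_self)
        obtain ⟨k₁, r₁⟩ := h₂.persist hX h₁'.1 hn₁
        obtain ⟨k₂, r₂⟩ := h₁.persist hX h₂'.1 hn₂
        refine IsCycle.of_app_of_app h₁'.1 h₂'.1 hX hne ?_ ?_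
        · exact ih (T₁.length + (L₂ :: T₂).length) (by rw [← hn]; simp) h₁'.2 r₁
            (h₁'.1.stable_app hX) (fun _ h h' => hd (List.mem_cons_of_mem _ h) h') hL₁
            (hL₂.diamond k₁ (h₂.stable hX) hne₁) rfl
        · exact ih ((L₁ :: T₁).length + T₂.length) (by rw [← hn]; simp) r₂ h₂'.2
            (h₂'.1.stable_app hX) (fun _ h h' => hd h (List.mem_cons_of_mem _ h'))
            (hL₁.diamond k₂ (h₁.stable hX) hne₂) hL₂ rfl

lemma _root_.List.exists_first {α : Type*} (P : α → Prop) (l : List α) (h : ∃ c ∈ l, P c) :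
    ∃ l₁ c l₂, l = l₁ ++ c :: l₂ ∧ P c ∧ ∀ x ∈ l₁, ¬ P x := by
  induction l with
  | nil => simp at h
  | cons a l ih =>
    by_cases ha : P a
    · exact ⟨[], a, l, rfl, ha, by simp⟩
    · obtain ⟨c, hc, hP⟩ := h
      obtain ⟨l₁, d, l₂, rfl, h1, h2⟩ := ih ⟨c, (List.mem_cons.1 hc).resolve_left (by
        rintro rfl; exact ha hP), hP⟩
      exact ⟨a :: l₁, d, l₂, rfl, h1, by simpa [ha] using h2⟩

/-- If a rotation is generated at the ends of two routes, it is so after some of their common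
rotations. -/
lemma exists_common {Y₁ Y₂ : Finset (Fin m)} {T₁ T₂ : List (Rotation m)}
    (h₁ : M.Route X Y₁ T₁) (h₂ : M.Route X Y₂ T₂) (hX : M.Stable X)
    (hL₁ : M.IsCycle Y₁ L) (hL₂ : M.IsCycle Y₂ L) :
    ∃ T Z, M.Route X Z T ∧ M.IsCycle Z L ∧ T ⊆ T₁ ∧ T ⊆ T₂ := by
  induction hn : T₁.length using Nat.strong_induction_on generalizing X T₁ T₂ with
  | _ n ih =>
    by_cases hd : List.Disjoint T₁ T₂
    · exact ⟨[], X, Route.nil _, h₁.isCycle_of_disjoint h₂ hX hd hL₁ hL₂, by simp, by simp⟩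
    · have hex : ∃ c ∈ T₁, c ∈ T₂ := by
        by_contra! h
        exact hd fun c h1 h2 => h c h1 h2
      -- The parts of the two routes before `c` have nothing in common, so `c` is already generated
      -- by `X` and can be moved to the front of both.
      obtain ⟨l₁, c, l₂, rfl, hc, hl₁⟩ := List.exists_first (· ∈ T₂) T₁ hex
      obtain ⟨k₁, k₂, rfl⟩ := List.append_of_mem hc
      have hcX : M.IsCycle X c := by
        obtain ⟨Z₁, r₁, s₁⟩ := route_append_iff.1 h₁
        obtain ⟨Z₂, r₂, s₂⟩ := route_append_iff.1 h₂
        rw [route_cons_iff, isRotation_iff (r₁.stable hX)] at s₁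
        rw [route_cons_iff, isRotation_iff (r₂.stable hX)] at s₂
        exact r₁.isCycle_of_disjoint r₂ hX
          (fun x h h' => hl₁ x h (List.mem_append_left _ h')) s₁.1 s₂.1
      have hc₁ : c ∈ l₁ ++ c :: l₂ := by simp
      obtain ⟨T, Z, r, hZ, hs₁, hs₂⟩ := ih _ (by
          rw [← hn, List.length_erase_of_mem hc₁]
          have := List.length_pos_of_mem hc₁
          omega) (h₁.erase hX hcX hc₁) (h₂.erase hX hcX hc) (hcX.stable_app hX) rfl
      refine ⟨c :: T, Z, route_cons_iff.2 ⟨(isRotation_iff hX c).2 hcX, r⟩, hZ, ?_, ?_⟩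
      · exact List.cons_subset.2 ⟨hc₁, fun _ h => List.erase_subset (hs₁ h)⟩
      · exact List.cons_subset.2 ⟨hc, fun _ h => List.erase_subset (hs₂ h)⟩

/-- The links of a rotation are the same wherever it is generated. -/
lemma link_iff {Y₁ Y₂ : Finset (Fin m)} {T₁ T₂ : List (Rotation m)}
    (h₁ : M.Route X Y₁ T₁) (h₂ : M.Route X Y₂ T₂) (hX : M.Stable X)
    (hL₁ : M.IsCycle Y₁ L) (hL₂ : M.IsCycle Y₂ L) {x a b : Fin m} (hx : x ∈ L.minus)
    (hl : M.Link Y₁ x a b) : M.Link Y₂ x a b := by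
  obtain ⟨T, Z, r, hZ, hs₁, hs₂⟩ := h₁.exists_common h₂ hX hL₁ hL₂
  have hZs := r.stable hX
  obtain ⟨a', b', hl', ha', hb'⟩ := hZ.exists_link hx
  obtain ⟨T₁', r₁, -⟩ := h₁.exists_extension r hX fun L hL => Or.inl (hs₁ hL)
  obtain ⟨T₂', r₂, -⟩ := h₂.exists_extension r hX fun L hL => Or.inl (hs₂ hL)
  -- Both ends are reached from the common set `Z`, so the link at `Z` persists to either;
  -- uniqueness identifies it with the given one.
  have k₁ := hl'.persist hZs (h₁.stable hX) (r₁.le hZs) (hL₁.minus_subset hx) (hL₁.minus_subset hb')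
  have k₂ := hl'.persist hZs (h₂.stable hX) (r₂.le hZs) (hL₂.minus_subset hx) (hL₂.minus_subset hb')
  obtain ⟨rfl, rfl⟩ := hl.unique k₁ (h₁.stable hX)
  exact k₂

end Route

/-! ### Rank sums and full routes. -/

lemma IsCycle.sum_rk_lt {X : Finset (Fin m)} {L : Rotation m} (h : M.IsCycle X L)
    (hX : M.Stable X) : ∑ a ∈ L.plus, M.rk a < ∑ x ∈ L.minus, M.rk x := by
  obtain ⟨k, x, a, hx, hl, hp, hm⟩ := h
  have ha : Function.Injective a := by
    intro i j hij
    apply hx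
    refine hX.eq_of_wk (hl i).mem (hl j).mem ?_
    rw [← (hl i).wk_eq, ← (hl j).wk_eq, hij]
  rw [hp, hm, Finset.sum_image (fun _ _ _ _ h => ha h), Finset.sum_image (fun _ _ _ _ h => hx h)]
  exact Finset.sum_lt_sum_of_nonempty Finset.univ_nonempty fun i _ => (hl i).rk_lt

lemma IsCycle.sum_rk_app {X : Finset (Fin m)} {L : Rotation m} (h : M.IsCycle X L)
    (hX : M.Stable X) : ∑ e ∈ L.app X, M.rk e + ∑ x ∈ L.minus, M.rk x =
      ∑ e ∈ X, M.rk e + ∑ a ∈ L.plus, M.rk a := by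
  rw [Rotation.app, Finset.sum_union (h.disjoint_plus hX Finset.sdiff_subset),
    ← Finset.sum_sdiff h.minus_subset]
  ring

/-- Each rank counts edges of one worker, and a stable set contains at most one edge per worker; so
no edge is counted twice. This linear bound is the basis of the running time. -/
lemma Stable.sum_rk_le {X : Finset (Fin m)} (hX : M.Stable X) : ∑ e ∈ X, M.rk e ≤ m := by
  classical
  unfold rk
  rw [← Finset.card_biUnion]
  · exact (Finset.card_le_univ _).trans (by simp)
  · intro x hx y hy hne
    rw [Function.onFun, Finset.disjoint_left]
    intro d hd hd'
    simp only [Finset.mem_filter, Finset.mem_univ, true_and] at hd hd'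
    exact hne (hX.eq_of_wk hx hy (hd.1.symm.trans hd'.1))

lemma IsXmin.le {X Y : Finset (Fin m)} (h : M.IsXmin X) (hY : M.Stable Y) : M.Le X Y :=
  (M.firmsPrefer_iff Y X).1 (h.2 Y hY)

lemma IsXmax.le {X Y : Finset (Fin m)} (h : M.IsXmax X) (hY : M.Stable Y) : M.Le Y X :=
  (M.firmsPrefer_iff X Y).1 (h.2 Y hY)

/-- A stable matching that generates no rotation is the greatest one. -/
lemma IsXmin.isXmax {X₀ Y : Finset (Fin m)} (h : M.IsXmin X₀) (hY : M.Stable Y)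
    (hT : ∀ L, ¬ M.IsCycle Y L) : M.IsXmax Y := by
  refine ⟨hY, fun Z hZ => (M.firmsPrefer_iff Y Z).2 ?_⟩
  -- The walk from `X₀` to `Z` by rotations stays below `Y`: since `Y` generates no rotation, each
  -- one applied must lead towards `Y`. The rank sum makes it end.
  have key : ∀ n W, ∑ e ∈ W, M.rk e = n → M.Stable W → M.Le W Y → M.Le W Z → M.Le Z Y := by
    intro n
    induction n using Nat.strong_induction_on with
    | _ n ih =>
      intro W hn hW hWY hWZ
      by_cases heq : W = Z
      · rwa [← heq]
      · obtain ⟨L, hL, hLZ⟩ := hWZ.exists_isCycle hW hZ heq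
        have h1 := hL.sum_rk_lt hW
        have h2 := hL.sum_rk_app hW
        have h3 := (hL.persist hW hY hWY).resolve_left (hT L)
        exact ih _ (by omega) _ rfl (hL.stable_app hW) h3.2 hLZ
  exact key _ X₀ rfl h.1 (h.le hY) (h.le hZ)

lemma IsXmax.not_isCycle {Y : Finset (Fin m)} (h : M.IsXmax Y) (L : Rotation m) :
    ¬ M.IsCycle Y L := by
  intro hL
  have h1 := (h.le (hL.stable_app h.1)).antisymm (hL.le_app h.1)
  obtain ⟨x, hx⟩ := hL.minus_nonempty
  apply hL.not_mem_app h.1 hx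
  rw [h1]
  exact hL.minus_subset hx

/-- Replaces the unknown greatest stable set by a local condition: the route ends where no rotation
is generated. -/
lemma fullRoute_iff {X₀ : Finset (Fin m)} (h : M.IsXmin X₀) (T : List (Rotation m)) :
    M.FullRoute T ↔ ∃ Y, M.Route X₀ Y T ∧ ∀ L, ¬ M.IsCycle Y L := by
  constructor
  · rintro ⟨X, Y, hX, hY, hr⟩
    have : X = X₀ := (hX.le h.1).antisymm (h.le hX.1)
    subst this
    exact ⟨Y, hr, hY.not_isCycle⟩
  · rintro ⟨Y, hr, hY⟩
    exact ⟨X₀, Y, h, h.isXmax (hr.stable h.1) hY, hr⟩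

lemma _root_.List.pair_sublist_iff_of_nodup {α : Type*} {a b : α} {l₁ l₂ : List α}
    (h : (l₁ ++ b :: l₂).Nodup) : [a, b].Sublist (l₁ ++ b :: l₂) ↔ a ∈ l₁ := by
  constructor
  · intro hs
    induction l₁ with
    | nil =>
      rw [List.nil_append] at h hs
      have hb := (List.nodup_cons.1 h).1
      exfalso
      apply hb
      cases hs with
      | cons _ h => exact h.subset (by simp)
      | cons_cons _ h => exact h.subset (by simp)
    | cons c l₁ ih =>
      rw [List.cons_append] at hs h
      cases hs with
      | cons _ h' => exact List.mem_cons_of_mem _ (ih (List.nodup_cons.1 h).2 h')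
      | cons_cons _ h' => exact List.mem_cons_self
  · intro ha
    exact (List.singleton_sublist.2 ha).append (List.singleton_sublist.2 List.mem_cons_self)

lemma fullRoute_nodup {X₀ : Finset (Fin m)} (h₀ : M.IsXmin X₀) {T : List (Rotation m)} (hT : M.FullRoute T) : T.Nodup := by
  obtain ⟨Y, hr, -⟩ := (fullRoute_iff h₀ T).1 hT
  exact hr.nodup h₀.1

lemma precedes_trans {X₀ : Finset (Fin m)} (h₀ : M.IsXmin X₀) {R R' R'' : Rotation m} (h : M.Precedes R R') (h' : M.Precedes R' R'') :
    M.Precedes R R'' := by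
  refine ⟨h.1, h'.2.1, fun T hT => ?_⟩
  have hnd := fullRoute_nodup h₀ hT
  have h1 := h.2.2 T hT
  have h2 := h'.2.2 T hT
  obtain ⟨l₁, l₂, rfl⟩ := List.append_of_mem (h2.subset (by simp : R'' ∈ [R', R'']))
  rw [List.pair_sublist_iff_of_nodup hnd] at h2 ⊢
  obtain ⟨k₁, k₂, rfl⟩ := List.append_of_mem h2
  rw [List.append_assoc, List.cons_append] at h1 hnd
  rw [List.pair_sublist_iff_of_nodup hnd] at h1
  exact List.mem_append_left _ h1

/-! ### The poset of rotations controls which rotations are generated. -/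

section Poset

variable {X₀ Y₀ : Finset (Fin m)} {T₀ : List (Rotation m)} (h₀ : M.IsXmin X₀)
  (hr₀ : M.Route X₀ Y₀ T₀) (hT₀ : ∀ L, ¬ M.IsCycle Y₀ L)
include h₀ hr₀ hT₀

/-- `Route.exists_extension` absorbs one full route into the other; the remainder is empty because
no rotation is generated at the end of a full route. -/
lemma perm_of_fullRoute {T : List (Rotation m)} (hT : M.FullRoute T) : T.Perm T₀ := by
  obtain ⟨Y, hr, hY⟩ := (fullRoute_iff h₀ T).1 hT
  obtain ⟨T', hr', hp⟩ := hr₀.exists_extension hr h₀.1 fun L _ => Or.inr (hT₀ L)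
  cases T' with
  | nil => simpa using hp
  | cons L T' =>
    rw [route_cons_iff, isRotation_iff (hr.stable h₀.1)] at hr'
    exact absurd hr'.1 (hY L)

lemma mem_rotations_iff (R : Rotation m) : R ∈ M.rotations ↔ R ∈ T₀ := by
  constructor
  · rintro ⟨T, hT, hR⟩
    exact (perm_of_fullRoute h₀ hr₀ hT₀ hT).subset hR
  · intro hR
    exact ⟨T₀, (fullRoute_iff h₀ T₀).2 ⟨Y₀, hr₀, hT₀⟩, hR⟩

lemma exists_fullRoute_append {X : Finset (Fin m)} {B : List (Rotation m)} (hB : M.Route X₀ X B) :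
    ∃ T, M.FullRoute (B ++ T) := by
  obtain ⟨T, hT, -⟩ := hr₀.exists_extension hB h₀.1 fun L _ => Or.inr (hT₀ L)
  exact ⟨T, (fullRoute_iff h₀ _).2 ⟨Y₀, route_append_iff.2 ⟨X, hB, hT⟩, hT₀⟩⟩

/-- A rotation is generated at the end of a route if and only if it has not been applied while all
its predecessors have. -/
theorem isCycle_iff {X : Finset (Fin m)} {B : List (Rotation m)} (hB : M.Route X₀ X B)
    {R : Rotation m} (hR : R ∈ T₀) :
    M.IsCycle X R ↔ R ∉ B ∧ ∀ R', M.Precedes R' R → R' ∈ B := by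
  have hX := hB.stable h₀.1
  constructor
  · intro hc
    refine ⟨fun h => hB.not_isCycle h₀.1 h hc, fun R' hR' => ?_⟩
    -- In a full route that starts with `B` and `R`, all predecessors of `R` must occur in `B`.
    have hB' : M.Route X₀ (R.app X) (B ++ [R]) := route_append_iff.2
      ⟨X, hB, route_cons_iff.2 ⟨(isRotation_iff hX R).2 hc, Route.nil _⟩⟩
    obtain ⟨T, hT⟩ := exists_fullRoute_append h₀ hr₀ hT₀ hB'
    have hnd := fullRoute_nodup h₀ hT
    rw [List.append_assoc, List.singleton_append] at hT hnd
    exact (List.pair_sublist_iff_of_nodup hnd).1 (hR'.2.2 _ hT)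
  · rintro ⟨hRB, hpre⟩
    -- A shortest route `D` after which `R` is generated turns out to consist of the rotations that
    -- have to come before `R`.
    have hex : ∃ n, ∃ D Z, M.Route X₀ Z D ∧ M.IsCycle Z R ∧ D.length = n := by
      obtain ⟨l₁, l₂, rfl⟩ := List.append_of_mem hR
      obtain ⟨Z, r, s⟩ := route_append_iff.1 hr₀
      rw [route_cons_iff, isRotation_iff (r.stable h₀.1)] at s
      exact ⟨_, l₁, Z, r, s.1, rfl⟩
    classical
    obtain ⟨D, Z, hD, hZ, hlen⟩ := Nat.find_spec hex
    -- The common rotations of `D` and `E` that suffice for `R` are no fewer than those of `D`, by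
    -- minimality; so they are all of `D`.
    have hmin : ∀ E W, M.Route X₀ W E → M.IsCycle W R → D ⊆ E := by
      intro E W hE hW
      obtain ⟨G, V, hG, hV, h1, h2⟩ := hD.exists_common hE h₀.1 hZ hW
      have h3 : Nat.find hex ≤ G.length := Nat.find_min' hex ⟨G, V, hG, hV, rfl⟩
      have h4 := (List.subperm_of_subset (hG.nodup h₀.1) h1).perm_of_length_le (by omega)
      exact fun x hx => h2 (h4.symm.subset hx)
    have hDB : D ⊆ B := by
      intro R' hR'
      apply hpre
      refine ⟨?_, (mem_rotations_iff h₀ hr₀ hT₀ R).2 hR, fun T hT => ?_⟩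
      · obtain ⟨T, hT⟩ := exists_fullRoute_append h₀ hr₀ hT₀ hD
        exact ⟨_, hT, List.mem_append_left _ hR'⟩
      · have hRT : R ∈ T := (perm_of_fullRoute h₀ hr₀ hT₀ hT).symm.subset hR
        have hnd := fullRoute_nodup h₀ hT
        obtain ⟨Y, hr, -⟩ := (fullRoute_iff h₀ T).1 hT
        obtain ⟨l₁, l₂, rfl⟩ := List.append_of_mem hRT
        obtain ⟨W, r, s⟩ := route_append_iff.1 hr
        rw [route_cons_iff, isRotation_iff (r.stable h₀.1)] at s
        exact (List.pair_sublist_iff_of_nodup hnd).2 (hmin l₁ W r s.1 hR')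
    -- Reorder `B` so that it starts with `D`; then `R` is generated after `D` and persists through
    -- the rest, which does not use it.
    obtain ⟨E, hE, hp⟩ := hB.exists_extension hD h₀.1 fun L hL => Or.inl (hDB hL)
    exact (hE.persist (hD.stable h₀.1) hZ fun h => hRB (hp.subset (List.mem_append_right _ h))).1

lemma precedes_mem {R R' : Rotation m} (h : M.Precedes R R') : R ∈ T₀ ∧ R' ∈ T₀ :=
  ⟨(mem_rotations_iff h₀ hr₀ hT₀ R).1 h.1, (mem_rotations_iff h₀ hr₀ hT₀ R').1 h.2.1⟩

lemma precedes_mem_left {R R' : Rotation m} (h : M.Precedes R R') {l₁ l₂ : List (Rotation m)}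
    (hl : T₀ = l₁ ++ R' :: l₂) : R ∈ l₁ := by
  have := h.2.2 T₀ ((fullRoute_iff h₀ T₀).2 ⟨Y₀, hr₀, hT₀⟩)
  have hnd := hr₀.nodup h₀.1
  rw [hl] at this hnd
  exact (List.pair_sublist_iff_of_nodup hnd).1 this

lemma precedes_irrefl (R : Rotation m) : ¬ M.Precedes R R := by
  intro h
  obtain ⟨l₁, l₂, hl⟩ := List.append_of_mem (precedes_mem h₀ hr₀ hT₀ h).1
  have h1 := precedes_mem_left h₀ hr₀ hT₀ h hl
  have hnd := hr₀.nodup h₀.1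
  rw [hl, List.nodup_append] at hnd
  exact hnd.2.2 R h1 R List.mem_cons_self rfl

end Poset

end CBM

/-! ### Immediate successors found greedily. -/

namespace CBM

variable {p q m : ℕ} {M : CBM p q m}

section Greedy

variable {X₀ Y₀ : Finset (Fin m)} {T₀ : List (Rotation m)} (h₀ : M.IsXmin X₀)
  (hr₀ : M.Route X₀ Y₀ T₀) (hT₀ : ∀ L, ¬ M.IsCycle Y₀ L)

open Classical in
variable (M) in
/-- The rotations of a list that can be applied before `R`. -/
noncomputable def before (R : Rotation m) (l : List (Rotation m)) : List (Rotation m) :=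
  l.filter fun R' => R' ≠ R ∧ ¬ M.Precedes R R'

lemma mem_before {R R' : Rotation m} {l : List (Rotation m)} :
    R' ∈ M.before R l ↔ R' ∈ l ∧ R' ≠ R ∧ ¬ M.Precedes R R' := by
  simp [before]

lemma before_append_of_precedes {R R' : Rotation m} (l : List (Rotation m))
    (h : R' = R ∨ M.Precedes R R') : M.before R (l ++ [R']) = M.before R l := by
  have : ¬ (R' ≠ R ∧ ¬ M.Precedes R R') := by tauto
  simp [before, List.filter_append, this]

lemma before_append_of_not_precedes {R R' : Rotation m} (l : List (Rotation m)) (hne : R' ≠ R)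
    (h : ¬ M.Precedes R R') : M.before R (l ++ [R']) = M.before R l ++ [R'] := by
  simp [before, List.filter_append, hne, h]

include h₀ hr₀ hT₀

/-- If `R'` need not wait for `R`, its predecessors occur earlier in the list and need not wait for
`R` either, so they have all been applied. Hence the test for availability decides comparability
with `R`. -/
lemma isCycle_before_iff {X : Finset (Fin m)} {R R' : Rotation m} {l r : List (Rotation m)}
    (hl : T₀ = l ++ R' :: r) (hX : M.Route X₀ X (M.before R l)) (hR : R ∈ T₀) (hne : R' ≠ R) :
    M.IsCycle X R' ↔ ¬ M.Precedes R R' := by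
  have hnd := hr₀.nodup h₀.1
  rw [isCycle_iff h₀ hr₀ hT₀ hX (by simp [hl])]
  constructor
  · rintro ⟨-, h⟩ hp
    exact (mem_before.1 (h R hp)).2.1 rfl
  · intro hn
    refine ⟨fun h => ?_, fun R'' h => mem_before.2 ⟨precedes_mem_left h₀ hr₀ hT₀ h hl, ?_, ?_⟩⟩
    · rw [hl, List.nodup_append] at hnd
      exact hnd.2.2 R' (mem_before.1 h).1 R' List.mem_cons_self rfl
    · rintro rfl
      exact hn h
    · exact fun h' => hn (precedes_trans h₀ h' h)

lemma isCycle_before_self {X : Finset (Fin m)} {R : Rotation m}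
    (hX : M.Route X₀ X (M.before R T₀)) (hR : R ∈ T₀) : M.IsCycle X R := by
  rw [isCycle_iff h₀ hr₀ hT₀ hX hR]
  refine ⟨fun h => (mem_before.1 h).2.1 rfl, fun R' h => mem_before.2
    ⟨(precedes_mem h₀ hr₀ hT₀ h).1, ?_, fun h' => ?_⟩⟩
  · rintro rfl
    exact precedes_irrefl h₀ hr₀ hT₀ _ h
  · exact precedes_irrefl h₀ hr₀ hT₀ _ (precedes_trans h₀ h h')

/-- After all rotations that need not wait for `R` and `R` itself have been applied, the generated
rotations are the immediate successors of `R`. -/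
lemma isCycle_after_iff {X : Finset (Fin m)} {R R' : Rotation m}
    (hX : M.Route X₀ X (M.before R T₀ ++ [R])) (hR : R ∈ T₀) (hR' : R' ∈ T₀) :
    M.IsCycle X R' ↔ M.ImmediatelyPrecedes R R' := by
  rw [isCycle_iff h₀ hr₀ hT₀ hX hR']
  simp only [List.mem_append, List.mem_singleton, mem_before, not_or]
  constructor
  · rintro ⟨⟨h1, h2⟩, h3⟩
    have hp : M.Precedes R R' := by
      by_contra hn
      exact h1 ⟨hR', h2, hn⟩
    refine ⟨hp, ?_⟩
    rintro ⟨R'', h4, h5⟩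
    rcases h3 R'' h5 with h6 | rfl
    · exact h6.2.2 h4
    · exact precedes_irrefl h₀ hr₀ hT₀ _ h4
  · rintro ⟨hp, hn⟩
    refine ⟨⟨fun h => h.2.2 hp, ?_⟩, fun R'' h => ?_⟩
    · rintro rfl
      exact precedes_irrefl h₀ hr₀ hT₀ _ hp
    · by_cases hne : R'' = R
      · exact Or.inr hne
      · exact Or.inl ⟨(precedes_mem h₀ hr₀ hT₀ h).1, hne, fun h' => hn ⟨R'', h', h⟩⟩

end Greedy

/-! ### Recorded rotations, the cost measure, and dead edges. -/

/-- The rotation that moves the edges `x` of the list `c` to the edges `A x`. -/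
def rotOf (A : Fin m → Fin m) (c : List (Fin m)) : Rotation m :=
  ⟨(c.map A).toFinset, c.toFinset⟩

lemma rotOf_congr {A A' : Fin m → Fin m} {c : List (Fin m)} (h : ∀ x ∈ c, A' x = A x) :
    rotOf A' c = rotOf A c := by
  rw [rotOf, rotOf, List.map_congr_left h]

/-- Fits the stack of the search: each entry is the successor of the entry after it, and the last
entry is the successor of the first. -/
lemma isCycle_rotOf {X : Finset (Fin m)} {A B : Fin m → Fin m} {l : List (Fin m)}
    (hne : l ≠ []) (hnd : l.Nodup) (hlk : ∀ x ∈ l, M.Link X x (A x) (B x))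
    (hB : List.IsChain (fun y z => B z = y) (l.getLast hne :: l)) :
    M.IsCycle X (rotOf A l) := by
  obtain ⟨k, hk⟩ : ∃ k, l.length = k + 1 :=
    ⟨l.length - 1, by have := List.length_pos_of_ne_nil hne; omega⟩
  -- The list is read backwards, because successors stand before their predecessors in it.
  let x : Fin (k + 1) → Fin m := fun i => l[k - i]
  have hxm : ∀ i, x i ∈ l := fun i => List.getElem_mem _
  refine ⟨k, x, A ∘ x, ?_, fun i => ?_, ?_, ?_⟩
  · intro i j hij
    have := (hnd.getElem_inj_iff).1 hij
    omega
  · have hBx : B (x i) = x (i + 1) := by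
      rw [List.isChain_iff_getElem] at hB
      have h1 := hB (k - i) (by simp; omega)
      rw [List.getElem_cons_succ] at h1
      change B l[k - i] = _
      rw [h1]
      by_cases hi : i = Fin.last k
      · subst hi
        simp only [x, Fin.last_add_one, Fin.val_last, Nat.sub_self, Fin.val_zero, Nat.sub_zero,
          List.getElem_cons_zero, List.getLast_eq_getElem]
        congr 1
        omega
      · have h2 : ((i + 1 : Fin (k + 1)) : ℕ) = i + 1 :=
          Fin.val_add_one_of_lt (Fin.lt_last_iff_ne_last.2 hi)
        have h3 : (i : ℕ) < k := by
          have := Fin.lt_last_iff_ne_last.2 hi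
          exact this
        simp only [x, h2]
        rw [List.getElem_cons, dif_neg (by omega)]
        congr 1
    rw [← hBx]
    exact hlk _ (hxm i)
  · ext e
    simp only [rotOf, List.mem_toFinset, List.mem_map, Finset.mem_image, Finset.mem_univ, true_and,
      Function.comp]
    constructor
    · rintro ⟨y, hy, rfl⟩
      obtain ⟨n, hn, rfl⟩ := List.getElem_of_mem hy
      refine ⟨⟨k - n, by omega⟩, ?_⟩
      congr 1
      simp only [x]
      congr 1
      omega
    · rintro ⟨i, rfl⟩
      exact ⟨_, hxm i, rfl⟩
  · ext e
    simp only [rotOf, List.mem_toFinset, Finset.mem_image, Finset.mem_univ, true_and]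
    constructor
    · intro hy
      obtain ⟨n, hn, rfl⟩ := List.getElem_of_mem hy
      refine ⟨⟨k - n, by omega⟩, ?_⟩
      simp only [x]
      congr 1
      omega
    · rintro ⟨i, rfl⟩
      exact hxm i

variable (M) in
/-- The amount by which the worker of `x` loses when it changes to `A x`. -/
noncomputable def gap (A : Fin m → Fin m) (x : Fin m) : ℕ := M.rk x - M.rk (A x)

/-- The amortization identity: what a rotation will cost to test is exactly what it takes away from
the rank sum. -/
lemma sum_rk_rotOf {X : Finset (Fin m)} {A B : Fin m → Fin m} {c : List (Fin m)}
    (hX : M.Stable X) (hc : M.IsCycle X (rotOf A c)) (hnd : c.Nodup)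
    (hl : ∀ x ∈ c, M.Link X x (A x) (B x)) :
    ∑ e ∈ (rotOf A c).app X, M.rk e + (c.map (M.gap A)).sum = ∑ e ∈ X, M.rk e := by
  have h := hc.sum_rk_app hX
  have h1 : ∑ x ∈ (rotOf A c).minus, M.rk x = (c.map M.rk).sum :=
    List.sum_toFinset _ hnd
  have h2 : ∑ x ∈ (rotOf A c).plus, M.rk x = (c.map fun x => M.rk (A x)).sum := by
    change ∑ x ∈ (c.map A).toFinset, M.rk x = _
    rw [List.sum_toFinset, List.map_map]
    · rfl
    · refine hnd.map_on fun x hx y hy hxy => hX.eq_of_wk (hl x hx).mem (hl y hy).mem ?_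
      rw [← (hl x hx).wk_eq, ← (hl y hy).wk_eq, hxy]
  have h3 : (c.map M.rk).sum = (c.map fun x => M.rk (A x)).sum + (c.map (M.gap A)).sum := by
    rw [← List.sum_map_add]
    congr 1
    refine List.map_congr_left fun x hx => ?_
    have := (hl x hx).rk_lt
    simp only [gap]
    omega
  omega

variable (M) in
/-- The lists of `Cs` describe the rotations of a route from `X₀` to `X`. -/
structure Recorded (A B : Fin m → Fin m) (X₀ X : Finset (Fin m)) (Cs : List (List (Fin m))) :
    Prop where
  route : M.Route X₀ X (Cs.map (rotOf A))
  link : ∀ l c r, Cs = l ++ c :: r → ∃ Z, M.Route X₀ Z (l.map (rotOf A)) ∧ c.Nodup ∧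
    ∀ x ∈ c, M.Link Z x (A x) (B x)
  sum : ∑ e ∈ X, M.rk e + (Cs.flatten.map (M.gap A)).sum = ∑ e ∈ X₀, M.rk e

lemma _root_.List.length_le_sum_map {α : Type*} {l : List α} {f : α → ℕ} (h : ∀ x ∈ l, 1 ≤ f x) :
    l.length ≤ (l.map f).sum := by
  induction l with
  | nil => simp
  | cons a l ih =>
    have h1 := h a List.mem_cons_self
    have h2 := ih fun x hx => h x (List.mem_cons_of_mem _ hx)
    simp only [List.length_cons, List.map_cons, List.sum_cons]
    omega

namespace Recorded

variable {A B : Fin m → Fin m} {X₀ X : Finset (Fin m)} {Cs : List (List (Fin m))}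

lemma nil (X₀ : Finset (Fin m)) : M.Recorded A B X₀ X₀ [] :=
  ⟨Route.nil _, fun l c r h => by simp at h, by simp⟩

lemma congr {A' B' : Fin m → Fin m} (h : M.Recorded A B X₀ X Cs)
    (hA : ∀ x ∈ Cs.flatten, A' x = A x) (hB : ∀ x ∈ Cs.flatten, B' x = B x) :
    M.Recorded A' B' X₀ X Cs := by
  have h1 : ∀ c ∈ Cs, rotOf A' c = rotOf A c := fun c hc =>
    rotOf_congr fun x hx => hA x (List.mem_flatten.2 ⟨c, hc, hx⟩)
  refine ⟨?_, fun l c r hl => ?_, ?_⟩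
  · rw [List.map_congr_left h1]
    exact h.route
  · obtain ⟨Z, hZ, hnd, hlk⟩ := h.link l c r hl
    refine ⟨Z, ?_, hnd, fun x hx => ?_⟩
    · rwa [List.map_congr_left fun c hc => h1 c (by simp [hl, hc])]
    · have : x ∈ Cs.flatten := List.mem_flatten.2 ⟨c, by simp [hl], hx⟩
      rw [hA x this, hB x this]
      exact hlk x hx
  · rw [← h.sum]
    congr 2
    exact List.map_congr_left fun x hx => by rw [gap, gap, hA x hx]

lemma snoc (h : M.Recorded A B X₀ X Cs) (h₀ : M.Stable X₀) {c : List (Fin m)}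
    (hc : M.IsCycle X (rotOf A c)) (hnd : c.Nodup) (hl : ∀ x ∈ c, M.Link X x (A x) (B x)) :
    M.Recorded A B X₀ ((rotOf A c).app X) (Cs ++ [c]) := by
  have hX := h.route.stable h₀
  refine ⟨?_, fun l c' r hcr => ?_, ?_⟩
  · rw [List.map_append, route_append_iff]
    exact ⟨X, h.route, route_cons_iff.2 ⟨(isRotation_iff hX _).2 hc, Route.nil _⟩⟩
  · rcases List.eq_nil_or_concat r with rfl | ⟨r, d, rfl⟩
    · obtain ⟨rfl, h1⟩ := List.append_inj' hcr rfl
      obtain rfl : c = c' := by simpa using h1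
      exact ⟨X, h.route, hnd, hl⟩
    · refine h.link l c' r ?_
      rw [List.concat_eq_append, ← List.cons_append, ← List.append_assoc] at hcr
      exact (List.append_inj' hcr rfl).1
  · rw [← h.sum, ← sum_rk_rotOf hX hc hnd hl]
    simp
    ring

lemma isCycle (h : M.Recorded A B X₀ X Cs) (h₀ : M.Stable X₀) {l r : List (List (Fin m))}
    {c : List (Fin m)} (hl : Cs = l ++ c :: r) {Z : Finset (Fin m)}
    (hZ : M.Route X₀ Z (l.map (rotOf A))) : M.IsCycle Z (rotOf A c) := by
  have := h.route
  rw [hl, List.map_append, route_append_iff] at this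
  obtain ⟨W, h1, h2⟩ := this
  obtain rfl := h1.eq_end hZ
  rw [List.map_cons, route_cons_iff, isRotation_iff (h1.stable h₀)] at h2
  exact h2.1

/-- The test of whether a recorded rotation is generated by `Y`. -/
lemma isCycle_iff (h : M.Recorded A B X₀ X Cs) (h₀ : M.Stable X₀) {c : List (Fin m)} (hc : c ∈ Cs)
    {Y : Finset (Fin m)} {T : List (Rotation m)} (hY : M.Route X₀ Y T) :
    M.IsCycle Y (rotOf A c) ↔ ∀ x ∈ c, x ∈ Y ∧
      (∀ e, M.wk e = M.wk x → M.rk (A x) < M.rk e → M.rk e < M.rk x → e ∉ M.ch (insert e Y)) ∧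
      A x ∈ M.ch (insert (A x) Y) ∧ B x ∉ M.ch (insert (A x) Y) := by
  obtain ⟨l, r, hl⟩ := List.append_of_mem hc
  obtain ⟨Z, hZ, -, hlk⟩ := h.link l c r hl
  have hZc := h.isCycle h₀ hl hZ
  have hZs := hZ.stable h₀
  have hYs := hY.stable h₀
  have hmem : ∀ {x}, x ∈ (rotOf A c).minus ↔ x ∈ c := by simp [rotOf]
  constructor
  · intro hYc x hx
    have := hZ.link_iff hY h₀ hZc hYc (hmem.2 hx) (hlk x hx)
    exact ⟨this.mem, this.between, this.mem_ch, this.not_mem_ch hYs⟩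
  · intro ht
    -- The workers and ranks in a link do not depend on the stable set and are known from `Z`, so
    -- only the firms' answers have to be tested again; that `B x` lies in `Y` follows from the test
    -- of `B x` itself, as an element of the cycle.
    refine hZc.of_links fun x a b hx _ hb hl' => ?_
    have hxc := hmem.1 hx
    obtain ⟨rfl, rfl⟩ := hl'.unique (hlk x hxc) hZs
    obtain ⟨h1, h2, h3, h4⟩ := ht x hxc
    exact hYs.link_of_not_mem h1 hl'.wk_eq hl'.rk_lt h2 h3 (ht _ (hmem.1 hb)).1 h4

lemma length_le (h : M.Recorded A B X₀ X Cs) :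
    Cs.flatten.length ≤ (Cs.flatten.map (M.gap A)).sum := by
  have : ∀ x ∈ Cs.flatten, 1 ≤ M.gap A x := by
    intro x hx
    obtain ⟨c, hc, hxc⟩ := List.mem_flatten.1 hx
    obtain ⟨l, r, hl⟩ := List.append_of_mem hc
    obtain ⟨Z, -, -, hlk⟩ := h.link l c r hl
    have := (hlk x hxc).rk_lt
    rw [gap]
    omega
  exact List.length_le_sum_map this

lemma length_le' (h : M.Recorded A B X₀ X Cs) (h₀ : M.Stable X₀) :
    Cs.length ≤ Cs.flatten.length := by
  have h1 : ∀ c ∈ Cs, 1 ≤ c.length := by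
    intro c hc
    obtain ⟨l, r, hl⟩ := List.append_of_mem hc
    obtain ⟨Z, hZ, -, hlk⟩ := h.link l c r hl
    obtain ⟨x, hx⟩ := (h.isCycle h₀ hl hZ).minus_nonempty
    exact List.length_pos_of_mem (by simpa [rotOf] using hx : x ∈ c)
  rw [List.length_flatten]
  exact List.length_le_sum_map h1

end Recorded

variable (M) in
/-- The edge `x` of `X` is never given up when the firms get better off. -/
def Dead (X : Finset (Fin m)) (x : Fin m) : Prop := ∀ Y, M.Stable Y → M.Le X Y → x ∈ Y

lemma Dead.mono {X Y : Finset (Fin m)} {x : Fin m} (h : M.Dead X x) (hle : M.Le X Y) :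
    M.Dead Y x := fun Z hZ hYZ => h Z hZ (hle.trans hYZ)

/-- Giving up `x` on the way to a larger stable set would force giving up its successor. -/
lemma dead_of_link {X : Finset (Fin m)} {x a b : Fin m} (hX : M.Stable X) (hl : M.Link X x a b)
    (hb : M.Dead X b) : M.Dead X x := by
  intro Y hY hle
  by_contra hx
  obtain ⟨a', b', hl', hb', -⟩ := hle.exists_link hX hY hl.mem hx
  obtain ⟨rfl, rfl⟩ := hl.unique hl' hX
  exact hb' (hb Y hY hle)

lemma dead_of_forall_not_link {X : Finset (Fin m)} {x : Fin m} (hX : M.Stable X) (hx : x ∈ X)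
    (h : ∀ a b, ¬ M.Link X x a b) : M.Dead X x := by
  intro Y hY hle
  by_contra hn
  obtain ⟨a, b, hl, -⟩ := hle.exists_link hX hY hx hn
  exact h a b hl

lemma not_isCycle_of_dead {X : Finset (Fin m)} (hX : M.Stable X) (h : ∀ x ∈ X, M.Dead X x)
    (L : Rotation m) : ¬ M.IsCycle X L := by
  intro hL
  obtain ⟨x, hx⟩ := hL.minus_nonempty
  exact hL.not_mem_app hX hx (h x (hL.minus_subset hx) _ (hL.stable_app hX) (hL.le_app hX))

end CBM

/-! ### Memory updates and frame conditions. -/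

namespace Memory

@[simp] lemma setReg_reg (s : Memory) (x v y : ℕ) :
    (s.setReg x v).reg y = if y = x then v else s.reg y := rfl

@[simp] lemma setReg_arr (s : Memory) (x v : ℕ) : (s.setReg x v).arr = s.arr := rfl

@[simp] lemma setArr_reg (s : Memory) (a i v : ℕ) : (s.setArr a i v).reg = s.reg := rfl

@[simp] lemma setArr_arr (s : Memory) (a i v a' : ℕ) :
    (s.setArr a i v).arr a' = if a' = a then Function.update (s.arr a) i v else s.arr a' := by
  funext j
  by_cases h : a' = a
  · subst h
    simp [setArr, Function.update_apply]
  · simp [setArr, h]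

@[simp] lemma callOracle_reg {p q m : ℕ} (M : CBM p q m) (s : Memory) (f z o : ℕ) :
    (s.callOracle M f z o).reg = s.reg := rfl

lemma callOracle_arr_of_ne {p q m : ℕ} (M : CBM p q m) (s : Memory) (f z o a : ℕ) (h : a ≠ o) :
    (s.callOracle M f z o).arr a = s.arr a := by
  funext i
  simp [callOracle, h]

/-- `s'` differs from `s` only in the registers of the list `R` and the arrays of the list `A`. -/
structure Frame (R A : List ℕ) (s s' : Memory) : Prop where
  reg' : ∀ x, x ∉ R → s'.reg x = s.reg x
  arr' : ∀ a, a ∉ A → s'.arr a = s.arr a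

namespace Frame

variable {R A R' A' : List ℕ} {s s' s'' : Memory}

lemma reg (h : Frame R A s s') (x : ℕ) (hx : x ∉ R := by decide) : s'.reg x = s.reg x := h.reg' x hx

lemma arr (h : Frame R A s s') (a : ℕ) (ha : a ∉ A := by decide) : s'.arr a = s.arr a := h.arr' a ha

lemma refl (R A : List ℕ) (s : Memory) : Frame R A s s := ⟨fun _ _ => rfl, fun _ _ => rfl⟩

lemma trans (h : Frame R A s s') (h' : Frame R' A' s' s'') (hR : R' ⊆ R := by decide)
    (hA : A' ⊆ A := by decide) : Frame R A s s'' :=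
  ⟨fun x hx => (h'.reg' x fun h1 => hx (hR h1)).trans (h.reg' x hx),
    fun a ha => (h'.arr' a fun h1 => ha (hA h1)).trans (h.arr' a ha)⟩

lemma mono (h : Frame R' A' s s') (hR : R' ⊆ R := by decide) (hA : A' ⊆ A := by decide) :
    Frame R A s s' := (Frame.refl R A s).trans h hR hA

lemma setReg (h : Frame R A s s') (x v : ℕ) (hx : x ∈ R := by decide) :
    Frame R A s (s'.setReg x v) :=
  ⟨fun y hy => by
    have : y ≠ x := by rintro rfl; exact hy hx
    simp [this, h.reg' y hy], h.arr'⟩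

lemma setArr (h : Frame R A s s') (a i v : ℕ) (ha : a ∈ A := by decide) :
    Frame R A s (s'.setArr a i v) :=
  ⟨h.reg', fun b hb => by
    have : b ≠ a := by rintro rfl; exact hb ha
    simp [this, h.arr' b hb]⟩

lemma callOracle {p q m : ℕ} {M : CBM p q m} (h : Frame R A s s') (f z o : ℕ)
    (ho : o ∈ A := by decide) : Frame R A s (s'.callOracle M f z o) :=
  ⟨h.reg', fun b hb => by
    rw [callOracle_arr_of_ne, h.arr' b hb]
    rintro rfl
    exact hb ho⟩

end Frame

end Memory

/-! ### A program logic with step bounds. -/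

open Memory

section Logic

variable {p q m : ℕ} {M : CBM p q m}

infixr:60 " ;; " => Program.seq

variable (M) in
/-- Started on `s`, the program `P` halts within `t` steps in a memory that satisfies `Q`. -/
def Runs (P : Program) (s : Memory) (t : ℕ) (Q : Memory → Prop) : Prop :=
  ∃ t' s', t' ≤ t ∧ Exec M P s t' s' ∧ Q s'

namespace Runs

variable {P P' : Program} {s : Memory} {t t' t₁ t₂ : ℕ} {Q Q' R : Memory → Prop} {b : Test}

lemma mono (h : Runs M P s t Q) (ht : t ≤ t') (hQ : ∀ s, Q s → Q' s) : Runs M P s t' Q' := by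
  obtain ⟨u, s', hu, he, hq⟩ := h
  exact ⟨u, s', hu.trans ht, he, hQ s' hq⟩

lemma le (h : Runs M P s t Q) (ht : t ≤ t') : Runs M P s t' Q := h.mono ht fun _ h => h

lemma bind (h : Runs M P s t₁ Q) (h' : ∀ s', Q s' → Runs M P' s' t₂ R) :
    Runs M (P ;; P') s (t₁ + t₂) R := by
  obtain ⟨u, s', hu, he, hq⟩ := h
  obtain ⟨u', s'', hu', he', hr⟩ := h' s' hq
  exact ⟨u + u', s'', by omega, .seq he he', hr⟩

lemma skip (h : Q s) : Runs M .skip s 1 Q := ⟨1, _, le_rfl, .skip s, h⟩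
lemma const {x k : ℕ} (h : Q (s.setReg x k)) : Runs M (.const x k) s 1 Q :=
  ⟨1, _, le_rfl, .const x k s, h⟩
lemma copy {x y : ℕ} (h : Q (s.setReg x (s.reg y))) : Runs M (.copy x y) s 1 Q :=
  ⟨1, _, le_rfl, .copy x y s, h⟩
lemma inc {x : ℕ} (h : Q (s.setReg x (s.reg x + 1))) : Runs M (.inc x) s 1 Q :=
  ⟨1, _, le_rfl, .inc x s, h⟩
lemma load {x a y : ℕ} (h : Q (s.setReg x (s.arr a (s.reg y)))) : Runs M (.load x a y) s 1 Q :=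
  ⟨1, _, le_rfl, .load x a y s, h⟩
lemma store {a y x : ℕ} (h : Q (s.setArr a (s.reg y) (s.reg x))) : Runs M (.store a y x) s 1 Q :=
  ⟨1, _, le_rfl, .store a y x s, h⟩
lemma oracle {y z o : ℕ} (h : Q (s.callOracle M (s.reg y) z o)) : Runs M (.oracle y z o) s 1 Q :=
  ⟨1, _, le_rfl, .oracle y z o s, h⟩

lemma before (h : Runs M P s 1 (fun s' => Runs M P' s' t R)) : Runs M (P ;; P') s (t + 1) R := by
  rw [add_comm]
  exact h.bind fun _ h => h

lemma seq_const {x k : ℕ} (h : Runs M P (s.setReg x k) t Q) :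
    Runs M (.const x k ;; P) s (t + 1) Q := before (const h)
lemma seq_copy {x y : ℕ} (h : Runs M P (s.setReg x (s.reg y)) t Q) :
    Runs M (.copy x y ;; P) s (t + 1) Q := before (copy h)
lemma seq_inc {x : ℕ} (h : Runs M P (s.setReg x (s.reg x + 1)) t Q) :
    Runs M (.inc x ;; P) s (t + 1) Q := before (inc h)
lemma seq_load {x a y : ℕ} (h : Runs M P (s.setReg x (s.arr a (s.reg y))) t Q) :
    Runs M (.load x a y ;; P) s (t + 1) Q := before (load h)
lemma seq_store {a y x : ℕ} (h : Runs M P (s.setArr a (s.reg y) (s.reg x)) t Q) :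
    Runs M (.store a y x ;; P) s (t + 1) Q := before (store h)
lemma seq_oracle {y z o : ℕ} (h : Runs M P (s.callOracle M (s.reg y) z o) t Q) :
    Runs M (.oracle y z o ;; P) s (t + 1) Q := before (oracle h)

lemma cond (h : b.Holds s → Runs M P s t Q) (h' : ¬ b.Holds s → Runs M P' s t Q) :
    Runs M (.cond b P P') s (t + 1) Q := by
  by_cases hb : b.Holds s
  · obtain ⟨u, s', hu, he, hq⟩ := h hb
    exact ⟨1 + u, s', by omega, .condTrue hb he, hq⟩
  · obtain ⟨u, s', hu, he, hq⟩ := h' hb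
    exact ⟨1 + u, s', by omega, .condFalse hb he, hq⟩

/-- A loop with a decreasing measure. -/
lemma loop_measure (I : ℕ → Memory → Prop)
    (hstep : ∀ n s, I n s → b.Holds s → Runs M P s t fun s' => ∃ n' < n, I n' s') {n : ℕ}
    (h : I n s) :
    Runs M (.loop b P) s (n * (t + 1) + 1) fun s' => ∃ n', I n' s' ∧ ¬ b.Holds s' := by
  induction n using Nat.strong_induction_on generalizing s with
  | _ n ih =>
    by_cases hb : b.Holds s
    · obtain ⟨u, s', hu, he, n', hn, hI⟩ := hstep n s h hb
      obtain ⟨u', s'', hu', he', hr⟩ := ih n' hn hI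
      refine ⟨1 + u + u', s'', ?_, .loopStep hb he he', hr⟩
      have : (n' + 1) * (t + 1) ≤ n * (t + 1) := Nat.mul_le_mul_right _ hn
      rw [add_mul] at this
      omega
    · exact ⟨1, s, by omega, .loopStop hb, n, h, hb⟩

/-- A loop that processes the elements of a list. -/
lemma loop_list {α : Type*} {f : α → ℕ} (I : List α → List α → Memory → Prop)
    (hstep : ∀ l x r s, I l (x :: r) s → b.Holds s ∧ Runs M P s (f x) (I (l ++ [x]) r))
    (hend : ∀ l s, I l [] s → ¬ b.Holds s) {l r : List α} (h : I l r s) :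
    Runs M (.loop b P) s ((r.map fun x => f x + 1).sum + 1) (I (l ++ r) []) := by
  induction r generalizing l s with
  | nil =>
    rw [List.append_nil]
    exact ⟨1, s, by simp, .loopStop (hend l s h), h⟩
  | cons x r ih =>
    obtain ⟨hb, u, s', hu, he, hI⟩ := hstep l x r s h
    obtain ⟨u', s'', hu', he', hr⟩ := ih hI
    refine ⟨1 + u + u', s'', ?_, .loopStep hb he he', ?_⟩
    · simp only [List.map_cons, List.sum_cons]
      omega
    · rwa [List.append_assoc, List.singleton_append] at hr

/-- A loop that counts from `i` to `n`. -/
lemma loop_range (I : ℕ → Memory → Prop) {i n : ℕ} (hin : i ≤ n)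
    (hstep : ∀ j s, i ≤ j → j < n → I j s → b.Holds s ∧ Runs M P s t (I (j + 1)))
    (hend : ∀ s, I n s → ¬ b.Holds s) (h : I i s) :
    Runs M (.loop b P) s ((n - i) * (t + 1) + 1) (I n) := by
  -- The measure is the number `n - j` of rounds left.
  refine (loop_measure (fun k s => ∃ j, i ≤ j ∧ j ≤ n ∧ k = n - j ∧ I j s) ?_
    ⟨i, le_rfl, hin, rfl, h⟩).mono le_rfl ?_
  · rintro k s ⟨j, hij, hjn, rfl, hI⟩ hb
    have hlt : j < n := lt_of_le_of_ne hjn (by rintro rfl; exact hend s hI hb)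
    exact (hstep j s hij hlt hI).2.mono le_rfl fun s' h' =>
      ⟨n - (j + 1), by omega, j + 1, by omega, hlt, rfl, h'⟩
  · rintro s ⟨k, ⟨j, hij, hjn, -, hI⟩, hb⟩
    rcases hjn.eq_or_lt with rfl | hlt
    · exact hI
    · exact absurd (hstep j s hij hlt hI).1 hb

end Runs

end Logic

-- Names of registers and arrays.

notation "rgN" => (0 : ℕ)
notation "rgArcs" => (1 : ℕ)
notation "rgM" => (10 : ℕ)
notation "rgU" => (11 : ℕ)
notation "rgZero" => (12 : ℕ)
notation "rgOne" => (13 : ℕ)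
notation "rgTop" => (14 : ℕ)
notation "rgRun" => (15 : ℕ)
notation "rgA" => (16 : ℕ)
notation "rgE" => (17 : ℕ)
notation "rgF" => (18 : ℕ)
notation "rgT" => (19 : ℕ)
notation "rgB" => (20 : ℕ)
notation "rgI" => (21 : ℕ)
notation "rgJ" => (22 : ℕ)
notation "rgKind" => (23 : ℕ)
notation "rgV" => (24 : ℕ)
notation "rgEnd" => (25 : ℕ)
notation "rgY" => (26 : ℕ)
notation "rgOk" => (28 : ℕ)
notation "rgFlag" => (29 : ℕ)
notation "arU" => (0 : ℕ)
notation "arPlus" => (1 : ℕ)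
notation "arMinus" => (2 : ℕ)
notation "arSrc" => (3 : ℕ)
notation "arTgt" => (4 : ℕ)
notation "arFm" => (10 : ℕ)
notation "arNx" => (11 : ℕ)
notation "arMin" => (12 : ℕ)
notation "arX" => (13 : ℕ)
notation "arO" => (14 : ℕ)
notation "arSt" => (15 : ℕ)
notation "arA" => (16 : ℕ)
notation "arB" => (17 : ℕ)
notation "arPrev" => (18 : ℕ)

/-! ### Programs that compute the link of an edge. -/

section Machine

variable {p q m : ℕ} {M : CBM p q m}

/-- The array contents `g` is the 0-1-vector of `X`. -/
def Indicates (g : ℕ → ℕ) (X : Finset (Fin m)) : Prop := ∀ e : Fin m, g e = if e ∈ X then 1 else 0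

namespace CBM

variable (M) in
/-- `v` is the number of the edge next to `e`, or `m` if there is none. -/
def IsNx (v : ℕ) (e : Fin m) : Prop :=
  (∃ e' : Fin m, v = e' ∧ M.wk e' = M.wk e ∧ M.rk e' < M.rk e ∧
    ∀ d, M.wk d = M.wk e → M.rk d < M.rk e → M.rk d ≤ M.rk e') ∨
  (v = m ∧ ∀ d, M.wk d = M.wk e → ¬ M.rk d < M.rk e)

variable (M) in
/-- The part of the memory that never changes after the initialization. -/
structure Env (X₀ : Finset (Fin m)) (s : Memory) : Prop where
  m_eq : s.reg rgM = m
  zero : s.reg rgZero = 0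
  one : s.reg rgOne = 1
  fm : ∀ e : Fin m, s.arr arFm e = M.fm e
  nx : ∀ e : Fin m, M.IsNx (s.arr arNx e) e
  xmin : Indicates (s.arr arMin) X₀

lemma Env.frame {X₀ : Finset (Fin m)} {s s' : Memory} {R A : List ℕ} (h : M.Env X₀ s)
    (hF : Frame R A s s') (hR : rgM ∉ R ∧ rgZero ∉ R ∧ rgOne ∉ R := by decide)
    (hA : arFm ∉ A ∧ arNx ∉ A ∧ arMin ∉ A := by decide) : M.Env X₀ s' := by
  constructor
  · rw [hF.reg _ hR.1, h.m_eq]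
  · rw [hF.reg _ hR.2.1, h.zero]
  · rw [hF.reg _ hR.2.2, h.one]
  · rw [hF.arr _ hA.1]
    exact h.fm
  · rw [hF.arr _ hA.2.1]
    exact h.nx
  · rw [hF.arr _ hA.2.2]
    exact h.xmin

variable (M) in
/-- The array contents `g` holds the choice of the firm of `e` when `e` is added to `X`. -/
def HoldsChoice (g : ℕ → ℕ) (X : Finset (Fin m)) (e : Fin m) : Prop :=
  ∀ d : Fin m, M.fm d = M.fm e → g d = if d ∈ M.ch (insert e X) then 1 else 0

end CBM

namespace Prog

/-- Ask for the choice of the firm of the edge in register `rgE` when this edge is added. -/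
def query : Program :=
  .store arX rgE rgOne ;; .load rgF arFm rgE ;; .oracle rgF arX arO ;; .store arX rgE rgZero

/-- Search the admissible edge of the edge in register `rgTop`. -/
def findA : Program :=
  .load rgE arNx rgTop ;; .copy rgA rgM ;;
  .loop (.lt rgE rgM) (query ;; .load rgT arO rgE ;;
    .cond (.eq rgT rgZero) (.load rgE arNx rgE) (.copy rgA rgE ;; .copy rgE rgM))

/-- Search an edge of the firm in register `rgF` that is rejected. -/
def findB : Program :=
  .copy rgB rgM ;; .const rgI 0 ;;
  .loop (.lt rgI rgM) (.load rgT arFm rgI ;;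
    .cond (.eq rgT rgF) (.load rgT arX rgI ;;
      .cond (.eq rgT rgOne) (.load rgT arO rgI ;;
        .cond (.eq rgT rgZero) (.copy rgB rgI ;; .inc rgI) (.inc rgI)) (.inc rgI)) (.inc rgI))

end Prog

namespace CBM

variable {X₀ X : Finset (Fin m)} {s : Memory}

lemma callOracle_arr_self (M : CBM p q m) (s : Memory) (z o : ℕ) (X : Finset (Fin m))
    (hz : ∀ e : Fin m, s.arr z e ≠ 0 ↔ e ∈ X) (d : Fin m) {f : ℕ} (hd : (M.fm d : ℕ) = f) :
    (s.callOracle M f z o).arr o d = if d ∈ M.ch X then 1 else 0 := by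
  have hset : (Finset.univ.filter fun e : Fin m => M.fm e = M.fm d ∧ s.arr z e ≠ 0) =
      M.atF X (M.fm d) := by
    ext e
    simp [atF, hz, and_comm]
  simp only [Memory.callOracle, if_pos, Fin.is_lt, dite_true, Fin.eta, hd, hset, mem_ch]

/-- The edge is put into the indicator array for the single oracle call and taken out again; writing
zero back is right because the edge is not in `X`. Only the answer cells of its firm are meaningful
afterwards. -/
lemma runs_query (hs : M.Env X₀ s) (hX : Indicates (s.arr arX) X) {e : Fin m}
    (he : s.reg rgE = e) (heX : e ∉ X) :
    Runs M Prog.query s 4 fun s' => Frame [rgF] [arX, arO] s s' ∧ Indicates (s'.arr arX) X ∧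
      s'.reg rgF = M.fm e ∧ M.HoldsChoice (s'.arr arO) X e := by
  have hfm : s.arr 10 (s.reg 17) = M.fm e := by rw [he, hs.fm]
  refine Runs.seq_store (Runs.seq_load (Runs.seq_oracle (Runs.store ⟨?_, ?_, ?_, ?_⟩)))
  · exact ((((Frame.refl _ _ s).setArr _ _ _).setReg _ _).callOracle _ _ _).setArr _ _ _
  · intro d
    simp only [setArr_arr, callOracle_reg, setReg_reg, setArr_reg]
    rw [callOracle_arr_of_ne _ _ _ _ _ _ (by decide)]
    by_cases hd : d = e
    · subst hd
      simp [he, hs.zero, heX]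
    · have : (d : ℕ) ≠ e := fun h => hd (Fin.ext h)
      simp [he, this, hX d]
  · simp [hfm]
  · intro d hd
    simp only [setArr_arr, callOracle_reg, setReg_reg, setArr_reg]
    rw [if_neg (by decide)]
    refine callOracle_arr_self M _ _ _ _ (fun e' => ?_) d (by simp [hfm, hd])
    by_cases h1 : e' = e
    · simp [h1, he, hs.one]
    · have : (e' : ℕ) ≠ e := fun h => h1 (Fin.ext h)
      simp [h1, he, this, hX e']

/-- The list of the worker is followed downwards from `x` to the first edge that its firm accepts.
Ranks decrease strictly along the list and `x` has rank at most `m`, which bounds the number of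
queries. -/
lemma runs_findA (hs : M.Env X₀ s) (hX : Indicates (s.arr arX) X) (hXs : M.Stable X) {x : Fin m}
    (hx : s.reg rgTop = x) (hxX : x ∈ X) :
    Runs M Prog.findA s (9 * m + 3) fun s' =>
      Frame [rgE, rgA, rgF, rgT] [arX, arO] s s' ∧ Indicates (s'.arr arX) X ∧
      ((s'.reg rgA = m ∧ ∀ e, M.wk e = M.wk x → M.rk e < M.rk x → e ∉ M.ch (insert e X)) ∨
      ∃ a : Fin m, s'.reg rgA = a ∧ M.wk a = M.wk x ∧ M.rk a < M.rk x ∧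
        (∀ e, M.wk e = M.wk x → M.rk a < M.rk e → M.rk e < M.rk x → e ∉ M.ch (insert e X)) ∧
        a ∈ M.ch (insert a X) ∧ s'.reg rgF = M.fm a ∧ M.HoldsChoice (s'.arr arO) X a) := by
  set F : Memory → Prop := fun s' => Frame [rgE, rgA, rgF, rgT] [arX, arO] s s' ∧
    Indicates (s'.arr arX) X with hFdef
  set P : Memory → Prop := fun s' =>
      ((s'.reg rgA = m ∧ ∀ e, M.wk e = M.wk x → M.rk e < M.rk x → e ∉ M.ch (insert e X)) ∨
      ∃ a : Fin m, s'.reg rgA = a ∧ M.wk a = M.wk x ∧ M.rk a < M.rk x ∧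
        (∀ e, M.wk e = M.wk x → M.rk a < M.rk e → M.rk e < M.rk x → e ∉ M.ch (insert e X)) ∧
        a ∈ M.ch (insert a X) ∧ s'.reg rgF = M.fm a ∧ M.HoldsChoice (s'.arr arO) X a) with hPdef
  -- Either the search is over, marked by `m` in `rgE`, or `rgE` holds a pending edge of rank below
  -- `n`, and every better edge of its worker worse than `x` has been refused.
  let I : ℕ → Memory → Prop := fun n s' => F s' ∧
    ((s'.reg rgE = m ∧ P s') ∨ (s'.reg rgA = m ∧ ∃ e : Fin m, s'.reg rgE = e ∧
      M.wk e = M.wk x ∧ M.rk e < M.rk x ∧ M.rk e < n ∧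
      ∀ d, M.wk d = M.wk x → M.rk e < M.rk d → M.rk d < M.rk x → d ∉ M.ch (insert d X)))
  have hnext : ∀ (e : Fin m) (n : ℕ) (s' : Memory), F s' → s'.reg rgA = m → M.IsNx (s'.reg rgE) e →
      M.wk e = M.wk x → M.rk e ≤ M.rk x → M.rk e ≤ n →
      (∀ d, M.wk d = M.wk x → M.rk e ≤ M.rk d → M.rk d < M.rk x → d ∉ M.ch (insert d X)) →
      I n s' := by
    rintro e n s' hF hA (⟨e', h1, h2, h3, h4⟩ | ⟨h1, h2⟩) hw hr hn hd
    · refine ⟨hF, Or.inr ⟨hA, e', h1, h2.trans hw, by omega, by omega, fun d h5 h6 h7 => ?_⟩⟩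
      apply hd d h5 _ h7
      by_contra hlt
      have := h4 d (h5.trans hw.symm) (by omega)
      omega
    · refine ⟨hF, Or.inl ⟨h1, Or.inl ⟨hA, fun d h5 h6 => hd d h5 ?_ h6⟩⟩⟩
      exact not_lt.1 (h2 d (h5.trans hw.symm))
  have hrk : M.rk x ≤ m := (Finset.single_le_sum (f := M.rk) (fun _ _ => Nat.zero_le _) hxX).trans
    hXs.sum_rk_le
  refine (Runs.seq_load (Runs.seq_copy ((Runs.loop_measure (t := 8) I ?_ (n := m) ?_).mono
    le_rfl ?_))).le (by omega)
  · rintro n s' ⟨hF, hcase⟩ hb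
    have hs' := hs.frame hF.1
    simp only [Test.Holds, hs'.m_eq] at hb
    rcases hcase with ⟨h1, -⟩ | ⟨hA, e, he, hw, hr, hn, hd⟩
    · omega
    have heX := hXs.not_mem_of_rk_lt hxX hw hr
    refine ((runs_query hs' hF.2 he heX).bind (t₂ := 4) ?_)
    rintro s₁ ⟨hF₁, hX₁, hf₁, hc₁⟩
    have hs₁ := hs'.frame hF₁
    have he₁ : s₁.reg 17 = e := (hF₁.reg _).trans he
    have hoe : s₁.arr 14 e = _ := hc₁ e rfl
    refine Runs.seq_load (Runs.cond (fun h => ?_) (fun h => ?_))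
    · simp [Test.Holds, hs₁.zero, he₁, hoe] at h
      refine (Runs.load ⟨M.rk e, hn, hnext e _ _ ⟨?_, ?_⟩ ?_ ?_ hw hr.le le_rfl ?_⟩).le (by omega)
      · exact ((hF.1.trans hF₁).setReg _ _).setReg _ _
      · exact hX₁
      · simpa using (hF₁.reg 16).trans hA
      · simpa [he₁] using hs₁.nx e
      · intro d h1 h2 h3
        rcases h2.eq_or_lt with h4 | h4
        · rwa [← M.rk_inj (hw.trans h1.symm) h4]
        · exact hd d h1 h4 h3
    · simp [Test.Holds, hs₁.zero, he₁, hoe] at h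
      refine Runs.seq_copy (Runs.copy ⟨0, by omega, ⟨?_, ?_⟩, Or.inl ⟨?_, ?_⟩⟩)
      · exact (((hF.1.trans hF₁).setReg _ _).setReg _ _).setReg _ _
      · exact hX₁
      · simp [hs₁.m_eq]
      · exact Or.inr ⟨e, by simp [he₁], hw, hr, hd, h, by simp [hf₁], hc₁⟩
  · refine hnext x _ _ ⟨?_, hX⟩ (by simp [hs.m_eq]) ?_ rfl le_rfl hrk ?_
    · exact ((Frame.refl _ _ s).setReg _ _).setReg _ _
    · simpa [hx] using hs.nx x
    · intro d _ h1 h2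
      omega
  · rintro s' ⟨n, ⟨hF, hcase⟩, hb⟩
    have hs' := hs.frame hF.1
    simp only [Test.Holds, hs'.m_eq] at hb
    rcases hcase with ⟨-, h1⟩ | ⟨-, e, he, -⟩
    · exact ⟨hF.1, hF.2, h1⟩
    · exact absurd (he ▸ e.2) hb

/-- A full scan without early exit. Only cells of the firm of `a` are consulted, as the others may
hold stale answers. Any hit will do, since `Stable.link_of_not_mem` makes it the successor. -/
lemma runs_findB (hs : M.Env X₀ s) (hX : Indicates (s.arr arX) X) {a : Fin m}
    (hf : s.reg rgF = M.fm a) (hc : M.HoldsChoice (s.arr arO) X a) :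
    Runs M Prog.findB s (10 * m + 3) fun s' =>
      Frame [rgB, rgI, rgT] [] s s' ∧
      ((s'.reg rgB = m ∧ ∀ b ∈ X, M.fm b = M.fm a → b ∈ M.ch (insert a X)) ∨
      ∃ b : Fin m, s'.reg rgB = b ∧ b ∈ X ∧ b ∉ M.ch (insert a X)) := by
  refine (Runs.seq_copy (Runs.seq_const ((Runs.loop_range (t := 8) (n := m) (i := 0) (fun i s' =>
    Frame [rgB, rgI, rgT] [] s s' ∧ s'.reg rgI = i ∧
    ((s'.reg rgB = m ∧ ∀ b : Fin m, b < i → b ∈ X → M.fm b = M.fm a → b ∈ M.ch (insert a X)) ∨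
      ∃ b : Fin m, s'.reg rgB = b ∧ b ∈ X ∧ b ∉ M.ch (insert a X))) (Nat.zero_le _) ?_ ?_ ?_).mono
      le_rfl ?_))).le (by omega)
  · rintro i s' - him ⟨hF, hi, hcase⟩
    have hs' := hs.frame hF
    refine ⟨by simp [Test.Holds, hi, hs'.m_eq, him], ?_⟩
    obtain ⟨e, rfl⟩ : ∃ e : Fin m, i = e := ⟨⟨i, him⟩, rfl⟩
    have hfe : s'.arr 10 e = M.fm e := hs'.fm e
    have hXe : s'.arr 13 e = _ := (congrFun (hF.arr 13) e).trans (hX e)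
    have hoe : s'.arr 14 e = s.arr 14 e := congrFun (hF.arr 14) e
    have hf' : s'.reg 18 = M.fm a := (hF.reg 18).trans hf
    have hadv : ∀ s'' : Memory, Frame [rgB, rgI, rgT] [] s s'' → s''.reg rgI = e →
        s''.reg rgB = s'.reg rgB → (e ∈ X → M.fm e = M.fm a → e ∈ M.ch (insert a X)) →
        Runs M (.inc rgI) s'' 1 fun s' => Frame [rgB, rgI, rgT] [] s s' ∧ s'.reg rgI = e + 1 ∧
          ((s'.reg rgB = m ∧ ∀ b : Fin m, b < (e : ℕ) + 1 → b ∈ X → M.fm b = M.fm a →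
            b ∈ M.ch (insert a X)) ∨
          ∃ b : Fin m, s'.reg rgB = b ∧ b ∈ X ∧ b ∉ M.ch (insert a X)) := by
      intro s'' hF' hi' hB' he
      refine Runs.inc ⟨hF'.setReg _ _, by simp [hi'], ?_⟩
      simp only [setReg_reg]
      rw [if_neg (by decide), hB']
      refine hcase.imp_left fun h => ⟨h.1, fun b hb h1 h2 => ?_⟩
      rcases (Nat.lt_succ_iff.1 hb).eq_or_lt with h3 | h3
      · obtain rfl := Fin.ext h3
        exact he h1 h2
      · exact h.2 b h3 h1 h2
    refine Runs.seq_load (Runs.cond (t := 6) (fun h => ?_) (fun h => ?_))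
    · simp [Test.Holds, hi, hfe, hf', Fin.val_inj] at h
      have hoe' : s'.arr 14 e = _ := hoe.trans (hc e h)
      refine Runs.seq_load (Runs.cond (t := 4) (fun h1 => ?_) (fun h1 => ?_))
      · simp [Test.Holds, hi, hXe, hs'.one] at h1
        refine Runs.seq_load (Runs.cond (t := 2) (fun h2 => ?_) (fun h2 => ?_))
        · simp [Test.Holds, hi, hoe', hs'.zero] at h2
          refine Runs.seq_copy (Runs.inc ⟨?_, by simp [hi], Or.inr ⟨e, by simp [hi], h1, h2⟩⟩)
          exact ((((hF.setReg _ _).setReg _ _).setReg _ _).setReg _ _).setReg _ _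
        · simp [Test.Holds, hi, hoe', hs'.zero] at h2
          exact (hadv _ (((hF.setReg _ _).setReg _ _).setReg _ _) (by simp [hi]) (by simp)
            fun _ _ => h2).le (by omega)
      · simp [Test.Holds, hi, hXe, hs'.one] at h1
        exact (hadv _ ((hF.setReg _ _).setReg _ _) (by simp [hi]) (by simp)
            fun h => absurd h h1).le (by omega)
    · simp [Test.Holds, hi, hfe, hf', Fin.val_inj] at h
      exact (hadv _ (hF.setReg _ _) (by simp [hi]) (by simp) fun _ h' => absurd h' h).le (by omega)
  · rintro s' ⟨hF, hi, -⟩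
    have hs' := hs.frame hF
    simp [Test.Holds, hi, hs'.m_eq]
  · refine ⟨((Frame.refl _ _ s).setReg _ _).setReg _ _, by simp, Or.inl ⟨by simp [hs.m_eq], ?_⟩⟩
    intro b hb
    exact absurd hb (Nat.not_lt_zero _)
  · rintro s' ⟨hF, hi, hcase⟩
    exact ⟨hF, hcase.imp_left fun h => ⟨h.1, fun b => h.2 b b.2⟩⟩

end CBM

/-! ### Lists in memory, and the routines of the stack. -/

/-- The array contents `g` lists the elements of a list from cell `u` on. -/
def Cells (g : ℕ → ℕ) : ℕ → List (Fin m) → Prop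
  | _, [] => True
  | u, x :: l => g u = x ∧ Cells g (u + 1) l

lemma cells_append {g : ℕ → ℕ} {u : ℕ} {l l' : List (Fin m)} :
    Cells g u (l ++ l') ↔ Cells g u l ∧ Cells g (u + l.length) l' := by
  induction l generalizing u with
  | nil => simp [Cells]
  | cons x l ih =>
    simp only [List.cons_append, Cells, ih, List.length_cons, and_assoc]
    rw [show u + 1 + l.length = u + (l.length + 1) by omega]

lemma Cells.congr {g g' : ℕ → ℕ} {u : ℕ} {l : List (Fin m)} (h : Cells g u l)
    (hg : ∀ i, u ≤ i → i < u + l.length → g' i = g i) : Cells g' u l := by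
  induction l generalizing u with
  | nil => trivial
  | cons x l ih =>
    refine ⟨(hg u le_rfl (by simp)).trans h.1, ih h.2 fun i h1 h2 => hg i (by omega) ?_⟩
    simp only [List.length_cons]
    omega

lemma Cells.getElem {g : ℕ → ℕ} {u : ℕ} {l : List (Fin m)} (h : Cells g u l) (i : ℕ)
    (hi : i < l.length) : g (u + i) = l[i] := by
  induction l generalizing u i with
  | nil => simp at hi
  | cons x l ih =>
    cases i with
    | zero => exact h.1
    | succ i =>
      rw [List.getElem_cons_succ, ← ih h.2 i (by simpa using hi)]
      congr 1
      omega

/-- The value `v` is the head of a linked list that is stored in `g` and ends with `m`. -/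
def Linked (g : ℕ → ℕ) : ℕ → List (Fin m) → Prop
  | v, [] => v = m
  | v, x :: l => v = x ∧ Linked g (g x) l

lemma Linked.congr {g g' : ℕ → ℕ} {v : ℕ} {l : List (Fin m)} (h : Linked g v l)
    (hg : ∀ x ∈ l, g' x = g x) : Linked g' v l := by
  induction l generalizing v with
  | nil => exact h
  | cons x l ih =>
    refine ⟨h.1, ?_⟩
    rw [hg x List.mem_cons_self]
    exact ih h.2 fun y hy => hg y (List.mem_cons_of_mem _ hy)

namespace Prog

/-- Apply the rotation that is listed in the cells from `rgV` to `rgEnd`. -/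
def apply : Program :=
  .loop (.lt rgV rgEnd) (.load rgY arMinus rgV ;; .store arX rgY rgZero ;;
    .load rgY arPlus rgV ;; .store arX rgY rgOne ;; .inc rgV)

/-- Mark all edges on the stack as dead, and remove them. -/
def kill : Program :=
  .const rgT 2 ;; .loop (.lt rgTop rgM) (.store arSt rgTop rgT ;; .load rgTop arPrev rgTop)

/-- Remove the top of the stack down to the edge in `rgB`, and list it as a new rotation. -/
def pop : Program :=
  .const rgT 2 ;; .const rgFlag 1 ;;
  .loop (.eq rgFlag rgOne) (.store arMinus rgU rgTop ;; .load rgY arA rgTop ;;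
    .store arPlus rgU rgY ;; .inc rgU ;; .store arSt rgTop rgT ;;
    .cond (.eq rgTop rgB) (.const rgFlag 0 ;; .load rgTop arPrev rgTop) (.load rgTop arPrev rgTop))

/-- Search an edge of `X` that is not dead, and put it on the stack. -/
def search : Program :=
  .const rgRun 0 ;; .const rgI 0 ;;
  .loop (.lt rgI rgM) (.load rgT arX rgI ;;
    .cond (.eq rgT rgOne) (.load rgT arSt rgI ;;
      .cond (.eq rgT rgZero) (.copy rgTop rgI ;; .const rgRun 1 ;; .inc rgI) (.inc rgI))
    (.inc rgI)) ;;
  .cond (.eq rgRun rgOne) (.store arSt rgTop rgOne ;; .store arPrev rgTop rgM) .skip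

end Prog

namespace CBM

variable {X₀ X : Finset (Fin m)} {s : Memory}

/-- By `hA` no edge is both added and removed, so the interleaved single writes have the effect of
the simultaneous exchange. -/
lemma runs_apply (hs : M.Env X₀ s) (hX : Indicates (s.arr arX) X) {u : ℕ} {c : List (Fin m)}
    {A : Fin m → Fin m} (hA : ∀ x ∈ c, ∀ y ∈ c, A y ≠ x) (hV : s.reg rgV = u)
    (hEnd : s.reg rgEnd = u + c.length) (hm : Cells (s.arr arMinus) u c)
    (hp : Cells (s.arr arPlus) u (c.map A)) :
    Runs M Prog.apply s (6 * c.length + 1) fun s' => Frame [rgV, rgY] [arX] s s' ∧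
      Indicates (s'.arr arX) ((rotOf A c).app X) := by
  refine (Runs.loop_list (f := fun _ => 5) (fun d r s' => c = d ++ r ∧
    Frame [rgV, rgY] [arX] s s' ∧ s'.reg rgV = u + d.length ∧
    Indicates (s'.arr arX) ((rotOf A d).app X)) ?_ ?_ (l := []) (r := c) ?_).mono (by simp; omega) ?_
  · rintro d x r s' ⟨rfl, hF, hV', hI⟩
    have hs' := hs.frame hF
    have h1 : s'.arr 2 (u + d.length) = x := by
      rw [hF.arr 2]
      exact (cells_append.1 hm).2.1
    have h2 : s'.arr 1 (u + d.length) = A x := by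
      rw [hF.arr 1]
      rw [List.map_append, cells_append] at hp
      simpa using hp.2.1
    refine ⟨?_, ?_⟩
    · simp [Test.Holds, hV', hF.reg 25, hEnd]
    refine Runs.seq_load (Runs.seq_store (Runs.seq_load (Runs.seq_store (Runs.inc
      ⟨by simp, ?_, by simp [hV', add_assoc], ?_⟩))))
    · exact ((((hF.setReg _ _).setArr _ _ _).setReg _ _).setArr _ _ _).setReg _ _
    · intro e
      have hne : ∀ y ∈ d, A y ≠ x := fun y hy => hA x (by simp) y (by simp [hy])
      have hIe := hI e
      simp only [Rotation.app, rotOf, Finset.mem_union, Finset.mem_sdiff, List.mem_toFinset,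
        List.mem_map] at hIe
      simp only [setReg_arr, setArr_arr, setReg_reg, setArr_reg]
      simp only [h1, h2, hV', hs'.zero, hs'.one, Function.update_apply, Fin.val_inj,
        if_true, if_false, Nat.reduceEqDiff]
      rw [hIe]
      simp only [Rotation.app, rotOf, Finset.mem_union, Finset.mem_sdiff, List.mem_toFinset,
        List.mem_map, List.mem_append, List.mem_singleton, not_or]
      by_cases he1 : e = A x
      · subst he1
        rw [if_pos rfl, if_pos]
        exact Or.inr ⟨x, Or.inr rfl, rfl⟩
      · rw [if_neg he1]
        by_cases he2 : e = x
        · subst he2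
          rw [if_pos rfl, if_neg]
          rintro (h | ⟨y, hy | rfl, h⟩)
          · exact h.2.2 rfl
          · exact hne y hy h
          · exact he1 h.symm
        · rw [if_neg he2]
          refine if_congr ?_ rfl rfl
          constructor
          · rintro (h | ⟨y, hy, h⟩)
            · exact Or.inl ⟨h.1, h.2, he2⟩
            · exact Or.inr ⟨y, Or.inl hy, h⟩
          · rintro (h | ⟨y, hy | rfl, h⟩)
            · exact Or.inl ⟨h.1, h.2.1⟩
            · exact Or.inr ⟨y, hy, h⟩
            · exact absurd h.symm he1
  · rintro d s' ⟨hd, hF, hV', -⟩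
    simp only [List.append_nil] at hd
    subst hd
    simp [Test.Holds, hV', hF.reg 25, hEnd]
  · exact ⟨rfl, Frame.refl _ _ _, by simpa using hV, by simpa [Rotation.app, rotOf] using hX⟩
  · rintro s' ⟨-, hF, -, hI⟩
    exact ⟨hF, hI⟩

lemma runs_kill (hs : M.Env X₀ s) {l : List (Fin m)}
    (hl : Linked (s.arr arPrev) (s.reg rgTop) l) :
    Runs M Prog.kill s (3 * l.length + 2) fun s' => Frame [rgT, rgTop] [arSt] s s' ∧
      s'.reg rgTop = m ∧ ∀ e : Fin m, s'.arr arSt e = if e ∈ l then 2 else s.arr arSt e := by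
  refine (Runs.seq_const ((Runs.loop_list (f := fun _ => 2) (fun d r s' =>
    Frame [rgT, rgTop] [arSt] s s' ∧ s'.reg rgT = 2 ∧ Linked (s.arr arPrev) (s'.reg rgTop) r ∧
    ∀ e : Fin m, s'.arr arSt e = if e ∈ d then 2 else s.arr arSt e) ?_ ?_ (l := []) (r := l)
    ?_).mono le_rfl ?_)).le (by simp; omega)
  · rintro d x r s' ⟨hF, h2, hr, hst⟩
    have hs' := hs.frame hF
    refine ⟨by simp [Test.Holds, hr.1, hs'.m_eq], ?_⟩
    refine Runs.seq_store (Runs.load ⟨(hF.setArr _ _ _).setReg _ _, by simp [h2], ?_, fun e => ?_⟩)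
    · simp only [setReg_reg, if_true, setArr_reg, setArr_arr]
      rw [if_neg (by decide), hF.arr 18, hr.1]
      exact hr.2
    · simp only [setReg_arr, setArr_arr, if_true, hr.1, h2, Function.update_apply, Fin.val_inj,
        hst e, List.mem_append, List.mem_singleton]
      by_cases h1 : e = x <;> by_cases h3 : e ∈ d <;> simp [h1, h3]
  · rintro d s' ⟨hF, -, hr, -⟩
    have hs' := hs.frame hF
    have : s'.reg 14 = m := hr
    simp [Test.Holds, this, hs'.m_eq]
  · exact ⟨(Frame.refl _ _ _).setReg _ _, by simp, by simpa using hl, by simp⟩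
  · rintro s' ⟨hF, -, hr, hst⟩
    exact ⟨hF, hr, by simpa using hst⟩

/-- The segment from the top down to `b` is listed as a rotation while it is removed; the entries of
earlier rotations, below cell `u`, are untouched. -/
lemma runs_pop (hs : M.Env X₀ s) {l rest : List (Fin m)} {b : Fin m} {A : Fin m → Fin m} {u : ℕ}
    (hnd : (l ++ [b]).Nodup) (hl : Linked (s.arr arPrev) (s.reg rgTop) (l ++ b :: rest))
    (hb : s.reg rgB = b) (hA : ∀ x ∈ l ++ [b], s.arr arA x = A x) (hu : s.reg rgU = u) :
    Runs M Prog.pop s (9 * (l.length + 1) + 3) fun s' =>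
      Frame [rgT, rgFlag, rgY, rgU, rgTop] [arMinus, arPlus, arSt] s s' ∧
      Linked (s.arr arPrev) (s'.reg rgTop) rest ∧ s'.reg rgU = u + (l.length + 1) ∧
      Cells (s'.arr arMinus) u (l ++ [b]) ∧ Cells (s'.arr arPlus) u ((l ++ [b]).map A) ∧
      (∀ i < u, s'.arr arMinus i = s.arr arMinus i) ∧
      (∀ i < u, s'.arr arPlus i = s.arr arPlus i) ∧
      ∀ e : Fin m, s'.arr arSt e = if e ∈ l ++ [b] then 2 else s.arr arSt e := by
  refine (Runs.seq_const (Runs.seq_const ((Runs.loop_list (f := fun _ => 8) (fun d r s' =>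
    l ++ [b] = d ++ r ∧ Frame [rgT, rgFlag, rgY, rgU, rgTop] [arMinus, arPlus, arSt] s s' ∧
      s'.reg rgT = 2 ∧ s'.reg rgFlag = (if r = [] then 0 else 1) ∧
      Linked (s.arr arPrev) (s'.reg rgTop) (r ++ rest) ∧ s'.reg rgU = u + d.length ∧
      Cells (s'.arr arMinus) u d ∧ Cells (s'.arr arPlus) u (d.map A) ∧
      (∀ i < u, s'.arr arMinus i = s.arr arMinus i) ∧
      (∀ i < u, s'.arr arPlus i = s.arr arPlus i) ∧
      ∀ e : Fin m, s'.arr arSt e = if e ∈ d then 2 else s.arr arSt e) ?_ ?_ (l := [])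
      (r := l ++ [b]) ?_).mono le_rfl ?_))).le (by simp; omega)
  · rintro d x r s' ⟨hd, hF, h2, hfl, hr, hu', hcm, hcp, hm, hp, hst⟩
    have hs' := hs.frame hF
    refine ⟨by simp [Test.Holds, hfl, hs'.one], ?_⟩
    have hx : s'.reg 14 = x := hr.1
    have hb' : s'.reg 20 = b := (hF.reg 20).trans hb
    have hAx : s'.arr 16 x = A x := by
      rw [hF.arr 16]
      exact hA x (by simp [hd])
    have hprev : s'.arr 18 = s.arr 18 := hF.arr 18
    -- As the segment has no repetition, `b` is met only at its end, so comparing with `rgB` stops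
    -- the loop in time.
    have hxb : x = b ↔ r = [] := by
      constructor
      · rintro rfl
        by_contra hne
        rw [hd] at hnd
        have h1 : x ∈ r := by
          have := congrArg List.getLast? hd
          rw [List.getLast?_append_of_ne_nil _ (by simp), List.getLast?_append_of_ne_nil _ (by simp),
            List.getLast?_cons_of_ne_nil hne] at this
          exact List.mem_of_getLast? this.symm
        rw [List.nodup_append, List.nodup_cons] at hnd
        exact hnd.2.1.1 h1
      · rintro rfl
        have := (List.append_inj' hd rfl).2
        simpa using this.symm
    have hcells : ∀ (g : ℕ → ℕ) (k : List (Fin m)) (y : Fin m), k.length = d.length → Cells g u k →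
        Cells (Function.update g (u + d.length) y) u (k ++ [y]) := by
      intro g k y hk hc
      refine cells_append.2 ⟨hc.congr fun i h1 h2 => ?_, ?_, trivial⟩
      · rw [Function.update_of_ne]
        omega
      · rw [hk, Function.update_self]
    have key : ∀ s'' : Memory, Frame [rgT, rgFlag, rgY, rgU, rgTop] [arMinus, arPlus, arSt] s s'' →
        s''.reg rgT = 2 → s''.reg rgFlag = (if r = [] then 0 else 1) → s''.reg rgTop = x →
        s''.reg rgU = u + d.length + 1 →
        s''.arr arMinus = Function.update (s'.arr arMinus) (u + d.length) x →
        s''.arr arPlus = Function.update (s'.arr arPlus) (u + d.length) (A x) →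
        s''.arr arSt = Function.update (s'.arr arSt) x 2 →
        Runs M (.load rgTop arPrev rgTop) s'' 1 fun s' =>
          l ++ [b] = (d ++ [x]) ++ r ∧
          Frame [rgT, rgFlag, rgY, rgU, rgTop] [arMinus, arPlus, arSt] s s' ∧
          s'.reg rgT = 2 ∧ s'.reg rgFlag = (if r = [] then 0 else 1) ∧
          Linked (s.arr arPrev) (s'.reg rgTop) (r ++ rest) ∧ s'.reg rgU = u + (d ++ [x]).length ∧
          Cells (s'.arr arMinus) u (d ++ [x]) ∧ Cells (s'.arr arPlus) u ((d ++ [x]).map A) ∧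
          (∀ i < u, s'.arr arMinus i = s.arr arMinus i) ∧
          (∀ i < u, s'.arr arPlus i = s.arr arPlus i) ∧
          ∀ e : Fin m, s'.arr arSt e = if e ∈ d ++ [x] then 2 else s.arr arSt e := by
      intro s'' hF' h2' hfl' hx' hu'' hm' hp' hst'
      refine Runs.load ⟨by simpa using hd, hF'.setReg _ _, by simp [h2'], by simp [hfl'], ?_,
        by simp [hu'', add_assoc], ?_, ?_, ?_, ?_, ?_⟩
      · simp only [setReg_reg, if_true, hx']
        rw [hF'.arr 18]
        exact hr.2
      · simp only [setReg_arr, hm']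
        exact hcells _ _ _ rfl hcm
      · simp only [setReg_arr, hp', List.map_append, List.map_singleton]
        exact hcells _ _ _ (by simp) hcp
      · intro i hi
        simp only [setReg_arr, hm']
        rw [Function.update_of_ne (by omega), hm i hi]
      · intro i hi
        simp only [setReg_arr, hp']
        rw [Function.update_of_ne (by omega), hp i hi]
      · intro e
        simp only [setReg_arr, hst', Function.update_apply, Fin.val_inj, hst e, List.mem_append,
          List.mem_singleton]
        by_cases h1 : e = x <;> by_cases h3 : e ∈ d <;> simp [h1, h3]
    refine Runs.seq_store (Runs.seq_load (Runs.seq_store (Runs.seq_inc (Runs.seq_store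
      (Runs.cond (t := 1 + 1) (fun h => ?_) (fun h => ?_))))))
    · simp [Test.Holds, hx, hb', Fin.val_inj] at h
      refine Runs.seq_const (key _ ?_ ?_ ?_ ?_ ?_ ?_ ?_ ?_)
      · exact (((((hF.setArr _ _ _).setReg _ _).setArr _ _ _).setReg _ _).setArr _ _ _).setReg _ _
      · simp [h2]
      · simp [hxb.1 h]
      · simp [hx]
      · simp [hu']
      · simp [hu', hx]
      · simp [hu', hx, hAx]
      · simp [hx, h2]
    · simp [Test.Holds, hx, hb', Fin.val_inj] at h
      refine (key _ ?_ ?_ ?_ ?_ ?_ ?_ ?_ ?_).le (by omega)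
      · exact ((((hF.setArr _ _ _).setReg _ _).setArr _ _ _).setReg _ _).setArr _ _ _
      · simp [h2]
      · simp [hfl, mt hxb.2 h]
      · simp [hx]
      · simp [hu']
      · simp [hu', hx]
      · simp [hu', hx, hAx]
      · simp [hx, h2]
  · rintro d s' ⟨-, hF, -, hfl, -⟩
    have hs' := hs.frame hF
    simp [Test.Holds, hfl, hs'.one]
  · exact ⟨rfl, ((Frame.refl _ _ _).setReg _ _).setReg _ _, by simp, by simp, by simpa using hl,
      by simp [hu], trivial, trivial, fun _ _ => rfl, fun _ _ => rfl, by simp⟩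
  · rintro s' ⟨-, hF, -, -, hr, hu', h⟩
    exact ⟨hF, hr, by simpa using hu', h⟩

lemma runs_search (hs : M.Env X₀ s) (hX : Indicates (s.arr arX) X) :
    Runs M Prog.search s (8 * m + 8) fun s' =>
      (Frame [rgRun, rgI, rgT, rgTop] [arSt, arPrev] s s') ∧
      ((s'.reg rgRun = 0 ∧ s'.reg rgTop = s.reg rgTop ∧ s'.arr arSt = s.arr arSt ∧
        s'.arr arPrev = s.arr arPrev ∧ ∀ x ∈ X, s.arr arSt x ≠ 0) ∨
      (s'.reg rgRun = 1 ∧ ∃ x ∈ X, s.arr arSt x = 0 ∧ s'.reg rgTop = x ∧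
        s'.arr arSt = Function.update (s.arr arSt) x 1 ∧
        s'.arr arPrev = Function.update (s.arr arPrev) x m)) := by
  refine (Runs.seq_const (Runs.seq_const (((Runs.loop_range (t := 7) (n := m) (i := 0) (fun i s' =>
    Frame [rgRun, rgI, rgT, rgTop] [] s s' ∧ s'.reg rgI = i ∧
    ((s'.reg rgRun = 0 ∧ s'.reg rgTop = s.reg rgTop ∧
      ∀ x : Fin m, x < i → x ∈ X → s.arr arSt x ≠ 0) ∨
    (s'.reg rgRun = 1 ∧ ∃ x ∈ X, s.arr arSt x = 0 ∧ s'.reg rgTop = x)))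
      (Nat.zero_le _) ?_ ?_ ?_)).bind (t₂ := 3) ?_))).le (by omega)
  · rintro i s' - him ⟨hF, hi, hcase⟩
    have hs' := hs.frame hF
    refine ⟨by simp [Test.Holds, hi, hs'.m_eq, him], ?_⟩
    obtain ⟨e, rfl⟩ : ∃ e : Fin m, i = e := ⟨⟨i, him⟩, rfl⟩
    have hXe : s'.arr 13 e = _ := (congrFun (hF.arr 13) e).trans (hX e)
    have hse : s'.arr 15 e = s.arr 15 e := congrFun (hF.arr 15) e
    have hadv : ∀ s'' : Memory, Frame [rgRun, rgI, rgT, rgTop] [] s s'' → s''.reg rgI = e →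
        s''.reg rgRun = s'.reg rgRun → s''.reg rgTop = s'.reg rgTop →
        (e ∈ X → s.arr arSt e ≠ 0) →
        Runs M (.inc rgI) s'' 1 fun s' => Frame [rgRun, rgI, rgT, rgTop] [] s s' ∧
          s'.reg rgI = e + 1 ∧ ((s'.reg rgRun = 0 ∧ s'.reg rgTop = s.reg rgTop ∧
          ∀ x : Fin m, x < (e : ℕ) + 1 → x ∈ X → s.arr arSt x ≠ 0) ∨
          (s'.reg rgRun = 1 ∧ ∃ x ∈ X, s.arr arSt x = 0 ∧ s'.reg rgTop = x)) := by
      intro s'' hF' hi' h1 h2 he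
      refine Runs.inc ⟨hF'.setReg _ _, by simp [hi'], ?_⟩
      simp only [setReg_reg]
      rw [if_neg (by decide), if_neg (by decide), h1, h2]
      refine hcase.imp_left fun h => ⟨h.1, h.2.1, fun b hb h1 => ?_⟩
      rcases (Nat.lt_succ_iff.1 hb).eq_or_lt with h3 | h3
      · obtain rfl := Fin.ext h3
        exact he h1
      · exact h.2.2 b h3 h1
    refine Runs.seq_load (Runs.cond (t := 5) (fun h => ?_) (fun h => ?_))
    · simp [Test.Holds, hi, hXe, hs'.one] at h
      refine Runs.seq_load (Runs.cond (t := 3) (fun h1 => ?_) (fun h1 => ?_))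
      · simp [Test.Holds, hi, hse, hs'.zero] at h1
        refine Runs.seq_copy (Runs.seq_const (Runs.inc ⟨?_, by simp [hi], Or.inr
          ⟨by simp, e, h, h1, by simp [hi]⟩⟩))
        exact ((((hF.setReg _ _).setReg _ _).setReg _ _).setReg _ _).setReg _ _
      · simp [Test.Holds, hi, hse, hs'.zero] at h1
        exact (hadv _ ((hF.setReg _ _).setReg _ _) (by simp [hi]) (by simp) (by simp)
          fun _ => h1).le (by omega)
    · simp [Test.Holds, hi, hXe, hs'.one] at h
      exact (hadv _ (hF.setReg _ _) (by simp [hi]) (by simp) (by simp)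
        fun h' => absurd h' h).le (by omega)
  · rintro s' ⟨hF, hi, -⟩
    have hs' := hs.frame hF
    simp [Test.Holds, hi, hs'.m_eq]
  · refine ⟨((Frame.refl _ _ s).setReg _ _).setReg _ _, by simp, Or.inl ⟨by simp, by simp, ?_⟩⟩
    intro b hb
    exact absurd hb (Nat.not_lt_zero _)
  · rintro s' ⟨hF, hi, hcase⟩
    have hs' := hs.frame hF
    refine Runs.cond (fun h => ?_) (fun h => ?_)
    · simp only [Test.Holds, hs'.one] at h
      obtain ⟨-, x, hx, h0, htop⟩ := hcase.resolve_left (by simp [h])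
      refine Runs.seq_store (Runs.store ⟨?_, Or.inr ⟨by simpa using h, x, hx, h0, ?_, ?_, ?_⟩⟩)
      · exact ((hF.mono (A := [arSt, arPrev])).setArr _ _ _).setArr _ _ _
      · simpa using htop
      · simp [htop, hs'.one, hF.arr 15]
      · simp [htop, hs'.m_eq, hF.arr 18]
    · simp only [Test.Holds, hs'.one] at h
      obtain ⟨h1, h2, h3⟩ := hcase.resolve_right (by simp [h])
      exact (Runs.skip ⟨hF.mono, Or.inl ⟨h1, h2, hF.arr 15, hF.arr 18, fun x => h3 x x.2⟩⟩).le
        (by omega)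

end CBM

/-! ### The search for a full route. -/

namespace Prog

/-- Search the link of the edge on the top of the stack. In `rgKind` there is the status of its
successor, or `2` if there is none. -/
def extend : Program :=
  findA ;; .const rgKind 2 ;;
  .cond (.lt rgA rgM) (findB ;; .cond (.lt rgB rgM) (.load rgKind arSt rgB) .skip) .skip

/-- Put the successor of the top of the stack on the stack. -/
def push : Program :=
  .store arA rgTop rgA ;; .store arB rgTop rgB ;; .store arSt rgB rgOne ;;
  .store arPrev rgB rgTop ;; .copy rgTop rgB

/-- The successor of the top is on the stack: list and apply the rotation that has been found. -/
def turn : Program :=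
  .store arA rgTop rgA ;; .store arB rgTop rgB ;; .copy rgV rgU ;; pop ;; .inc rgN ;;
  .store arU rgN rgU ;; .copy rgEnd rgU ;; apply

/-- One step of the search for rotations. -/
def step : Program :=
  .cond (.lt rgTop rgM)
    (extend ;; .cond (.eq rgKind rgZero) push (.cond (.eq rgKind rgOne) turn kill)) search

/-- Construct a full route. -/
def phaseOne : Program := .loop (.eq rgRun rgOne) step

end Prog

namespace List

variable {α : Type*} {R R' : α → α → Prop} {l : List α}

/-- The link of the top of the stack is not yet recorded, so in the chain condition `A` and `B` are
only known on the tail. -/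
lemma IsChain.imp_of_mem_tail (h : l.IsChain R)
    (hR : ∀ y z, y ∈ l → z ∈ l.tail → R y z → R' y z) : l.IsChain R' := by
  induction l with
  | nil => exact .nil
  | cons a l ih =>
    cases l with
    | nil => exact .singleton _
    | cons b l =>
      rw [isChain_cons_cons] at h ⊢
      refine ⟨hR _ _ (by simp) (by simp) h.1, ih h.2 fun y z hy hz => ?_⟩
      exact hR y z (mem_cons_of_mem _ hy) (mem_of_mem_tail hz)

lemma IsChain.exists_of_mem_tail (h : l.IsChain R) {z : α} (hz : z ∈ l.tail) :
    ∃ y ∈ l, R y z := by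
  induction l with
  | nil => simp at hz
  | cons a l ih =>
    cases l with
    | nil => simp at hz
    | cons b l =>
      rw [isChain_cons_cons] at h
      rcases mem_cons.1 hz with rfl | hz
      · exact ⟨a, by simp, h.1⟩
      · obtain ⟨y, hy, hr⟩ := ih h.2 hz
        exact ⟨y, mem_cons_of_mem _ hy, hr⟩

end List

namespace CBM

variable {X₀ X : Finset (Fin m)} {s : Memory}

lemma runs_extend (hs : M.Env X₀ s) (hX : Indicates (s.arr arX) X) (hXs : M.Stable X) {x : Fin m}
    (hx : s.reg rgTop = x) (hxX : x ∈ X) :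
    Runs M Prog.extend s (19 * m + 10) fun s' =>
      Frame [rgE, rgA, rgF, rgT, rgB, rgI, rgKind] [arX, arO] s s' ∧ Indicates (s'.arr arX) X ∧
      ((s'.reg rgKind = 2 ∧ ∀ a b, ¬ M.Link X x a b) ∨
      ∃ a b : Fin m, s'.reg rgA = a ∧ s'.reg rgB = b ∧ M.Link X x a b ∧
        s'.reg rgKind = s.arr arSt b) := by
  refine ((runs_findA hs hX hXs hx hxX).bind (t₂ := 10 * m + 7) ?_).le (by omega)
  rintro s₁ ⟨hF₁, hX₁, hcase⟩
  have hs₁ := hs.frame hF₁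
  refine (Runs.seq_const (Runs.cond (t := 10 * m + 5) (fun h => ?_) (fun h => ?_)))
  · simp [Test.Holds, hs₁.m_eq] at h
    obtain ⟨a, ha, hw, hr, hbt, hac, hf, hc⟩ := hcase.resolve_left (fun h' => by omega)
    refine (runs_findB (hs₁.frame ((Frame.refl [rgKind] [] _).setReg rgKind 2)) (by simpa using hX₁)
      (by simpa using hf) (by simpa using hc)).bind (t₂ := 2) ?_
    rintro s₂ ⟨hF₂, hcase₂⟩
    have hF := (((hF₁.mono (R := [rgE, rgA, rgF, rgT, rgB, rgI, rgKind]) (A := [arX, arO])).setReg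
      rgKind 2).trans hF₂)
    have hs₂ := hs.frame hF
    have hX₂ : Indicates (s₂.arr arX) X := by
      rw [hF₂.arr arX]
      exact hX₁
    refine Runs.cond (fun h' => ?_) (fun h' => ?_)
    · simp [Test.Holds, hs₂.m_eq] at h'
      obtain ⟨b, hb, hbX, hbc⟩ := hcase₂.resolve_left (fun h' => by omega)
      refine Runs.load ⟨hF.setReg _ _, hX₂, Or.inr ⟨a, b, ?_, by simpa using hb, ?_, ?_⟩⟩
      · simpa [hF₂.reg rgA] using ha
      · exact hXs.link_of_not_mem hxX hw hr hbt hac hbX hbc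
      · simp [hb, hF.arr 15]
    · simp [Test.Holds, hs₂.m_eq] at h'
      have hb := hcase₂.resolve_right (by
        rintro ⟨b, hb, -⟩
        have := b.2
        omega)
      refine Runs.skip ⟨hF, hX₂, Or.inl ⟨by simp [hF₂.reg rgKind], fun a' b' hl => ?_⟩⟩
      -- Any link of `x` would have to use the same best candidate; its displaced edge belongs to
      -- the firm of `a` and would have been found.
      have haa : a' = a := by
        apply M.rk_inj (hl.wk_eq.trans hw.symm)
        rcases lt_trichotomy (M.rk a') (M.rk a) with h1 | h1 | h1
        · exact absurd hac (hl.between a hw h1 hr)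
        · exact h1
        · exact absurd hl.mem_ch (hbt a' hl.wk_eq h1 hl.rk_lt)
      subst haa
      exact hl.not_mem_ch hXs (hb.2 b' hl.mem' (hl.fm_eq hXs))
  · simp [Test.Holds, hs₁.m_eq] at h
    have hn := hcase.resolve_right (by
      rintro ⟨a, ha, -⟩
      have := a.2
      omega)
    refine (Runs.skip ⟨(hF₁.mono).setReg _ _, hX₁, Or.inl ⟨by simp, fun a b hl => ?_⟩⟩).le (by omega)
    exact hn.2 a hl.wk_eq hl.rk_lt hl.mem_ch

variable (M) in
/-- The state of the search for rotations: `X` is the current stable matching, `l` is the stack,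
`K` is the set of edges that have ever been on the stack, and `Cs` lists the rotations found. -/
structure StackInv (X₀ X : Finset (Fin m)) (l : List (Fin m)) (K : Finset (Fin m))
    (A B : Fin m → Fin m) (Cs : List (List (Fin m))) (s : Memory) : Prop where
  env : M.Env X₀ s
  xind : Indicates (s.arr arX) X
  recd : M.Recorded A B X₀ X Cs
  linked : Linked (s.arr arPrev) (s.reg rgTop) l
  nodup : l.Nodup
  sub : ∀ x ∈ l, x ∈ X
  chain : l.IsChain fun y z => M.Link X z (A z) y ∧ B z = y
  -- Status `0` means never on the stack, `1` on it now, and `2` removed from it.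
  one_iff : ∀ e : Fin m, s.arr arSt e = 1 ↔ e ∈ l
  zero_iff : ∀ e : Fin m, s.arr arSt e = 0 ↔ e ∉ K
  le_two : ∀ e : Fin m, s.arr arSt e ≤ 2
  dead : ∀ e : Fin m, s.arr arSt e = 2 → e ∈ X → M.Dead X e
  -- Ensures that edges brought in by a rotation carry no old mark: a worker's edge only gets worse,
  -- so nothing worse than its current edge has been on the stack.
  above : ∀ e ∈ K, ∃ x ∈ X, M.wk x = M.wk e ∧ M.rk x ≤ M.rk e
  done : ∀ x ∈ Cs.flatten, s.arr arSt x = 2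
  memA : ∀ x ∈ Cs.flatten ++ l.tail, s.arr arA x = A x
  memB : ∀ x ∈ Cs.flatten ++ l.tail, s.arr arB x = B x
  minus : Cells (s.arr arMinus) 0 Cs.flatten
  plus : Cells (s.arr arPlus) 0 (Cs.flatten.map A)
  n_eq : s.reg rgN = Cs.length
  u_eq : s.reg rgU = Cs.flatten.length
  offs : ∀ i ≤ Cs.length, s.arr arU i = (Cs.take i).flatten.length

namespace StackInv

variable {l : List (Fin m)} {K : Finset (Fin m)} {A B : Fin m → Fin m} {Cs : List (List (Fin m))}

lemma stable (h : M.StackInv X₀ X l K A B Cs s) (h₀ : M.Stable X₀) : M.Stable X :=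
  h.recd.route.stable h₀

/-- Changes outside of the data structures of the search do not matter. -/
lemma frame {R R' : List ℕ} {s' : Memory} (h : M.StackInv X₀ X l K A B Cs s)
    (hF : Frame R R' s s') (hX : Indicates (s'.arr arX) X)
    (hR : (rgM ∉ R ∧ rgZero ∉ R ∧ rgOne ∉ R) ∧ rgTop ∉ R ∧ rgN ∉ R ∧ rgU ∉ R := by decide)
    (hR' : (arFm ∉ R' ∧ arNx ∉ R' ∧ arMin ∉ R') ∧ arPrev ∉ R' ∧ arSt ∉ R' ∧ arA ∉ R' ∧ arB ∉ R' ∧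
      arMinus ∉ R' ∧ arPlus ∉ R' ∧ arU ∉ R' := by decide) :
    M.StackInv X₀ X l K A B Cs s' := by
  obtain ⟨h1, h2, h3, h4⟩ := hR
  obtain ⟨k1, k2, k3, k4, k5, k6, k7, k8⟩ := hR'
  have hst := hF.arr arSt k3
  constructor
  · exact h.env.frame hF h1 k1
  · exact hX
  · exact h.recd
  · rw [hF.arr _ k2, hF.reg _ h2]
    exact h.linked
  · exact h.nodup
  · exact h.sub
  · exact h.chain
  · rw [hst]; exact h.one_iff
  · rw [hst]; exact h.zero_iff
  · rw [hst]; exact h.le_two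
  · rw [hst]; exact h.dead
  · exact h.above
  · rw [hst]; exact h.done
  · rw [hF.arr _ k4]; exact h.memA
  · rw [hF.arr _ k5]; exact h.memB
  · rw [hF.arr _ k6]; exact h.minus
  · rw [hF.arr _ k7]; exact h.plus
  · rw [hF.reg _ h3]; exact h.n_eq
  · rw [hF.reg _ h4]; exact h.u_eq
  · rw [hF.arr _ k8]; exact h.offs

lemma length_le (h : M.StackInv X₀ X l K A B Cs s) : l.length ≤ m := by
  simpa using h.nodup.length_le_card

lemma top_eq_iff (h : M.StackInv X₀ X l K A B Cs s) : s.reg rgTop < m ↔ l ≠ [] := by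
  have := h.linked
  cases l with
  | nil => simp [show s.reg rgTop = m from this]
  | cons x l => simp [this.1]

/-- Recording the link of the top of the stack. -/
lemma setLink {x : Fin m} {t : List (Fin m)} (h : M.StackInv X₀ X (x :: t) K A B Cs s)
    {a b : Fin m} (hl : M.Link X x a b) (ha : s.reg rgA = a) (hb : s.reg rgB = b) :
    ∃ A' B', M.StackInv X₀ X (x :: t) K A' B' Cs
        ((s.setArr arA (s.reg rgTop) (s.reg rgA)).setArr arB (s.reg rgTop) (s.reg rgB)) ∧
      A' x = a ∧ B' x = b ∧
      (∀ z ∈ x :: t, Function.update (s.arr arA) x a z = A' z ∧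
        Function.update (s.arr arB) x b z = B' z) ∧
      ∀ z ∈ x :: t, M.Link X z (A' z) (B' z) := by
  -- Recorded edges have status `2`, the top has status `1`; so overwriting the entries of `x`
  -- spoils no recorded rotation.
  have hxC : ∀ z ∈ Cs.flatten, z ≠ x := by
    rintro z hz rfl
    have h1 := h.done z hz
    have h2 := (h.one_iff z).2 List.mem_cons_self
    omega
  have hxt : ∀ z ∈ t, z ≠ x := by
    rintro z hz rfl
    exact (List.nodup_cons.1 h.nodup).1 hz
  have hx : s.reg 14 = x := h.linked.1
  have hne : ∀ z ∈ Cs.flatten ++ (x :: t).tail, z ≠ x := fun z hz =>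
    (List.mem_append.1 hz).elim (hxC z) (hxt z)
  have hneN : ∀ z ∈ Cs.flatten ++ (x :: t).tail, (z : ℕ) ≠ x := fun z hz h' =>
    hne z hz (Fin.ext h')
  have hA : ∀ z ∈ Cs.flatten ++ (x :: t).tail, Function.update A x a z = A z := fun z hz =>
    Function.update_of_ne (hne z hz) _ _
  have hB : ∀ z ∈ Cs.flatten ++ (x :: t).tail, Function.update B x b z = B z := fun z hz =>
    Function.update_of_ne (hne z hz) _ _
  have hmA : ∀ z ∈ Cs.flatten ++ (x :: t).tail, Function.update (s.arr arA) x a z =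
      Function.update A x a z := fun z hz => by
    rw [hA z hz, Function.update_of_ne (hneN z hz)]
    exact h.memA z hz
  have hmB : ∀ z ∈ Cs.flatten ++ (x :: t).tail, Function.update (s.arr arB) x b z =
      Function.update B x b z := fun z hz => by
    rw [hB z hz, Function.update_of_ne (hneN z hz)]
    exact h.memB z hz
  have hchain : (x :: t).IsChain fun y z => M.Link X z (Function.update A x a z) y ∧
      Function.update B x b z = y := by
    refine h.chain.imp_of_mem_tail fun y z _ hz hr => ?_
    rwa [hA z (List.mem_append_right _ hz), hB z (List.mem_append_right _ hz)]
  refine ⟨Function.update A x a, Function.update B x b, ?_, by simp, by simp, ?_, ?_⟩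
  · constructor
    · exact h.env.frame (((Frame.refl [] [arA, arB] s).setArr _ _ _).setArr _ _ _)
    · simpa using h.xind
    · exact h.recd.congr (fun z hz => hA z (List.mem_append_left _ hz))
        fun z hz => hB z (List.mem_append_left _ hz)
    · simpa using h.linked
    · exact h.nodup
    · exact h.sub
    · exact hchain
    · simpa using h.one_iff
    · simpa using h.zero_iff
    · simpa using h.le_two
    · simpa using h.dead
    · exact h.above
    · simpa using h.done
    · intro z hz
      rw [← hmA z hz]
      simp [hx, ha]
    · intro z hz
      rw [← hmB z hz]
      simp [hx, hb]
    · simpa using h.minus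
    · rw [List.map_congr_left fun z hz => hA z (List.mem_append_left _ hz)]
      simpa using h.plus
    · simpa using h.n_eq
    · simpa using h.u_eq
    · simpa using h.offs
  · intro z hz
    rcases List.mem_cons.1 hz with rfl | hz
    · simp
    · have hz' : z ∈ Cs.flatten ++ (x :: t).tail := List.mem_append_right _ hz
      exact ⟨hmA z hz', hmB z hz'⟩
  · intro z hz
    rcases List.mem_cons.1 hz with rfl | hz
    · simpa using hl
    · obtain ⟨y, -, hr⟩ := hchain.exists_of_mem_tail hz
      rw [hr.2]
      exact hr.1

/-- All edges on the stack are dead if its top is. -/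
lemma dead_of_top {x : Fin m} {t : List (Fin m)} (hXs : M.Stable X)
    (h : (x :: t).IsChain fun y z => M.Link X z (A z) y ∧ B z = y) (hx : M.Dead X x) :
    ∀ z ∈ x :: t, M.Dead X z := by
  induction t generalizing x with
  | nil => simpa using hx
  | cons y t ih =>
    rw [List.isChain_cons_cons] at h
    intro z hz
    rcases List.mem_cons.1 hz with rfl | hz
    · exact hx
    · exact ih h.2 (dead_of_link hXs h.1.1 hx) z hz

end StackInv

end CBM

namespace CBM

variable {X₀ X : Finset (Fin m)} {s : Memory} {l : List (Fin m)} {K : Finset (Fin m)}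
  {A B : Fin m → Fin m} {Cs : List (List (Fin m))}

lemma runs_push {x : Fin m} {t : List (Fin m)} (h : M.StackInv X₀ X (x :: t) K A B Cs s)
    {a b : Fin m} (hl : M.Link X x a b) (ha : s.reg rgA = a) (hb : s.reg rgB = b)
    (hst : s.arr arSt b = 0) :
    Runs M Prog.push s 5 fun s' => s'.reg rgRun = s.reg rgRun ∧
      ∃ A' B', M.StackInv X₀ X (b :: x :: t) (insert b K) A' B' Cs s' := by
  obtain ⟨A', B', h', hAx, hBx, -, -⟩ := h.setLink hl ha hb
  have hbK : b ∉ K := (h.zero_iff b).1 hst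
  have hxb : b ∉ x :: t := by
    rw [← h.one_iff, hst]
    decide
  have hneN : ∀ z ∈ x :: t, (z : ℕ) ≠ b := fun z hz h' => hxb (by rwa [← Fin.ext h'])
  have htop : s.reg rgTop = x := h.linked.1
  refine Runs.seq_store (Runs.seq_store ?_)
  generalize hs₁ : (s.setArr arA (s.reg rgTop) (s.reg rgA)).setArr arB (s.reg rgTop) (s.reg rgB) =
    s₁ at h'
  replace hs₁ : s₁ =
    (s.setArr arA (s.reg rgTop) (s.reg rgA)).setArr arB (s.reg rgTop) (s.reg rgB) := hs₁.symm
  change Runs M _ ((s.setArr arA (s.reg rgTop) (s.reg rgA)).setArr arB (s.reg rgTop) (s.reg rgB)) _ _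
  rw [← hs₁]
  have hb₁ : s₁.reg rgB = b := by rw [hs₁]; exact hb
  have ht₁ : s₁.reg rgTop = x := by rw [hs₁]; exact htop
  have hr₁ : s₁.reg rgRun = s.reg rgRun := by rw [hs₁]; rfl
  have hst₁ : s₁.arr arSt = s.arr arSt := by simp [hs₁]
  have hA₁ : s₁.arr arA x = a := by simp [hs₁, htop, ha]
  have hB₁ : s₁.arr arB x = b := by simp [hs₁, htop, hb]
  clear hs₁
  refine Runs.seq_store (Runs.seq_store (Runs.copy ⟨by simp [hr₁], A', B', ?_⟩))
  have hstN : ∀ e : Fin m, Function.update (s₁.arr arSt) b 1 e = if e = b then 1 else s.arr arSt e := by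
    intro e
    simp [Function.update_apply, hst₁, Fin.val_inj]
  constructor
  · exact h'.env.frame ((((Frame.refl [rgTop] [arSt, arPrev] s₁).setArr _ _ _).setArr _ _ _).setReg _ _)
  · simpa using h'.xind
  · exact h'.recd
  · simp only [setReg_reg, setReg_arr, setArr_arr, setArr_reg, if_true, hb₁, ht₁, Linked,
      Function.update_self, true_and,
      if_neg (show ¬ ((18 : ℕ) = 15) by decide)]
    rw [Function.update_of_ne (hneN x (by simp))]
    exact h'.linked.2.congr fun y hy =>
      Function.update_of_ne (hneN y (List.mem_cons_of_mem _ hy)) _ _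
  · exact List.nodup_cons.2 ⟨hxb, h'.nodup⟩
  · intro y hy
    rcases List.mem_cons.1 hy with rfl | hy
    · exact hl.mem'
    · exact h'.sub y hy
  · refine List.isChain_cons_cons.2 ⟨⟨?_, hBx⟩, h'.chain⟩
    rwa [hAx]
  · intro e
    simp only [setReg_arr, setArr_arr, if_neg (show ¬ ((15 : ℕ) = 18) by decide), if_true, hb₁,
      h'.env.one, hstN e, List.mem_cons]
    by_cases he : e = b
    · simp [he]
    · simpa [he] using h.one_iff e
  · intro e
    simp only [setReg_arr, setArr_arr, if_neg (show ¬ ((15 : ℕ) = 18) by decide), if_true, hb₁,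
      h'.env.one, hstN e, Finset.mem_insert]
    by_cases he : e = b
    · simp [he]
    · simpa [he] using h.zero_iff e
  · intro e
    simp only [setReg_arr, setArr_arr, if_neg (show ¬ ((15 : ℕ) = 18) by decide), if_true, hb₁,
      h'.env.one, hstN e]
    by_cases he : e = b
    · simp [he]
    · simpa [he] using h.le_two e
  · intro e
    simp only [setReg_arr, setArr_arr, if_neg (show ¬ ((15 : ℕ) = 18) by decide), if_true, hb₁,
      h'.env.one, hstN e]
    by_cases he : e = b
    · simp [he]
    · simpa [he] using h.dead e
  · intro e he
    rcases Finset.mem_insert.1 he with rfl | he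
    · exact ⟨e, hl.mem', rfl, le_rfl⟩
    · exact h.above e he
  · intro e he
    simp only [setReg_arr, setArr_arr, if_neg (show ¬ ((15 : ℕ) = 18) by decide), if_true, hb₁,
      h'.env.one, hstN e]
    have h1 := h.done e he
    rw [if_neg, h1]
    rintro rfl
    omega
  · intro e he
    have : e = x ∨ e ∈ Cs.flatten ++ t := by
      simp only [List.tail_cons, List.mem_append, List.mem_cons] at he ⊢
      tauto
    rcases this with rfl | he
    · simp [hA₁, hAx]
    · simpa using h'.memA e he
  · intro e he
    have : e = x ∨ e ∈ Cs.flatten ++ t := by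
      simp only [List.tail_cons, List.mem_append, List.mem_cons] at he ⊢
      tauto
    rcases this with rfl | he
    · simp [hB₁, hBx]
    · simpa using h'.memB e he
  · simpa using h'.minus
  · simpa using h'.plus
  · simpa using h'.n_eq
  · simpa using h'.u_eq
  · simpa using h'.offs

/-- Each stack entry has the entry above it as its successor, so deadness of the top spreads down
the whole stack. -/
lemma runs_kill_stack {x : Fin m} {t : List (Fin m)} (h₀ : M.Stable X₀)
    (h : M.StackInv X₀ X (x :: t) K A B Cs s) (hx : M.Dead X x) :
    Runs M Prog.kill s (3 * m + 2) fun s' => s'.reg rgRun = s.reg rgRun ∧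
      M.StackInv X₀ X [] K A B Cs s' := by
  have hdead := StackInv.dead_of_top (h.stable h₀) h.chain hx
  have hlen := h.length_le
  refine (runs_kill h.env h.linked).mono (by omega) ?_
  rintro s' ⟨hF, htop, hst⟩
  refine ⟨hF.reg _, ?_⟩
  have hone : ∀ e : Fin m, e ∈ x :: t → s.arr arSt e = 1 := fun e => (h.one_iff e).2
  constructor
  · exact h.env.frame hF
  · rw [hF.arr arX]; exact h.xind
  · exact h.recd
  · exact htop
  · exact List.nodup_nil
  · simp
  · exact .nil
  · intro e
    rw [hst]
    by_cases he : e ∈ x :: t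
    · simp [he]
    · simp only [if_neg he]
      simpa using mt (h.one_iff e).1 he
  · intro e
    rw [hst]
    by_cases he : e ∈ x :: t
    · have h1 := hone e he
      have h2 := h.zero_iff e
      rw [if_pos he]
      rw [h1] at h2
      simpa using h2
    · rw [if_neg he]
      exact h.zero_iff e
  · intro e
    rw [hst]
    split_ifs
    · exact le_rfl
    · exact h.le_two e
  · intro e
    rw [hst]
    split_ifs with he
    · exact fun _ _ => hdead e he
    · exact h.dead e
  · exact h.above
  · intro e he
    rw [hst]
    split_ifs
    · rfl
    · exact h.done e he
  · intro e he
    rw [hF.arr arA]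
    rw [List.tail_nil, List.append_nil] at he
    exact h.memA e (List.mem_append_left _ he)
  · intro e he
    rw [hF.arr arB]
    rw [List.tail_nil, List.append_nil] at he
    exact h.memB e (List.mem_append_left _ he)
  · rw [hF.arr arMinus]; exact h.minus
  · rw [hF.arr arPlus]; exact h.plus
  · rw [hF.reg rgN]; exact h.n_eq
  · rw [hF.reg rgU]; exact h.u_eq
  · rw [hF.arr arU]; exact h.offs

/-- With an empty stack no edge has status `1`. If no edge of `X` has status `0` either, all have
status `2` and are dead, and the route is complete. -/
lemma runs_search_stack (h : M.StackInv X₀ X [] K A B Cs s) :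
    Runs M Prog.search s (8 * m + 8) fun s' =>
      (s'.reg rgRun = 0 ∧ M.StackInv X₀ X [] K A B Cs s' ∧ ∀ x ∈ X, M.Dead X x) ∨
      (s'.reg rgRun = 1 ∧ ∃ x, x ∉ K ∧ M.StackInv X₀ X [x] (insert x K) A B Cs s') := by
  refine (runs_search h.env h.xind).mono le_rfl ?_
  rintro s' ⟨hF, ⟨hr, htop, hst, hprev, hall⟩ | ⟨hr, x, hx, hx0, htop, hst, hprev⟩⟩
  · refine Or.inl ⟨hr, ?_, fun x hx => ?_⟩
    · constructor
      · exact h.env.frame hF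
      · rw [hF.arr arX]; exact h.xind
      · exact h.recd
      · rw [hprev, htop]; exact h.linked
      · exact h.nodup
      · exact h.sub
      · exact h.chain
      · rw [hst]; exact h.one_iff
      · rw [hst]; exact h.zero_iff
      · rw [hst]; exact h.le_two
      · rw [hst]; exact h.dead
      · exact h.above
      · rw [hst]; exact h.done
      · rw [hF.arr arA]; exact h.memA
      · rw [hF.arr arB]; exact h.memB
      · rw [hF.arr arMinus]; exact h.minus
      · rw [hF.arr arPlus]; exact h.plus
      · rw [hF.reg rgN]; exact h.n_eq
      · rw [hF.reg rgU]; exact h.u_eq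
      · rw [hF.arr arU]; exact h.offs
    · have h1 := h.le_two x
      have h2 := hall x hx
      have h3 : s.arr 15 x ≠ 1 := fun h3 => by simpa using (h.one_iff x).1 h3
      exact h.dead x (by omega) hx
  · have hstN : ∀ e : Fin m, s'.arr arSt e = if e = x then 1 else s.arr arSt e := by
      intro e
      simp [hst, Function.update_apply, Fin.val_inj]
    refine Or.inr ⟨hr, x, (h.zero_iff x).1 hx0, ?_⟩
    constructor
    · exact h.env.frame hF
    · rw [hF.arr arX]; exact h.xind
    · exact h.recd
    · exact ⟨htop, by simp [Linked, hprev]⟩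
    · simp
    · simpa using hx
    · exact .singleton _
    · intro e
      rw [hstN]
      by_cases he : e = x
      · simp [he]
      · simpa [he] using h.one_iff e
    · intro e
      rw [hstN, Finset.mem_insert]
      by_cases he : e = x
      · simp [he]
      · simpa [he] using h.zero_iff e
    · intro e
      rw [hstN]
      split_ifs
      · decide
      · exact h.le_two e
    · intro e
      rw [hstN]
      split_ifs with he
      · simp
      · exact h.dead e
    · intro e he
      rcases Finset.mem_insert.1 he with rfl | he
      · exact ⟨e, hx, rfl, le_rfl⟩
      · exact h.above e he
    · intro e he
      rw [hstN, if_neg]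
      · exact h.done e he
      · rintro rfl
        have := h.done e he
        omega
    · rw [hF.arr arA]; exact h.memA
    · rw [hF.arr arB]; exact h.memB
    · rw [hF.arr arMinus]; exact h.minus
    · rw [hF.arr arPlus]; exact h.plus
    · rw [hF.reg rgN]; exact h.n_eq
    · rw [hF.reg rgU]; exact h.u_eq
    · rw [hF.arr arU]; exact h.offs

/-- The successor `b` of the top closes a cycle consisting of the segment from the top down to `b`.
The entries below it are not moved, so after the rotation they remain a valid stack and the search
need not restart. -/
lemma runs_turn {x : Fin m} {t : List (Fin m)} (h₀ : M.Stable X₀)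
    (h : M.StackInv X₀ X (x :: t) K A B Cs s) {a b : Fin m} (hl : M.Link X x a b)
    (ha : s.reg rgA = a) (hb : s.reg rgB = b) (hst : s.arr arSt b = 1) :
    Runs M Prog.turn s (15 * m + 10) fun s' => s'.reg rgRun = s.reg rgRun ∧
      ∃ X' l' A' B' Cs', l'.length < (x :: t).length ∧ M.StackInv X₀ X' l' K A' B' Cs' s' := by
  obtain ⟨A', B', h', hAx, hBx, hAB, hlink⟩ := h.setLink hl ha hb
  have hXs := h.stable h₀
  obtain ⟨l₁, rest, hsplit⟩ := List.append_of_mem ((h.one_iff b).1 hst)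
  have hne : l₁ ++ [b] ≠ [] := by simp
  have hsplit' : x :: t = (l₁ ++ [b]) ++ rest := by simp [hsplit]
  have hnd := h.nodup
  rw [hsplit'] at hnd
  have hndc : (l₁ ++ [b]).Nodup := (List.nodup_append.1 hnd).1
  have hcsub : ∀ z ∈ l₁ ++ [b], z ∈ x :: t := fun z hz => by
    rw [hsplit']; exact List.mem_append_left _ hz
  have hdisj : ∀ z ∈ rest, z ∉ l₁ ++ [b] := fun z hz hz' =>
    (List.nodup_append.1 hnd).2.2 z hz' z hz rfl
  have hlc : ∀ z ∈ l₁ ++ [b], M.Link X z (A' z) (B' z) := fun z hz => hlink z (hcsub z hz)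
  have hcyc : M.IsCycle X (rotOf A' (l₁ ++ [b])) := by
    refine isCycle_rotOf hne hndc hlc ?_
    -- Putting `b` on top again, as the successor of `x`, gives the closed form of the cycle; the
    -- part below the lower copy of `b` is then cut off.
    have h1 : List.IsChain (fun y z => B' z = y) (b :: x :: t) := by
      refine List.isChain_cons_cons.2 ⟨hBx, h'.chain.imp fun y z h => h.2⟩
    rw [hsplit', ← List.cons_append] at h1
    simpa using (List.isChain_append.1 h1).1
  have hX's := hcyc.stable_app hXs
  have hle := hcyc.le_app hXs
  have hminus : ∀ z, z ∈ (rotOf A' (l₁ ++ [b])).minus ↔ z ∈ l₁ ++ [b] := fun z => by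
    simp only [rotOf, List.mem_toFinset]
  refine (Runs.seq_store (Runs.seq_store ?_)).le (show 15 * m + 8 + 1 + 1 ≤ _ by omega)
  set s₁ := (s.setArr arA (s.reg rgTop) (s.reg rgA)).setArr arB (s.reg rgTop) (s.reg rgB) with hs₁
  have hlen := h.length_le
  have hlen' : l₁.length + 1 + rest.length = (x :: t).length := by simp [hsplit']; omega
  refine (Runs.seq_copy (((runs_pop (A := A') (u := Cs.flatten.length) (rest := rest)
    (h'.env.frame ((Frame.refl [rgV] [] s₁).setReg rgV _)) hndc
    ?_ ?_ ?_ ?_).bind (t₂ := 6 * m + 4) ?_))).le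
    (show 9 * (l₁.length + 1) + 3 + (6 * m + 4) + 1 ≤ _ by omega)
  · have := h'.linked
    rw [hsplit] at this
    simpa using this
  · simpa [hs₁] using hb
  · intro z hz
    have := (hAB z (hcsub z hz)).1
    rw [← ha, ← (show s.reg 14 = x from h.linked.1)] at this
    simpa [hs₁] using this
  · simpa using h'.u_eq
  rintro s₂ ⟨hF₂, hr₂, hu₂, hcm, hcp, hm, hp, hst₂⟩
  have hN₂ : s₂.reg 0 = Cs.length := by
    rw [hF₂.reg 0]
    simpa using h'.n_eq
  have hU₂ : s₂.arr 0 = s₁.arr 0 := by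
    rw [hF₂.arr 0, setReg_arr]
  have hFa := ((Frame.refl [rgV] [] s₁).setReg rgV (s₁.reg rgU))
  have hFb := (hFa.mono (R := [rgV, rgN, rgEnd, rgT, rgFlag, rgY, rgU, rgTop])
    (A := [arMinus, arPlus, arSt, arU, arX])).trans hF₂
  refine (Runs.seq_inc (Runs.seq_store (Runs.seq_copy ((runs_apply (X₀ := X₀) (X := X)
    (u := Cs.flatten.length) (c := l₁ ++ [b]) (A := A') ?_ ?_ ?_ ?_ ?_ ?_ ?_).mono le_rfl ?_)))).le
    (show 6 * (l₁ ++ [b]).length + 1 + 1 + 1 + 1 ≤ _ by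
      rw [List.length_append, List.length_singleton]; omega)
  · exact h'.env.frame (((hFb.setReg _ _).setArr _ _ _).setReg _ _)
  · simp only [setReg_arr, setArr_arr, if_neg (show ¬ ((13 : ℕ) = 0) by decide)]
    rw [hF₂.arr 13]
    exact h'.xind
  · intro y hy z hz heq
    exact (hlc z hz).not_mem hXs (heq ▸ (hlc y hy).mem)
  · simp only [setReg_reg, setArr_reg, if_neg (show ¬ ((24 : ℕ) = 25) by decide),
      if_neg (show ¬ ((24 : ℕ) = 0) by decide)]
    rw [hF₂.reg 24]
    simpa using h'.u_eq
  · simpa using hu₂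
  · simpa using hcm
  · simpa using hcp
  rintro s₃ ⟨hF₃, hX₃⟩
  set s₂' := (((s₂.setReg 0 (s₂.reg 0 + 1)).setArr 0 ((s₂.setReg 0 (s₂.reg 0 + 1)).reg 0)
    ((s₂.setReg 0 (s₂.reg 0 + 1)).reg 11)).setReg 25 _) with hs₂'
  have hFc : Frame [rgV, rgN, rgEnd, rgT, rgFlag, rgY, rgU, rgTop]
      [arMinus, arPlus, arSt, arU, arX] s₁ s₃ :=
    (((hFb.setReg _ _).setArr _ _ _).setReg _ _).trans hF₃
  have hst₃ : ∀ e : Fin m, s₃.arr arSt e = if e ∈ l₁ ++ [b] then 2 else s.arr arSt e := by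
    intro e
    rw [hF₃.arr arSt]
    simpa [hs₂', hs₁] using hst₂ e
  have hin : ∀ e ∈ l₁ ++ [b], s.arr arSt e = 1 := fun e he => (h.one_iff e).2 (hcsub e he)
  have hrest : ∀ z ∈ rest, z ∈ (rotOf A' (l₁ ++ [b])).app X := by
    intro z hz
    refine Finset.mem_union_left _ (Finset.mem_sdiff.2 ⟨h.sub z (by rw [hsplit']; simp [hz]), ?_⟩)
    rw [hminus]
    exact hdisj z hz
  refine ⟨?_, (rotOf A' (l₁ ++ [b])).app X, rest, A', B', Cs ++ [l₁ ++ [b]], by omega, ?_⟩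
  · rw [hFc.reg rgRun]
    simp [hs₁]
  constructor
  · exact h'.env.frame hFc
  · exact hX₃
  · exact h'.recd.snoc h₀ hcyc hndc hlc
  · rw [hF₃.arr 18, hF₃.reg 14]
    simp only [hs₂', setReg_reg, setReg_arr, setArr_arr, setArr_reg,
      if_neg (show ¬ ((18 : ℕ) = 0) by decide), if_neg (show ¬ ((14 : ℕ) = 0) by decide),
      if_neg (show ¬ ((14 : ℕ) = 25) by decide)]
    rw [hF₂.arr 18]
    exact hr₂
  · exact (List.nodup_append.1 hnd).2.1
  · exact hrest
  · have h1 := h'.chain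
    rw [hsplit'] at h1
    -- Both ends of each remaining link stay in the new stable set, so the links persist.
    refine (List.isChain_append.1 h1).2.1.imp_of_mem_tail fun y z hy hz hr => ⟨?_, hr.2⟩
    exact hr.1.persist hXs hX's hle (hrest z (List.mem_of_mem_tail hz)) (hrest y hy)
  · intro e
    rw [hst₃]
    by_cases he : e ∈ l₁ ++ [b]
    · rw [if_pos he]
      exact ⟨fun h => by omega, fun h1 => absurd he (hdisj e h1)⟩
    · rw [if_neg he, h.one_iff, hsplit', List.mem_append]
      tauto
  · intro e
    rw [hst₃]
    by_cases he : e ∈ l₁ ++ [b]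
    · have h1 := hin e he
      have h2 := h.zero_iff e
      rw [h1] at h2
      rw [if_pos he]
      simpa using h2
    · rw [if_neg he]
      exact h.zero_iff e
  · intro e
    rw [hst₃]
    split_ifs
    · exact le_rfl
    · exact h.le_two e
  · intro e he heX
    rw [hst₃] at he
    split_ifs at he with hec
    · exact absurd heX (hcyc.not_mem_app hXs ((hminus e).2 hec))
    · rcases Finset.mem_union.1 heX with h1 | h1
      · exact (h.dead e he (Finset.mem_sdiff.1 h1).1).mono hle
      -- A newly added edge with status `2` would have been on the stack, though it is worse than
      -- the edge its worker held in `X`; `above` excludes this.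
      · exfalso
        obtain ⟨y, b', hly, -⟩ := hcyc.exists_link_of_plus h1
        have heK : e ∈ K := by
          by_contra hn
          have := (h.zero_iff e).2 hn
          omega
        obtain ⟨z, hz, hw, hr⟩ := h.above e heK
        have : z = y := hXs.eq_of_wk hz hly.mem (hw.trans hly.wk_eq)
        subst this
        have := hly.rk_lt
        omega
  · intro e he
    obtain ⟨z, hz, hw, hr⟩ := h.above e he
    obtain ⟨y, hy, hw', hr'⟩ := hle.exists_worse hXs hX's hz
    exact ⟨y, hy, hw'.trans hw, hr'.trans hr⟩
  · intro e he
    rw [hst₃]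
    split_ifs with hec
    · rfl
    · simp only [List.flatten_append, List.flatten_singleton, List.mem_append] at he hec
      exact h.done e (he.resolve_right hec)
  · intro e he
    rw [hFc.arr arA]
    have : e ∈ x :: t ∨ e ∈ Cs.flatten ++ (x :: t).tail := by
      rw [List.mem_append, List.flatten_append, List.flatten_singleton, List.mem_append] at he
      rcases he with (he | he) | he
      · exact Or.inr (List.mem_append_left _ he)
      · exact Or.inl (hcsub e he)
      · left
        rw [hsplit']
        exact List.mem_append_right _ (List.mem_of_mem_tail he)
    rcases this with he | he
    · have := (hAB e he).1
      rw [← ha, ← (show s.reg 14 = x from h.linked.1)] at this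
      simpa [hs₁] using this
    · exact h'.memA e he
  · intro e he
    rw [hFc.arr arB]
    have : e ∈ x :: t ∨ e ∈ Cs.flatten ++ (x :: t).tail := by
      rw [List.mem_append, List.flatten_append, List.flatten_singleton, List.mem_append] at he
      rcases he with (he | he) | he
      · exact Or.inr (List.mem_append_left _ he)
      · exact Or.inl (hcsub e he)
      · left
        rw [hsplit']
        exact List.mem_append_right _ (List.mem_of_mem_tail he)
    rcases this with he | he
    · have := (hAB e he).2
      rw [← hb, ← (show s.reg 14 = x from h.linked.1)] at this
      simpa [hs₁] using this
    · exact h'.memB e he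
  · rw [hF₃.arr 2, List.flatten_append, List.flatten_singleton, cells_append]
    simp only [hs₂', setReg_arr, setArr_arr, if_neg (show ¬ ((2 : ℕ) = 0) by decide), zero_add]
    refine ⟨h'.minus.congr fun i _ hi => ?_, hcm⟩
    rw [hm i (by omega), setReg_arr]
  · rw [hF₃.arr 1, List.flatten_append, List.flatten_singleton, List.map_append, cells_append]
    simp only [hs₂', setReg_arr, setArr_arr, if_neg (show ¬ ((1 : ℕ) = 0) by decide), zero_add,
      List.length_map]
    refine ⟨h'.plus.congr fun i _ hi => ?_, hcp⟩
    rw [List.length_map] at hi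
    rw [hp i (by omega), setReg_arr]
  · rw [hF₃.reg 0]
    simp [hs₂', hN₂]
  · rw [hF₃.reg 11]
    simp [hs₂', hu₂]
  · intro i hi
    rw [hF₃.arr 0]
    simp only [hs₂', setReg_arr, setArr_arr, setReg_reg, if_true, hN₂, hU₂,
      if_neg (show ¬ ((11 : ℕ) = 0) by decide), hu₂]
    rcases (show i ≤ Cs.length ∨ i = Cs.length + 1 by simp at hi; omega) with hi | rfl
    · rw [Function.update_of_ne (by omega), h'.offs i hi, List.take_append_of_le_length hi]
    · rw [Function.update_self, List.take_of_length_le (by simp)]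
      simp

end CBM

namespace CBM

variable {X₀ : Finset (Fin m)} {s : Memory}

variable (M) in
/-- The invariant of `Prog.phaseOne`, with a bound `n` on the number of remaining steps. -/
def SearchInv (X₀ : Finset (Fin m)) (n : ℕ) (s : Memory) : Prop :=
  ∃ X l K A B Cs, M.StackInv X₀ X l K A B Cs s ∧
    -- A push lengthens the stack by one but enlarges `K`, which weighs twice; every other step with
    -- a nonempty stack shortens it. The final `1` pays for the step that ends the search.
    (s.reg rgRun = 1 ∧ n = 2 * (m - K.card) + l.length + 1 ∨
      s.reg rgRun = 0 ∧ n = 0 ∧ l = [] ∧ ∀ x ∈ X, M.Dead X x)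

lemma card_insert_lt {K : Finset (Fin m)} {x : Fin m} (hx : x ∉ K) :
    m - (insert x K).card < m - K.card := by
  have h1 := Finset.card_insert_of_notMem hx
  have h2 := Finset.card_le_univ (insert x K)
  rw [Fintype.card_fin] at h2
  omega

lemma runs_step (h₀ : M.Stable X₀) {n : ℕ} (h : M.SearchInv X₀ n s) (hrun : s.reg rgRun = 1) :
    Runs M Prog.step s (34 * m + 23) fun s' => ∃ n' < n, M.SearchInv X₀ n' s' := by
  obtain ⟨X, l, K, A, B, Cs, hI, hcase⟩ := h
  obtain ⟨-, rfl⟩ := hcase.resolve_right (by simp [hrun])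
  have hM := hI.env.m_eq
  refine (Runs.cond (t := 34 * m + 22) (fun h => ?_) (fun h => ?_))
  · simp only [Test.Holds, hM, hI.top_eq_iff] at h
    obtain ⟨x, t, rfl⟩ := List.exists_cons_of_ne_nil h
    have hXs := hI.stable h₀
    have hx : x ∈ X := hI.sub x List.mem_cons_self
    refine ((runs_extend hI.env hI.xind hXs hI.linked.1 hx).bind (t₂ := 15 * m + 12) ?_).le
      (by omega)
    rintro s' ⟨hF, hX', hcase⟩
    have hI' := hI.frame hF hX'
    have hr' : s'.reg rgRun = 1 := (hF.reg rgRun).trans hrun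
    have hzero := hI'.env.zero
    have hone := hI'.env.one
    have hkill : M.Dead X x → Runs M Prog.kill s' (3 * m + 2) fun s'' =>
        ∃ n' < 2 * (m - K.card) + (x :: t).length + 1, M.SearchInv X₀ n' s'' := fun hd =>
      (runs_kill_stack h₀ hI' hd).mono le_rfl fun s'' h'' =>
        ⟨2 * (m - K.card) + ([] : List (Fin m)).length + 1, by simp,
          X, [], K, A, B, Cs, h''.2, Or.inl ⟨h''.1.trans hr', rfl⟩⟩
    refine Runs.cond (fun hk => ?_) (fun hk => Runs.cond (t := 15 * m + 10) (fun hk' => ?_) fun hk' => ?_)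
    · simp only [Test.Holds, hzero] at hk
      obtain ⟨a, b, ha, hb, hl, hst⟩ := hcase.resolve_left (by simp [hk])
      rw [hk, ← hF.arr arSt] at hst
      refine (runs_push hI' hl ha hb hst.symm).mono (by omega) ?_
      rintro s'' ⟨hr, A', B', hI''⟩
      have hbK : b ∉ K := (hI'.zero_iff b).1 hst.symm
      have := card_insert_lt hbK
      exact ⟨_, by simp only [List.length_cons]; omega, X, _, _, A', B', Cs, hI'',
        Or.inl ⟨hr.trans hr', rfl⟩⟩
    · simp only [Test.Holds, hone] at hk'
      obtain ⟨a, b, ha, hb, hl, hst⟩ := hcase.resolve_left (by simp [hk'])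
      rw [hk', ← hF.arr arSt] at hst
      refine (runs_turn h₀ hI' hl ha hb hst.symm).mono le_rfl ?_
      rintro s'' ⟨hr, X', l', A', B', Cs', hlen, hI''⟩
      exact ⟨_, by omega, X', l', K, A', B', Cs', hI'', Or.inl ⟨hr.trans hr', rfl⟩⟩
    · simp only [Test.Holds, hzero, hone] at hk hk'
      refine (hkill ?_).le (by omega)
      -- The value `2` stands for two cases: no successor at all, or a successor of status `2`,
      -- which is dead as it lies in `X`.
      rcases hcase with ⟨-, hn⟩ | ⟨a, b, -, -, hl, hst⟩
      · exact dead_of_forall_not_link hXs hx hn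
      · rw [← hF.arr arSt] at hst
        have h2 := hI'.le_two b
        exact dead_of_link hXs hl (hI'.dead b (by omega) (hl.mem'))
  · simp only [Test.Holds, hM, hI.top_eq_iff, not_not] at h
    subst h
    refine (runs_search_stack hI).mono (by omega) ?_
    rintro s' (⟨hr, hI', hd⟩ | ⟨hr, x, hx, hI'⟩)
    · exact ⟨0, by simp, X, [], K, A, B, Cs, hI', Or.inr ⟨hr, rfl, rfl, hd⟩⟩
    · have := card_insert_lt hx
      exact ⟨_, by simp only [List.length_cons, List.length_nil]; omega, X, _, _, A, B, Cs, hI',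
        Or.inl ⟨hr, rfl⟩⟩

lemma runs_phaseOne (h₀ : M.Stable X₀) {A B : Fin m → Fin m} (h : M.StackInv X₀ X₀ [] ∅ A B [] s)
    (hrun : s.reg rgRun = 1) :
    Runs M Prog.phaseOne s ((2 * m + 1) * (34 * m + 24) + 1) fun s' =>
      ∃ X K A B Cs, M.StackInv X₀ X [] K A B Cs s' ∧ ∀ x ∈ X, M.Dead X x := by
  refine (Runs.loop_measure (M.SearchInv X₀) (t := 34 * m + 23) (fun n s hI hb => ?_)
    (n := 2 * m + 1) ⟨X₀, [], ∅, A, B, [], h, Or.inl ⟨hrun, by simp⟩⟩).mono le_rfl ?_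
  · obtain ⟨X, l, K, A, B, Cs, hS, -⟩ := id hI
    simp only [Test.Holds, hS.env.one] at hb
    exact runs_step h₀ hI hb
  · rintro s' ⟨n, ⟨X, l, K, A, B, Cs, hS, hcase⟩, hb⟩
    simp only [Test.Holds, hS.env.one] at hb
    obtain ⟨-, -, rfl, hd⟩ := hcase.resolve_left (fun h => hb h.1)
    exact ⟨X, K, A, B, Cs, hS, hd⟩

end CBM

/-! ### Testing a recorded rotation. -/

namespace Prog

/-- Clear the flag `rgOk` if `rgT` is zero. -/
def require : Program := .cond (.eq rgT rgZero) (.const rgOk 0) .skip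

/-- Clear the flag `rgOk` if `rgT` is not zero. -/
def forbid : Program := .cond (.eq rgT rgZero) .skip (.const rgOk 0)

/-- Test the edge in `rgY`, where `rgA` holds its successor in the recorded rotation. -/
def scan : Program :=
  .copy rgE rgY ;; .const rgFlag 1 ;;
  .loop (.eq rgFlag rgOne) (.load rgE arNx rgE ;; query ;; .load rgT arO rgE ;;
    .cond (.eq rgE rgA)
      (.const rgFlag 0 ;; require ;; .load rgB arB rgY ;; .load rgT arO rgB ;; forbid)
      forbid)

/-- Compute the range of the cells of the rotation number `rgJ`. -/
def range : Program :=
  .load rgV arU rgJ ;; .copy rgT rgJ ;; .inc rgT ;; .load rgEnd arU rgT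

/-- Test whether the rotation number `rgJ` can be applied. -/
def avail : Program :=
  .const rgOk 1 ;; range ;;
  .loop (.lt rgV rgEnd) (.load rgY arMinus rgV ;; .load rgT arX rgY ;;
    .cond (.eq rgT rgOne) (.load rgA arA rgY ;; scan) (.const rgOk 0) ;; .inc rgV)

end Prog

namespace CBM

variable {X₀ X : Finset (Fin m)} {s : Memory} {A B : Fin m → Fin m} {Cs : List (List (Fin m))}

/-- The edge next to an edge that is better than a given one. -/
lemma IsNx.exists_next {v : ℕ} {e a : Fin m} (h : M.IsNx v e) (hw : M.wk a = M.wk e)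
    (hr : M.rk a < M.rk e) : ∃ e' : Fin m, v = e' ∧ M.wk e' = M.wk e ∧ M.rk e' < M.rk e ∧
      ∀ d, M.wk d = M.wk e → M.rk d < M.rk e → M.rk d ≤ M.rk e' :=
  h.resolve_right fun h' => h'.2 a hw hr

variable (M) in
/-- The test for the edge `x` with the successors `a` and `b` in `X`. -/
def Fits (X : Finset (Fin m)) (x a b : Fin m) : Prop :=
  (∀ e, M.wk e = M.wk x → M.rk a < M.rk e → M.rk e < M.rk x → e ∉ M.ch (insert e X)) ∧
    a ∈ M.ch (insert a X) ∧ b ∉ M.ch (insert a X)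

lemma runs_require (hs : s.reg rgZero = 0) :
    Runs M Prog.require s 2 fun s' => Frame [rgOk] [] s s' ∧
      (s'.reg rgOk = 1 ↔ s.reg rgOk = 1 ∧ s.reg rgT ≠ 0) := by
  refine Runs.cond (fun h => Runs.const ⟨(Frame.refl _ _ s).setReg _ _, ?_⟩)
    fun h => Runs.skip ⟨Frame.refl _ _ s, ?_⟩
  all_goals simp only [Test.Holds, hs] at h; simp [h]

lemma runs_forbid (hs : s.reg rgZero = 0) :
    Runs M Prog.forbid s 2 fun s' => Frame [rgOk] [] s s' ∧
      (s'.reg rgOk = 1 ↔ s.reg rgOk = 1 ∧ s.reg rgT = 0) := by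
  refine Runs.cond (fun h => Runs.skip ⟨Frame.refl _ _ s, ?_⟩)
    fun h => Runs.const ⟨(Frame.refl _ _ s).setReg _ _, ?_⟩
  all_goals simp only [Test.Holds, hs] at h; simp [h]

/-- The worker's list is followed from `x` just as far as the recorded edge `a`, with one query per
edge, so the cost is governed by the loss of rank. The last query, for `a`, also answers whether `b`
is displaced. -/
lemma runs_scan (hs : M.Env X₀ s) (hX : Indicates (s.arr arX) X) (hXs : M.Stable X) {x a b : Fin m}
    (hx : s.reg rgY = x) (ha : s.reg rgA = a) (hb : s.arr arB x = b) (hxX : x ∈ X)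
    (hw : M.wk a = M.wk x) (hr : M.rk a < M.rk x) (hf : M.fm b = M.fm a) :
    Runs M Prog.scan s ((M.rk x - M.rk a) * 15 + 3) fun s' =>
      Frame [rgE, rgFlag, rgF, rgT, rgB, rgOk] [arX, arO] s s' ∧ Indicates (s'.arr arX) X ∧
      (s'.reg rgOk = 1 ↔ s.reg rgOk = 1 ∧ M.Fits X x a b) := by
  refine Runs.seq_copy (Runs.seq_const ((Runs.loop_measure (t := 14) (n := M.rk x - M.rk a)
    (fun n s' => Frame [rgE, rgFlag, rgF, rgT, rgB, rgOk] [arX, arO] s s' ∧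
      Indicates (s'.arr arX) X ∧
      ((s'.reg rgFlag = 1 ∧ ∃ e : Fin m, s'.reg rgE = e ∧ M.wk e = M.wk x ∧ M.rk a < M.rk e ∧
        M.rk e ≤ M.rk x ∧ n = M.rk e - M.rk a ∧ (s'.reg rgOk = 1 ↔ s.reg rgOk = 1 ∧
          ∀ d, M.wk d = M.wk x → M.rk e ≤ M.rk d → M.rk d < M.rk x → d ∉ M.ch (insert d X))) ∨
      (s'.reg rgFlag = 0 ∧ n = 0 ∧
        (s'.reg rgOk = 1 ↔ s.reg rgOk = 1 ∧ M.Fits X x a b)))) ?_ ?_).mono le_rfl ?_))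
  · rintro n s' ⟨hF, hX', hcase⟩ hflag
    have hs' := hs.frame hF
    simp only [Test.Holds, hs'.one] at hflag
    obtain ⟨-, e, he, hwe, hae, hex, rfl, hok⟩ := hcase.resolve_right (by simp [hflag])
    obtain ⟨d, hd, hwd, hrd, hnext⟩ := (hs'.nx e).exists_next (hw.trans hwe.symm) hae
    have hdx : d ∉ X := fun h => by
      have := hXs.eq_of_wk h hxX (hwd.trans hwe)
      subst this
      omega
    have hF₁ := hF.setReg rgE (s'.arr arNx (s'.reg rgE))
    refine (Runs.seq_load (((runs_query (e := d) (hs.frame hF₁) (by simpa using hX')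
      (by simp [he, hd]) hdx).bind (t₂ := 9) ?_))).le (by omega)
    rintro s₂ ⟨hF₂, hX₂, -, hO⟩
    have hF' := hF₁.trans hF₂
    have hs₂ := hs.frame hF'
    have hE₂ : s₂.reg 17 = d := by simp [hF₂.reg 17, he, hd]
    have hok₂ : s₂.reg 28 = s'.reg 28 := by simp [hF₂.reg 28]
    have hA₂ : s₂.reg 16 = a := by rw [hF'.reg 16, ha]
    have hY₂ : s₂.reg 26 = x := by rw [hF'.reg 26, hx]
    have hfl₂ : s₂.reg 29 = 1 := by simp [hF₂.reg 29, hflag]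
    have hB₂ : s₂.arr 17 x = b := by rw [hF'.arr 17, hb]
    have hOd := hO d rfl
    -- Moving on from `e` to the next edge `d` of the list enlarges the tested range by `d` alone.
    have hbetween : (∀ c, M.wk c = M.wk x → M.rk d ≤ M.rk c → M.rk c < M.rk x →
        c ∉ M.ch (insert c X)) ↔ (∀ c, M.wk c = M.wk x → M.rk e ≤ M.rk c → M.rk c < M.rk x →
        c ∉ M.ch (insert c X)) ∧ d ∉ M.ch (insert d X) := by
      constructor
      · exact fun h => ⟨fun c h1 h2 h3 => h c h1 (by omega) h3, h d (hwd.trans hwe) le_rfl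
          (by omega)⟩
      · rintro ⟨h1, h2⟩ c h3 h4 h5
        rcases lt_or_ge (M.rk c) (M.rk e) with h6 | h6
        · obtain rfl : c = d := M.rk_inj ((h3.trans hwe.symm).trans hwd.symm)
            (le_antisymm (hnext c (h3.trans hwe.symm) h6) h4)
          exact h2
        · exact h1 c h3 h6 h5
    refine (Runs.seq_load (Runs.cond (t := 7) (fun h => ?_) (fun h => ?_)))
    · have hda : d = a := by
        simp only [Test.Holds, setReg_reg] at h
        rw [if_neg (by decide), if_neg (by decide), hE₂, hA₂] at h
        exact Fin.ext h
      subst hda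
      have hOb := hO b hf
      -- The edge reached is `a`, the next one after `e`; so nothing between `a` and `e` remains to
      -- be tested.
      have hfits : M.Fits X x d b ↔ (∀ c, M.wk c = M.wk x → M.rk e ≤ M.rk c → M.rk c < M.rk x →
          c ∉ M.ch (insert c X)) ∧ d ∈ M.ch (insert d X) ∧ b ∉ M.ch (insert d X) := by
        refine and_congr_left fun _ => ⟨fun h c h1 h2 h3 => h c h1 (by omega) h3,
          fun h c h1 h2 h3 => h c h1 ?_ h3⟩
        by_contra hc
        have := hnext c (h1.trans hwe.symm) (by omega)
        omega
      refine Runs.seq_const ((runs_require (by simpa using hs₂.zero)).bind (t₂ := 4) ?_)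
      rintro s₃ ⟨hF₃, hok₃⟩
      have hF₄ := ((hF'.setReg rgT (s₂.arr arO (s₂.reg rgE))).setReg rgFlag 0).trans hF₃
      have hB₃ : s₃.arr 17 (s₃.reg 26) = b := by rw [hF₄.arr 17, hF₄.reg 26, hx, hb]
      have hO₃ : s₃.arr 14 b = s₂.arr 14 b := by simp [hF₃.arr 14]
      have hX₃ : Indicates (s₃.arr arX) X := by
        rw [hF₃.arr arX]
        exact hX₂
      have hfl₃ : s₃.reg 29 = 0 := by simp [hF₃.reg 29]
      have hok₄ : s₃.reg 28 = 1 ↔ s₂.reg 28 = 1 ∧ d ∈ M.ch (insert d X) := by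
        simpa [hE₂, hOd] using hok₃
      clear hok₃ hF₃
      have hF₅ := (hF₄.setReg rgB (s₃.arr arB (s₃.reg rgY)))
      refine Runs.seq_load (Runs.seq_load ((runs_forbid
        (by simpa using (hs.frame hF₄).zero)).mono le_rfl ?_))
      rintro s₅ ⟨hF₆, hok₅⟩
      refine ⟨0, by omega, (hF₅.setReg _ _).trans hF₆, ?_, Or.inr ⟨?_, rfl, ?_⟩⟩
      · rw [hF₆.arr arX]
        exact hX₃
      · rw [hF₆.reg rgFlag]
        exact hfl₃
      · rw [hok₅, hfits]
        simp only [setReg_reg, setReg_arr, Nat.reduceEqDiff, if_false, if_true, hok₄, hok₂, hok,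
          hB₃, hO₃, hOb, ite_eq_right_iff, one_ne_zero, imp_false,
          and_assoc]
    · have hda : d ≠ a := by
        rintro rfl
        simp [Test.Holds, hE₂, hA₂] at h
      have had : M.rk a < M.rk d := lt_of_le_of_ne (hnext a (hw.trans hwe.symm) hae)
        fun h => hda (M.rk_inj ((hwd.trans hwe).trans hw.symm) h.symm)
      refine (runs_forbid (by simpa using hs₂.zero)).mono (by omega) ?_
      rintro s₃ ⟨hF₃, hok₃⟩
      refine ⟨M.rk d - M.rk a, by omega, (hF'.setReg _ _).trans hF₃, ?_, Or.inl ⟨?_, d, ?_,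
        hwd.trans hwe, had, by omega, rfl, ?_⟩⟩
      · rw [hF₃.arr arX]
        exact hX₂
      · rw [hF₃.reg rgFlag]
        exact hfl₂
      · rw [hF₃.reg rgE]
        exact hE₂
      · rw [hok₃, hbetween]
        simp only [setReg_reg, Nat.reduceEqDiff, if_false, if_true, hok₂, hok,
          hE₂, hOd, ite_eq_right_iff, one_ne_zero, imp_false,
          and_assoc]
  · refine ⟨((Frame.refl _ _ s).setReg _ _).setReg _ _, by simpa using hX, Or.inl ⟨by simp, x,
      by simp [hx], rfl, hr, le_rfl, rfl, ?_⟩⟩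
    simp only [setReg_reg, Nat.reduceEqDiff, if_false]
    refine ⟨fun h => ⟨h, fun d _ h1 h2 => by omega⟩, fun h => h.1⟩
  · rintro s' ⟨n, ⟨hF, hX', hcase⟩, hb⟩
    simp only [Test.Holds, (hs.frame hF).one] at hb
    exact ⟨hF, hX', (hcase.resolve_left fun h => hb h.1).2.2⟩

variable (M) in
/-- The memory contains the recorded rotations. -/
structure TableInv (X₀ : Finset (Fin m)) (A B : Fin m → Fin m) (Cs : List (List (Fin m)))
    (s : Memory) : Prop where
  env : M.Env X₀ s
  memA : ∀ x ∈ Cs.flatten, s.arr arA x = A x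
  memB : ∀ x ∈ Cs.flatten, s.arr arB x = B x
  minus : Cells (s.arr arMinus) 0 Cs.flatten
  plus : Cells (s.arr arPlus) 0 (Cs.flatten.map A)
  n_eq : s.reg rgN = Cs.length
  offs : ∀ i ≤ Cs.length, s.arr arU i = (Cs.take i).flatten.length

namespace TableInv

lemma frame {R R' : List ℕ} {s' : Memory} (h : M.TableInv X₀ A B Cs s)
    (hF : Frame R R' s s')
    (hR : (rgM ∉ R ∧ rgZero ∉ R ∧ rgOne ∉ R) ∧ rgN ∉ R := by decide)
    (hR' : (arFm ∉ R' ∧ arNx ∉ R' ∧ arMin ∉ R') ∧ arA ∉ R' ∧ arB ∉ R' ∧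
      arMinus ∉ R' ∧ arPlus ∉ R' ∧ arU ∉ R' := by decide) :
    M.TableInv X₀ A B Cs s' := by
  obtain ⟨h1, h2⟩ := hR
  obtain ⟨k1, k2, k3, k4, k5, k6⟩ := hR'
  constructor
  · exact h.env.frame hF h1 k1
  · rw [hF.arr _ k2]; exact h.memA
  · rw [hF.arr _ k3]; exact h.memB
  · rw [hF.arr _ k4]; exact h.minus
  · rw [hF.arr _ k5]; exact h.plus
  · rw [hF.reg _ h2]; exact h.n_eq
  · rw [hF.arr _ k6]; exact h.offs

lemma cells (h : M.TableInv X₀ A B Cs s) {l r : List (List (Fin m))} {c : List (Fin m)}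
    (hl : Cs = l ++ c :: r) :
    s.arr arU l.length = l.flatten.length ∧ s.arr arU (l.length + 1) = l.flatten.length + c.length ∧
      Cells (s.arr arMinus) l.flatten.length c ∧
      Cells (s.arr arPlus) l.flatten.length (c.map A) := by
  subst hl
  refine ⟨?_, ?_, ?_, ?_⟩
  · rw [h.offs _ (by simp)]
    simp
  · rw [h.offs _ (by simp)]
    simp [List.take_append, List.take_of_length_le]
  · have := h.minus
    rw [List.flatten_append, cells_append, List.flatten_cons, cells_append] at this
    simpa using this.2.1
  · have := h.plus
    rw [List.flatten_append, List.map_append, cells_append, List.flatten_cons, List.map_append,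
      cells_append] at this
    rw [List.length_map, zero_add] at this
    exact this.2.1

end TableInv

lemma StackInv.tableInv {K : Finset (Fin m)} (h : M.StackInv X₀ X [] K A B Cs s) :
    M.TableInv X₀ A B Cs s := by
  refine ⟨h.env, fun x hx => h.memA x ?_, fun x hx => h.memB x ?_, h.minus, h.plus, h.n_eq, h.offs⟩
  all_goals exact List.mem_append_left _ hx

lemma Recorded.link_of_mem (h : M.Recorded A B X₀ X Cs) {c : List (Fin m)} (hc : c ∈ Cs) :
    ∃ Z T, M.Route X₀ Z T ∧ ∀ x ∈ c, M.Link Z x (A x) (B x) := by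
  obtain ⟨l, r, hl⟩ := List.append_of_mem hc
  obtain ⟨Z, hZ, -, hlk⟩ := h.link l c r hl
  exact ⟨Z, _, hZ, hlk⟩

lemma runs_range (hs : M.TableInv X₀ A B Cs s) {l r : List (List (Fin m))} {c : List (Fin m)}
    (hl : Cs = l ++ c :: r) (hJ : s.reg rgJ = l.length) :
    Runs M Prog.range s 4 fun s' => Frame [rgV, rgT, rgEnd] [] s s' ∧
      s'.reg rgV = l.flatten.length ∧ s'.reg rgEnd = l.flatten.length + c.length := by
  obtain ⟨h1, h2, -, -⟩ := hs.cells hl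
  refine Runs.seq_load (Runs.seq_copy (Runs.seq_inc (Runs.load ⟨?_, by simp [hJ, h1],
    by simp [hJ, h2]⟩)))
  exact (((((Frame.refl _ _ s).setReg _ _).setReg _ _).setReg _ _).setReg _ _)

lemma runs_avail (hs : M.TableInv X₀ A B Cs s) (h₀ : M.Stable X₀) {X₁ : Finset (Fin m)}
    (hrec : M.Recorded A B X₀ X₁ Cs) {T : List (Rotation m)} (hT : M.Route X₀ X T)
    (hX : Indicates (s.arr arX) X) {l r : List (List (Fin m))} {c : List (Fin m)}
    (hl : Cs = l ++ c :: r) (hJ : s.reg rgJ = l.length) :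
    Runs M Prog.avail s (24 * (c.map (M.gap A)).sum + 6) fun s' =>
      Frame [rgE, rgFlag, rgF, rgT, rgB, rgOk, rgV, rgEnd, rgY, rgA] [arX, arO] s s' ∧
      Indicates (s'.arr arX) X ∧ (s'.reg rgOk = 1 ↔ M.IsCycle X (rotOf A c)) := by
  have hc : c ∈ Cs := by simp [hl]
  have hXs := hT.stable h₀
  rw [hrec.isCycle_iff h₀ hc hT]
  obtain ⟨Z, T', hZ, hlk⟩ := hrec.link_of_mem hc
  have hZs := hZ.stable h₀
  obtain ⟨-, -, hm, -⟩ := hs.cells hl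
  have hgap : ∀ x ∈ c, 1 ≤ M.gap A x := fun x hx => by
    have := (hlk x hx).rk_lt
    simp only [gap]
    omega
  -- Every gap is at least one, so the constant cost per edge is absorbed into the gap.
  have hbound : (c.map fun x => M.gap A x * 15 + 8 + 1).sum ≤ 24 * (c.map (M.gap A)).sum := by
    rw [← List.sum_map_mul_left]
    refine List.sum_le_sum fun x hx => ?_
    have := hgap x hx
    omega
  have hF₀ : Frame [rgOk] [] s (s.setReg rgOk 1) := (Frame.refl _ _ s).setReg _ _
  refine (Runs.seq_const ((runs_range (hs.frame hF₀) hl (by simpa using hJ)).bind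
    (t₂ := (c.map fun x => M.gap A x * 15 + 8 + 1).sum + 1) ?_)).le (by omega)
  rintro s₁ ⟨hF₁, hV, hEnd⟩
  have hF := (hF₀.mono (R := [rgE, rgFlag, rgF, rgT, rgB, rgOk, rgV, rgEnd, rgY, rgA])
    (A := [arX, arO])).trans hF₁
  have hok₁ : s₁.reg rgOk = 1 := by simp [hF₁.reg 28]
  have hX₁ : Indicates (s₁.arr arX) X := by
    rw [hF₁.arr arX]
    exact hX
  clear hF₀ hF₁
  refine (Runs.loop_list (f := fun x => M.gap A x * 15 + 8) (fun d r s' => c = d ++ r ∧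
    Frame [rgE, rgFlag, rgF, rgT, rgB, rgOk, rgV, rgEnd, rgY, rgA] [arX, arO] s s' ∧
    Indicates (s'.arr arX) X ∧ s'.reg rgV = l.flatten.length + d.length ∧
    s'.reg rgEnd = l.flatten.length + c.length ∧
    (s'.reg rgOk = 1 ↔ ∀ x ∈ d, x ∈ X ∧ M.Fits X x (A x) (B x))) ?_ ?_ (l := []) (r := c) ?_).mono
      le_rfl ?_
  · rintro d x r' s' ⟨hd, hF, hX', hV, hEnd, hok⟩
    have hs' := hs.frame hF
    have hx : x ∈ c := by simp [hd]
    have hxf : x ∈ Cs.flatten := List.mem_flatten.2 ⟨c, hc, hx⟩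
    have hlx := hlk x hx
    have hmx : s'.arr 2 (l.flatten.length + d.length) = x := by
      rw [hF.arr 2]
      rw [hd] at hm
      exact (cells_append.1 hm).2.1
    refine ⟨by simp [Test.Holds, hV, hEnd, hd], ?_⟩
    refine (Runs.seq_load (Runs.seq_load (Runs.bind (t₁ := M.gap A x * 15 + 5) (t₂ := 1)
      (Q := fun s₃ => Frame [rgE, rgFlag, rgF, rgT, rgB, rgOk, rgV, rgEnd, rgY, rgA] [arX, arO] s s₃ ∧
        Indicates (s₃.arr arX) X ∧ s₃.reg rgV = l.flatten.length + d.length ∧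
        s₃.reg rgEnd = l.flatten.length + c.length ∧
        (s₃.reg rgOk = 1 ↔ ∀ y ∈ d ++ [x], y ∈ X ∧ M.Fits X y (A y) (B y)))
      (Runs.cond (t := M.gap A x * 15 + 4) (fun h => ?_) (fun h => ?_)) ?_))).le (by omega)
    · simp only [Test.Holds, setReg_reg, setReg_arr, hV, hmx, hs'.env.one, if_true, if_false,
        Nat.reduceEqDiff, hX' x] at h
      have hxX : x ∈ X := by
        by_contra h'
        simp [h'] at h
      have hF₂ := ((hF.setReg rgY (s'.arr arMinus (s'.reg rgV))).setReg rgT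
        ((s'.setReg rgY (s'.arr arMinus (s'.reg rgV))).arr arX
          ((s'.setReg rgY (s'.arr arMinus (s'.reg rgV))).reg rgY)))
      refine Runs.seq_load ((runs_scan (X := X) (x := x) (a := A x) (b := B x)
        (hs.frame (hF₂.setReg rgA _)).env ?_ hXs ?_ ?_ ?_ hxX hlx.wk_eq hlx.rk_lt
        (hlx.fm_eq hZs)).mono le_rfl ?_)
      · simpa using hX'
      · simp only [setReg_reg, Nat.reduceEqDiff, if_false, if_true, hV, hmx]
      · simp only [setReg_reg, setReg_arr, Nat.reduceEqDiff, if_false, if_true, hV, hmx]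
        exact hs'.memA x hxf
      · simpa using hs'.memB x hxf
      · rintro s₃ ⟨hF₃, hX₃, hok₃⟩
        refine ⟨(hF₂.setReg rgA _).trans hF₃, hX₃, ?_, ?_, ?_⟩
        · rw [hF₃.reg 24]
          simpa using hV
        · rw [hF₃.reg 25]
          simpa using hEnd
        · rw [hok₃]
          simp only [setReg_reg, Nat.reduceEqDiff, if_false, hok, List.forall_mem_append,
            List.forall_mem_singleton, hxX, true_and]
    · simp only [Test.Holds, setReg_reg, setReg_arr, hV, hmx, hs'.env.one, if_true, if_false,
        Nat.reduceEqDiff, hX' x] at h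
      have hxX : x ∉ X := by
        intro h'
        simp [h'] at h
      refine (Runs.const ⟨((hF.setReg _ _).setReg _ _).setReg _ _, by simpa using hX',
        by simpa using hV, by simpa using hEnd, ?_⟩).le (by omega)
      simp [hxX]
    · rintro s₃ ⟨hF₃, hX₃, hV₃, hEnd₃, hok₃⟩
      exact Runs.inc ⟨by simp [hd], hF₃.setReg _ _, by simpa using hX₃,
        by simp [hV₃, add_assoc], by simpa using hEnd₃, by simpa using hok₃⟩
  · rintro d s' ⟨hd, -, -, hV, hEnd, -⟩
    simp only [List.append_nil] at hd
    simp [Test.Holds, hV, hEnd, hd]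
  · exact ⟨rfl, hF, hX₁, by simpa using hV, hEnd, by simpa using hok₁⟩
  · rintro s' ⟨-, hF, hX', -, -, hok⟩
    exact ⟨hF, hX', hok⟩

end CBM

/-! ### Listing the arcs in quadratic time. -/

namespace Prog

/-- Apply the rotation number `rgJ`. -/
def applyRot : Program := range ;; apply

/-- Run a program for all numbers `rgJ` of rotations. -/
def each (P : Program) : Program := .const rgJ 0 ;; .loop (.lt rgJ rgN) (P ;; .inc rgJ)

/-- Reset the current stable matching. -/
def reset : Program :=
  .const rgE 0 ;;
  .loop (.lt rgE rgM) (.load rgT arMin rgE ;; .store arX rgE rgT ;; .inc rgE)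

/-- Apply all rotations that need not wait for the rotation number `rgI`. -/
def forward : Program :=
  each (.cond (.eq rgJ rgI) .skip (avail ;; .cond (.eq rgOk rgOne) applyRot .skip))

/-- List the arcs from the rotation number `rgI` to the available rotations. -/
def emit : Program :=
  each (avail ;; .cond (.eq rgOk rgOne)
    (.store arSrc rgArcs rgI ;; .store arTgt rgArcs rgJ ;; .inc rgArcs) .skip)

/-- List the arcs that leave the rotation number `rgI`. -/
def row : Program := reset ;; forward ;; .copy rgJ rgI ;; applyRot ;; emit

/-- List all arcs. -/
def phaseTwo : Program :=
  .const rgArcs 0 ;; .const rgI 0 ;; .loop (.lt rgI rgN) (row ;; .inc rgI)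

end Prog

namespace CBM

variable {X₀ X Y₀ : Finset (Fin m)} {s : Memory} {A B : Fin m → Fin m} {Cs : List (List (Fin m))}

variable (M) in
/-- The total loss of the workers in a recorded rotation. -/
noncomputable def weight (A : Fin m → Fin m) (c : List (Fin m)) : ℕ := (c.map (M.gap A)).sum

lemma Recorded.length_le_weight (h : M.Recorded A B X₀ Y₀ Cs) {c : List (Fin m)} (hc : c ∈ Cs) :
    c.length ≤ M.weight A c := by
  obtain ⟨Z, T, -, hlk⟩ := h.link_of_mem hc
  refine List.length_le_sum_map fun x hx => ?_
  have := (hlk x hx).rk_lt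
  simp only [gap]
  omega

/-- The losses telescope along the recorded route, so together they are at most the rank sum of its
start. -/
lemma Recorded.sum_weight_le (h : M.Recorded A B X₀ Y₀ Cs) (h₀ : M.Stable X₀) :
    (Cs.map (M.weight A)).sum ≤ m := by
  have h1 := h.sum
  have h2 := h₀.sum_rk_le
  rw [List.map_flatten, List.sum_flatten, List.map_map] at h1
  have : (Cs.map (M.weight A)) = Cs.map (List.sum ∘ List.map (M.gap A)) := rfl
  rw [this]
  omega

lemma Recorded.weight_le (h : M.Recorded A B X₀ Y₀ Cs) (h₀ : M.Stable X₀) {c : List (Fin m)}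
    (hc : c ∈ Cs) : M.weight A c ≤ m :=
  (List.single_le_sum (by simp) _ (List.mem_map_of_mem hc)).trans (h.sum_weight_le h₀)

lemma Recorded.length_le_card (h : M.Recorded A B X₀ Y₀ Cs) (h₀ : M.Stable X₀) :
    Cs.length ≤ m := by
  have h1 := h.sum
  have h2 := h₀.sum_rk_le
  have h3 := h.length_le
  have h4 := h.length_le' h₀
  omega

/-- A pass over all rotations is linear in `m` as soon as each costs at most an affine function of
its weight. -/
lemma Recorded.sum_le (h : M.Recorded A B X₀ Y₀ Cs) (h₀ : M.Stable X₀) (α β : ℕ) :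
    (Cs.map fun c => α * M.weight A c + β).sum ≤ (α + β) * m := by
  rw [List.sum_map_add, List.sum_map_mul_left, List.map_const', List.sum_replicate, add_mul,
    smul_eq_mul, mul_comm Cs.length]
  exact add_le_add (Nat.mul_le_mul_left _ (h.sum_weight_le h₀))
    (Nat.mul_le_mul_left _ (h.length_le_card h₀))

lemma runs_applyRot (hs : M.TableInv X₀ A B Cs s) (h₀ : M.Stable X₀)
    (hrec : M.Recorded A B X₀ Y₀ Cs) (hX : Indicates (s.arr arX) X)
    {l r : List (List (Fin m))} {c : List (Fin m)}
    (hl : Cs = l ++ c :: r) (hJ : s.reg rgJ = l.length) :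
    Runs M Prog.applyRot s (6 * M.weight A c + 5) fun s' =>
      Frame [rgV, rgT, rgEnd, rgY] [arX] s s' ∧ Indicates (s'.arr arX) ((rotOf A c).app X) := by
  have hc : c ∈ Cs := by simp [hl]
  have hlen := hrec.length_le_weight hc
  obtain ⟨Z, T', hZ, hlk⟩ := hrec.link_of_mem hc
  refine ((runs_range hs hl hJ).bind (t₂ := 6 * c.length + 1) ?_).le (by omega)
  rintro s₁ ⟨hF, hV, hEnd⟩
  have hs₁ := hs.frame hF
  obtain ⟨-, -, hm, hp⟩ := hs₁.cells hl
  refine (runs_apply hs₁.env (by rw [hF.arr arX]; exact hX) (fun x hx y hy heq => ?_) hV hEnd hm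
    hp).mono le_rfl ?_
  · exact (hlk y hy).not_mem (hZ.stable h₀) (heq ▸ (hlk x hx).mem)
  · rintro s' ⟨hF', hX'⟩
    exact ⟨(hF.mono (R := [rgV, rgT, rgEnd, rgY]) (A := [arX])).trans hF', hX'⟩

lemma runs_each {P : Program} {f : List (Fin m) → ℕ} (I : List (List (Fin m)) → Memory → Prop)
    (hframe : ∀ l s v, I l s → I l (s.setReg rgJ v))
    (hN : ∀ l s, I l s → s.reg rgN = Cs.length)
    (hstep : ∀ l c r s, Cs = l ++ c :: r → I l s → s.reg rgJ = l.length →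
      Runs M P s (f c) fun s' => s'.reg rgJ = l.length ∧ I (l ++ [c]) s')
    (h : I [] s) : Runs M (Prog.each P) s ((Cs.map fun c => f c + 2).sum + 2) (I Cs) := by
  refine Runs.seq_const ((Runs.loop_list (f := fun c => f c + 1)
    (fun l r s' => Cs = l ++ r ∧ s'.reg rgJ = l.length ∧ I l s') ?_ ?_ (l := []) (r := Cs)
    ⟨rfl, by simp, hframe _ _ _ h⟩).mono le_rfl fun s' h' => h'.2.2)
  · rintro l c r s' ⟨hl, hJ, hI⟩
    refine ⟨by simp [Test.Holds, hJ, hN l s' hI, hl], (hstep l c r s' hl hI hJ).bind ?_⟩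
    rintro s₁ ⟨hJ₁, hI₁⟩
    exact Runs.inc ⟨by simp [hl], by simp [hJ₁], hframe _ _ _ hI₁⟩
  · rintro l s' ⟨hl, hJ, hI⟩
    rw [List.append_nil] at hl
    simp [Test.Holds, hJ, hN l s' hI, hl]

lemma runs_reset (hs : M.Env X₀ s) :
    Runs M Prog.reset s (4 * m + 2) fun s' => Frame [rgE, rgT] [arX] s s' ∧
      Indicates (s'.arr arX) X₀ := by
  refine (Runs.seq_const ((Runs.loop_range (t := 3) (n := m) (i := 0) (fun i s' =>
    Frame [rgE, rgT] [arX] s s' ∧ s'.reg rgE = i ∧ ∀ e : Fin m, (e : ℕ) < i →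
      s'.arr arX e = if e ∈ X₀ then 1 else 0) (Nat.zero_le _) ?_ ?_ ?_).mono le_rfl
      fun s' h => ⟨h.1, fun e => h.2.2 e e.2⟩)).le (by omega)
  · rintro i s' - him ⟨hF, hi, h⟩
    have hs' := hs.frame hF
    refine ⟨by simp [Test.Holds, hi, hs'.m_eq, him], ?_⟩
    refine Runs.seq_load (Runs.seq_store (Runs.inc ⟨?_, by simp [hi], fun e he => ?_⟩))
    · exact ((hF.setReg _ _).setArr _ _ _).setReg _ _
    · simp only [setReg_reg, setReg_arr, setArr_arr, Nat.reduceEqDiff, if_false, if_true, hi,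
        Function.update_apply]
      split_ifs with h1 h2 h2
      · rw [← h1, hs'.xmin e, if_pos h2]
      · rw [← h1, hs'.xmin e, if_neg h2]
      · rw [h e (by omega), if_pos h2]
      · rw [h e (by omega), if_neg h2]
  · rintro s' ⟨hF, hi, -⟩
    simp [Test.Holds, hi, (hs.frame hF).m_eq]
  · exact ⟨(Frame.refl _ _ s).setReg _ _, by simp, fun e he => absurd he (Nat.not_lt_zero _)⟩

section Arcs

variable (h₀ : M.IsXmin X₀) (hrec : M.Recorded A B X₀ Y₀ Cs) (hd : ∀ x ∈ Y₀, M.Dead Y₀ x)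

lemma _root_.List.Nodup.length_eq_of_append {α : Type*} {l l' r r' : List α} {x : α}
    (h : (l ++ x :: r).Nodup) (h' : l ++ x :: r = l' ++ x :: r') : l.length = l'.length := by
  have h1 : (l ++ x :: r)[l.length]? = some x := by simp
  have h2 : (l ++ x :: r)[l'.length]? = some x := by rw [h']; simp
  have h3 : l.length < (l ++ x :: r).length := by simp
  exact (List.getElem?_inj h3 h).1 (h1.trans h2.symm)

include h₀ hrec in
lemma eq_of_rotOf_eq {l l' r r' : List (List (Fin m))} {c c' : List (Fin m)}
    (hl : Cs = l ++ c :: r) (hl' : Cs = l' ++ c' :: r') (h : rotOf A c = rotOf A c') :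
    l.length = l'.length := by
  have hnd := hrec.route.nodup h₀.1
  have h1 : Cs.map (rotOf A) = l.map (rotOf A) ++ rotOf A c :: r.map (rotOf A) := by simp [hl]
  have h2 : Cs.map (rotOf A) = l'.map (rotOf A) ++ rotOf A c :: r'.map (rotOf A) := by
    simp [hl', h]
  rw [h1] at hnd h2
  simpa using hnd.length_eq_of_append h2

include h₀ hrec hd

/-- One pass in recorded order suffices: when a rotation is reached, it is available exactly if it
need not wait for `c`, by `isCycle_before_iff`. -/
lemma runs_forward (hs : M.TableInv X₀ A B Cs s) (hX : Indicates (s.arr arX) X₀)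
    {l r : List (List (Fin m))} {c : List (Fin m)} (hl : Cs = l ++ c :: r)
    (hI : s.reg rgI = l.length) :
    Runs M Prog.forward s (45 * m + 2) fun s' =>
      Frame [rgE, rgFlag, rgF, rgT, rgB, rgOk, rgV, rgEnd, rgY, rgA, rgJ] [arX, arO] s s' ∧
      ∃ X, M.Route X₀ X (M.before (rotOf A c) (Cs.map (rotOf A))) ∧ Indicates (s'.arr arX) X := by
  have hT₀ := not_isCycle_of_dead (hrec.route.stable h₀.1) hd
  have hR : rotOf A c ∈ Cs.map (rotOf A) := List.mem_map_of_mem (by simp [hl])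
  -- Per unit of weight, the test costs `24` and the application `6`.
  refine (runs_each (Cs := Cs) (f := fun c => 30 * M.weight A c + 13) (fun d s' =>
    Frame [rgE, rgFlag, rgF, rgT, rgB, rgOk, rgV, rgEnd, rgY, rgA, rgJ] [arX, arO] s s' ∧
    ∃ X, M.Route X₀ X (M.before (rotOf A c) (d.map (rotOf A))) ∧ Indicates (s'.arr arX) X)
    ?_ ?_ ?_ ?_).le (by gcongr; exact hrec.sum_le h₀.1 30 15)
  · rintro d s' v ⟨hF, X, h1, h2⟩
    exact ⟨hF.setReg _ _, X, h1, by simpa using h2⟩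
  · rintro d s' ⟨hF, -⟩
    exact (hs.frame hF).n_eq
  · rintro d e r' s' hd' ⟨hF, X, hX, hX'⟩ hJ
    have hs' := hs.frame hF
    have hI' : s'.reg rgI = l.length := by rw [hF.reg 21, hI]
    have hXs := hX.stable h₀.1
    rw [List.map_append, List.map_singleton]
    refine Runs.cond (t := 30 * M.weight A e + 12) (fun h => ?_) (fun h => ?_)
    · simp only [Test.Holds, hJ, hI'] at h
      have hec : e = c := by
        have := List.append_inj (hd'.symm.trans hl) h
        simpa using (List.cons.inj this.2).1
      refine (Runs.skip ⟨hJ, hF, X, ?_, hX'⟩).le (by omega)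
      rwa [before_append_of_precedes _ (Or.inl (by rw [hec]))]
    · simp only [Test.Holds, hJ, hI'] at h
      have hne : rotOf A e ≠ rotOf A c := fun h' => h (eq_of_rotOf_eq h₀ hrec hd' hl h')
      have hiff := isCycle_before_iff h₀ hrec.route hT₀ (l := d.map (rotOf A))
        (r := r'.map (rotOf A)) (R' := rotOf A e) (by simp [hd']) hX hR hne
      refine ((runs_avail hs' h₀.1 hrec hX hX' hd' hJ).bind (t₂ := 6 * M.weight A e + 6) ?_).le
        (by simp only [weight]; omega)
      rintro s₁ ⟨hF₁, hX₁, hok⟩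
      have hs₁ := hs'.frame hF₁
      have hJ₁ : s₁.reg rgJ = d.length := by rw [hF₁.reg 22, hJ]
      refine Runs.cond (fun h1 => ?_) (fun h1 => ?_)
      · simp only [Test.Holds, hs₁.env.one, hok] at h1
        refine (runs_applyRot hs₁ h₀.1 hrec hX₁ hd' hJ₁).mono le_rfl ?_
        rintro s₂ ⟨hF₂, hX₂⟩
        refine ⟨by rw [hF₂.reg 22, hJ₁], (hF.trans hF₁).trans hF₂, _, ?_, hX₂⟩
        rw [before_append_of_not_precedes _ hne (hiff.1 h1), route_append_iff]
        exact ⟨X, hX, route_cons_iff.2 ⟨(isRotation_iff hXs _).2 h1, Route.nil _⟩⟩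
      · simp only [Test.Holds, hs₁.env.one, hok] at h1
        refine (Runs.skip ⟨hJ₁, hF.trans hF₁, X, ?_, hX₁⟩).le (by omega)
        rwa [before_append_of_precedes _ (Or.inr (by simpa using mt hiff.2 h1))]
  · exact ⟨Frame.refl _ _ s, X₀, by simpa [before] using Route.nil X₀, hX⟩

end Arcs

/-- The rotation with a given number. -/
def rotAt (A : Fin m → Fin m) (Cs : List (List (Fin m))) (i : ℕ) : Rotation m :=
  rotOf A (Cs.getD i [])

lemma rotAt_length {l r : List (List (Fin m))} {c : List (Fin m)} (hl : Cs = l ++ c :: r) :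
    rotAt A Cs l.length = rotOf A c := by
  simp [rotAt, hl]

variable (M) in
/-- The arcs that leave a rotation with a number below `i`, and those from the rotation number `i`
to the rotations with a number below `j` have been listed. -/
def ArcsInv (A : Fin m → Fin m) (Cs : List (List (Fin m))) (i j : ℕ) (s : Memory) : Prop :=
  Set.BijOn (fun k => (s.arr arSrc k, s.arr arTgt k)) (Set.Iio (s.reg rgArcs))
    {ij | (ij.1 < i ∧ ij.2 < Cs.length ∨ ij.1 = i ∧ ij.2 < j) ∧
      M.ImmediatelyPrecedes (rotAt A Cs ij.1) (rotAt A Cs ij.2)}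

lemma _root_.Set.BijOn.extend {α : Type*} {g g' : ℕ → α} {n : ℕ} {S S' : Set α}
    (h : Set.BijOn g (Set.Iio n) S) (hg : ∀ k < n, g' k = g k) (hn : g' n ∉ S)
    (hS : S' = insert (g' n) S) : Set.BijOn g' (Set.Iio (n + 1)) S' := by
  have h1 : Set.Iio (n + 1) = insert n (Set.Iio n) := by
    ext k
    simp only [Set.mem_Iio, Set.mem_insert_iff]
    omega
  rw [h1, hS]
  exact (h.congr fun k hk => (hg k hk).symm).insert hn

namespace ArcsInv

variable {i j : ℕ}

lemma zero (h : s.reg rgArcs = 0) : M.ArcsInv A Cs 0 0 s := by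
  simp [ArcsInv, h]

lemma congr {s' : Memory} (h : M.ArcsInv A Cs i j s) (h1 : s'.reg rgArcs = s.reg rgArcs)
    (h2 : s'.arr arSrc = s.arr arSrc) (h3 : s'.arr arTgt = s.arr arTgt) :
    M.ArcsInv A Cs i j s' := by
  rw [ArcsInv, h1, h2, h3]
  exact h

lemma skip (h : M.ArcsInv A Cs i j s)
    (hn : ¬ M.ImmediatelyPrecedes (rotAt A Cs i) (rotAt A Cs j)) : M.ArcsInv A Cs i (j + 1) s := by
  unfold ArcsInv at h ⊢
  convert h using 2
  ext ⟨a, b⟩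
  simp only [Nat.lt_succ_iff_lt_or_eq]
  refine and_congr_left fun hp => ?_
  have : ¬ (a = i ∧ b = j) := by
    rintro ⟨rfl, rfl⟩
    exact hn hp
  tauto

lemma add {s' : Memory} (h : M.ArcsInv A Cs i j s)
    (hp : M.ImmediatelyPrecedes (rotAt A Cs i) (rotAt A Cs j))
    (h1 : s'.reg rgArcs = s.reg rgArcs + 1)
    (h2 : s'.arr arSrc = Function.update (s.arr arSrc) (s.reg rgArcs) i)
    (h3 : s'.arr arTgt = Function.update (s.arr arTgt) (s.reg rgArcs) j) :
    M.ArcsInv A Cs i (j + 1) s' := by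
  rw [ArcsInv, h1, h2, h3]
  refine Set.BijOn.extend h (fun k hk => ?_) ?_ ?_
  · simp [hk.ne]
  · simp
  · ext ⟨a, b⟩
    simp only [Set.mem_ofPred_eq, Nat.lt_succ_iff_lt_or_eq, Function.update_self,
      Set.mem_insert_iff, Prod.mk.injEq]
    constructor
    · tauto
    · rintro (⟨rfl, rfl⟩ | h)
      · tauto
      · tauto

lemma next (h : M.ArcsInv A Cs i Cs.length s) : M.ArcsInv A Cs (i + 1) 0 s := by
  unfold ArcsInv at h ⊢
  convert h using 2
  ext ⟨a, b⟩
  refine and_congr_left fun _ => ?_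
  omega

end ArcsInv

section Arcs

variable (h₀ : M.IsXmin X₀) (hrec : M.Recorded A B X₀ Y₀ Cs) (hd : ∀ x ∈ Y₀, M.Dead Y₀ x)

include h₀ hrec hd

/-- After `c` and all that need not wait for it, the rotations passing the test are the immediate
successors of `c` by `isCycle_after_iff`; so each arc is listed once, in the row of its source. -/
lemma runs_emit (hs : M.TableInv X₀ A B Cs s) {l r : List (List (Fin m))} {c : List (Fin m)}
    (hl : Cs = l ++ c :: r)
    (hXr : M.Route X₀ X (M.before (rotOf A c) (Cs.map (rotOf A)) ++ [rotOf A c]))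
    (hX : Indicates (s.arr arX) X) (hI : s.reg rgI = l.length) (ha : M.ArcsInv A Cs l.length 0 s) :
    Runs M Prog.emit s (36 * m + 2) fun s' =>
      Frame [rgE, rgFlag, rgF, rgT, rgB, rgOk, rgV, rgEnd, rgY, rgA, rgJ, rgArcs]
        [arX, arO, arSrc, arTgt] s s' ∧ M.ArcsInv A Cs (l.length + 1) 0 s' := by
  have hT₀ := not_isCycle_of_dead (hrec.route.stable h₀.1) hd
  have hR : rotOf A c ∈ Cs.map (rotOf A) := List.mem_map_of_mem (by simp [hl])
  refine ((runs_each (Cs := Cs) (f := fun c => 24 * M.weight A c + 10) (fun d s' =>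
    Frame [rgE, rgFlag, rgF, rgT, rgB, rgOk, rgV, rgEnd, rgY, rgA, rgJ, rgArcs]
      [arX, arO, arSrc, arTgt] s s' ∧ Indicates (s'.arr arX) X ∧
      M.ArcsInv A Cs l.length d.length s')
    ?_ ?_ ?_ ?_).mono (by gcongr; exact hrec.sum_le h₀.1 24 12)
    fun s' h' => ⟨h'.1, h'.2.2.next⟩)
  · rintro d s' v ⟨hF, h1, h2⟩
    exact ⟨hF.setReg _ _, by simpa using h1, h2.congr (by simp) rfl rfl⟩
  · rintro d s' ⟨hF, -⟩
    exact (hs.frame hF).n_eq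
  · rintro d e r' s' hd' ⟨hF, hX', ha'⟩ hJ
    have hs' := hs.frame hF
    have hI' : s'.reg rgI = l.length := by rw [hF.reg 21, hI]
    have hR' : rotOf A e ∈ Cs.map (rotOf A) := List.mem_map_of_mem (by simp [hd'])
    have hiff := isCycle_after_iff h₀ hrec.route hT₀ hXr hR hR'
    rw [← rotAt_length (A := A) hl, ← rotAt_length (A := A) hd'] at hiff
    refine ((runs_avail hs' h₀.1 hrec hXr hX' hd' hJ).bind (t₂ := 4) ?_).le
      (by simp only [weight]; omega)
    rintro s₁ ⟨hF₁, hX₁, hok⟩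
    have hs₁ := hs'.frame hF₁
    have hJ₁ : s₁.reg rgJ = d.length := by rw [hF₁.reg 22, hJ]
    have hI₁ : s₁.reg rgI = l.length := by rw [hF₁.reg 21, hI']
    have ha₁ : M.ArcsInv A Cs l.length d.length s₁ :=
      ha'.congr (hF₁.reg 1) (hF₁.arr 3) (hF₁.arr 4)
    rw [← rotAt_length (A := A) hd', hiff] at hok
    refine Runs.cond (fun h1 => ?_) (fun h1 => ?_)
    · simp only [Test.Holds, hs₁.env.one, hok] at h1
      refine Runs.seq_store (Runs.seq_store (Runs.inc ⟨by simpa using hJ₁, ?_, by simpa using hX₁, ?_⟩))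
      · exact (((hF.trans hF₁).setArr _ _ _).setArr _ _ _).setReg _ _
      · rw [List.length_append, List.length_singleton]
        exact ha₁.add h1 (by simp) (by simp [hI₁]) (by simp [hJ₁])
    · simp only [Test.Holds, hs₁.env.one, hok] at h1
      refine (Runs.skip ⟨hJ₁, hF.trans hF₁, hX₁, ?_⟩).le (by omega)
      rw [List.length_append, List.length_singleton]
      exact ha₁.skip h1
  · exact ⟨Frame.refl _ _ s, hX, ha⟩

lemma runs_row (hs : M.TableInv X₀ A B Cs s) {l r : List (List (Fin m))} {c : List (Fin m)}
    (hl : Cs = l ++ c :: r) (hI : s.reg rgI = l.length) (ha : M.ArcsInv A Cs l.length 0 s) :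
    Runs M Prog.row s (91 * m + 12) fun s' =>
      Frame [rgE, rgFlag, rgF, rgT, rgB, rgOk, rgV, rgEnd, rgY, rgA, rgJ, rgArcs]
        [arX, arO, arSrc, arTgt] s s' ∧ M.ArcsInv A Cs (l.length + 1) 0 s' := by
  have hT₀ := not_isCycle_of_dead (hrec.route.stable h₀.1) hd
  have hc : c ∈ Cs := by simp [hl]
  have hR : rotOf A c ∈ Cs.map (rotOf A) := List.mem_map_of_mem hc
  have hw := hrec.weight_le h₀.1 hc
  -- The coefficient `91` consists of `4` for the reset, `45` for the forward pass, `6` for applying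
  -- `c` and `36` for listing the arcs.
  refine ((runs_reset hs.env).bind (t₂ := 87 * m + 10) ?_).le (by omega)
  rintro s₁ ⟨hF₁, hX₁⟩
  refine ((runs_forward h₀ hrec hd (hs.frame hF₁) hX₁ hl (by rw [hF₁.reg 21, hI])).bind
    (t₂ := 42 * m + 8) ?_).le (by omega)
  rintro s₂ ⟨hF₂, X, hX, hX₂⟩
  have hF := ((hF₁.mono (R := [rgE, rgFlag, rgF, rgT, rgB, rgOk, rgV, rgEnd, rgY, rgA, rgJ, rgArcs])
    (A := [arX, arO])).trans hF₂).setReg rgJ (s₂.reg rgI)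
  have ha₂ : M.ArcsInv A Cs l.length 0 (s₂.setReg rgJ (s₂.reg rgI)) :=
    ha.congr (by simp [hF₂.reg 1, hF₁.reg 1]) (hF.arr 3) (hF.arr 4)
  refine (Runs.seq_copy (((runs_applyRot (hs.frame hF) h₀.1 hrec (by simpa using hX₂) hl
    (by simp [hF₂.reg 21, hF₁.reg 21, hI]))).bind (t₂ := 36 * m + 2) ?_)).le (by omega)
  rintro s₃ ⟨hF₃, hX₃⟩
  have hF' := hF.trans hF₃
  have hcyc := isCycle_before_self h₀ hrec.route hT₀ hX hR
  refine (runs_emit h₀ hrec hd (hs.frame hF') hl (route_append_iff.2 ⟨X, hX, route_cons_iff.2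
    ⟨(isRotation_iff (hX.stable h₀.1) _).2 hcyc, Route.nil _⟩⟩) hX₃ (by rw [hF'.reg 21, hI])
    (ha₂.congr (hF₃.reg 1) (hF₃.arr 3) (hF₃.arr 4))).mono le_rfl ?_
  rintro s₄ ⟨hF₄, ha₄⟩
  exact ⟨(hF'.mono).trans hF₄, ha₄⟩

lemma runs_phaseTwo (hs : M.TableInv X₀ A B Cs s) :
    Runs M Prog.phaseTwo s (m * (91 * m + 14) + 3) fun s' =>
      M.TableInv X₀ A B Cs s' ∧ M.ArcsInv A Cs Cs.length 0 s' := by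
  have hlen := hrec.length_le_card h₀.1
  refine (Runs.seq_const (Runs.seq_const ((Runs.loop_range (t := 91 * m + 13) (n := Cs.length) (i := 0) (fun i s' =>
    M.TableInv X₀ A B Cs s' ∧ s'.reg rgI = i ∧ M.ArcsInv A Cs i 0 s') (Nat.zero_le _) ?_ ?_ ?_).mono
    le_rfl fun s' h => ⟨h.1, h.2.2⟩))).le (by
      have := Nat.mul_le_mul_right (91 * m + 14) hlen
      simpa using this)
  · rintro i s' - hi ⟨hs', hI, ha'⟩
    obtain ⟨l, c, r, hl, rfl⟩ : ∃ l c r, Cs = l ++ c :: r ∧ l.length = i :=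
      ⟨Cs.take i, Cs[i], Cs.drop (i + 1), by simp, by simp; omega⟩
    refine ⟨by simp [Test.Holds, hI, hs'.n_eq, hi], ((runs_row h₀ hrec hd hs' hl hI ha').bind (t₂ := 1) ?_)⟩
    rintro s₁ ⟨hF, ha₁⟩
    exact Runs.inc ⟨hs'.frame (hF.mono (R := [rgE, rgFlag, rgF, rgT, rgB, rgOk, rgV, rgEnd, rgY,
      rgA, rgJ, rgArcs, rgI]) (A := [arX, arO, arSrc, arTgt]) |>.setReg _ _), by simp [hF.reg 21, hI], ha₁.congr (by simp) rfl rfl⟩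
  · rintro s' ⟨hs', hI, -⟩
    simp [Test.Holds, hI, hs'.n_eq]
  · exact ⟨hs.frame (((Frame.refl [rgArcs, rgI] [] s).setReg _ _).setReg _ _), by simp,
      ArcsInv.zero (by simp)⟩

end Arcs

end CBM

/-! ### Initialization, the main program, and the theorem. -/

namespace Prog

/-- Copy the input to its place, and initialize the search for rotations. -/
def init : Program :=
  -- The input shares register `0` and low-numbered arrays with the output, so what is needed of it
  -- is moved first. `rgZero` and `rgU` need no initialization, as they are zero in the input
  -- memory.
  .copy rgM 0 ;; .const rgOne 1 ;; .const rgI 0 ;;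
  .loop (.lt rgI rgM) (.load rgT 1 rgI ;; .store arFm rgI rgT ;; .load rgT 3 rgI ;;
    .store arNx rgI rgT ;; .load rgT 4 rgI ;; .store arMin rgI rgT ;; .store arX rgI rgT ;;
    .inc rgI) ;;
  .const rgN 0 ;; .store arU rgZero rgZero ;; .const rgRun 1 ;; .copy rgTop rgM

/-- Construct the Hasse diagram of the poset of rotations. -/
def main : Program := init ;; phaseOne ;; phaseTwo

end Prog

namespace CBM

variable {X₀ Y₀ : Finset (Fin m)} {s : Memory} {A B : Fin m → Fin m} {Cs : List (List (Fin m))}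

/-- The end mark `m` really means that no worse edge exists: a nonempty finite set of worse edges
has a best one, which would be next. -/
lemma isNx_inputMemory (e : Fin m) : M.IsNx ((inputMemory M X₀).arr 3 e) e := by
  simp only [inputMemory, Nat.reduceEqDiff, if_false, Fin.is_lt, dite_true, Fin.eta, if_true]
  split_ifs with h
  · obtain ⟨hw, hg, hmax⟩ := h.choose_spec
    refine Or.inl ⟨h.choose, rfl, hw, M.rk_lt hw hg, fun d hd hr => ?_⟩
    by_cases hne : d = h.choose
    · rw [hne]
    · have := hmax d hd ((M.gt_iff rfl hd).2 hr) hne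
      exact ((M.gt_iff hw hd).1 this).le
  · refine Or.inr ⟨rfl, fun d hd hr => h ?_⟩
    obtain ⟨a, ha, hmax⟩ := Finset.exists_max_image
      (Finset.univ.filter fun a => M.wk a = M.wk e ∧ M.rk a < M.rk e) M.rk ⟨d, by simp [hd, hr]⟩
    simp only [Finset.mem_filter, Finset.mem_univ, true_and] at ha hmax
    refine ⟨a, ha.1, (M.gt_iff rfl ha.1).2 ha.2, fun c hc hg hne => (M.gt_iff ha.1 hc).2 ?_⟩
    exact lt_of_le_of_ne (hmax c ⟨hc, (M.gt_iff rfl hc).1 hg⟩) fun h' =>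
      hne (M.rk_inj (hc.trans ha.1.symm) h')

lemma runs_init :
    Runs M Prog.init (inputMemory M X₀) (9 * m + 8) fun s => s.reg rgRun = 1 ∧
      M.StackInv X₀ X₀ [] ∅ A B [] s := by
  set s₀ := inputMemory M X₀ with hs₀
  have hm : s₀.reg 0 = m := rfl
  have hfm : ∀ e : Fin m, s₀.arr 1 e = M.fm e := fun e => by simp [hs₀, inputMemory]
  have hmin : Indicates (s₀.arr 4) X₀ := fun e => by simp [hs₀, inputMemory]
  have hst : ∀ i, s₀.arr 15 i = 0 := fun i => by simp [hs₀, inputMemory]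
  have hzero : s₀.reg 12 = 0 := rfl
  have hU : s₀.reg 11 = 0 := rfl
  have hnx : ∀ e : Fin m, M.IsNx (s₀.arr 3 e) e := isNx_inputMemory
  clear_value s₀
  refine (Runs.seq_copy (Runs.seq_const (Runs.seq_const ((Runs.loop_range (t := 8) (n := m) (i := 0)
    (fun i s => Frame [rgM, rgOne, rgI, rgT] [arFm, arNx, arMin, arX] s₀ s ∧ s.reg rgM = m ∧
      s.reg rgOne = 1 ∧ s.reg rgI = i ∧ ∀ e : Fin m, (e : ℕ) < i → s.arr arFm e = s₀.arr 1 e ∧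
        s.arr arNx e = s₀.arr 3 e ∧ s.arr arMin e = s₀.arr 4 e ∧ s.arr arX e = s₀.arr 4 e)
    (Nat.zero_le _) ?_ ?_ ?_).bind (t₂ := 4) ?_)))).le (by omega)
  · rintro i s - him ⟨hF, hM, hO, hI, h⟩
    refine ⟨by simp [Test.Holds, hI, hM, him], ?_⟩
    refine Runs.seq_load (Runs.seq_store (Runs.seq_load (Runs.seq_store (Runs.seq_load
      (Runs.seq_store (Runs.seq_store (Runs.inc ⟨?_, by simpa using hM, by simpa using hO,
        by simp [hI], fun e he => ?_⟩)))))))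
    · exact (((((((hF.setReg _ _).setArr _ _ _).setReg _ _).setArr _ _ _).setReg _ _).setArr
        _ _ _).setArr _ _ _).setReg _ _
    · have h1 := hF.arr 1
      have h3 := hF.arr 3
      have h4 := hF.arr 4
      simp only [setReg_reg, setReg_arr, setArr_arr, setArr_reg, Nat.reduceEqDiff, if_false, if_true,
        hI, h1, h3, h4, Function.update_apply]
      split_ifs with h5
      · rw [h5]
        exact ⟨rfl, rfl, rfl, rfl⟩
      · exact h e (by omega)
  · rintro s ⟨-, hM, -, hI, -⟩
    simp [Test.Holds, hI, hM]
  · exact ⟨(((Frame.refl _ _ s₀).setReg _ _).setReg _ _).setReg _ _, by simp [hm], by simp, by simp,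
      fun e he => absurd he (Nat.not_lt_zero _)⟩
  · rintro s ⟨hF, hM, hO, hI, h⟩
    have hz : s.reg 12 = 0 := (hF.reg 12).trans hzero
    have hst' : s.arr 15 = s₀.arr 15 := hF.arr 15
    have hU' : s.reg 11 = 0 := (hF.reg 11).trans hU
    refine Runs.seq_const (Runs.seq_store (Runs.seq_const (Runs.copy ⟨by simp, ?_⟩)))
    constructor
    · constructor
      · simpa using hM
      · simpa using hz
      · simpa using hO
      · intro e
        simp [(h e e.2).1, hfm]
      · intro e
        simpa [(h e e.2).2.1] using hnx e
      · intro e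
        simpa [(h e e.2).2.2.1] using hmin e
    · intro e
      simpa [(h e e.2).2.2.2] using hmin e
    · exact .nil X₀
    · simpa [Linked] using hM
    · simp
    · simp
    · exact .nil
    · simp [hst', hst]
    · simp [hst', hst]
    · simp [hst', hst]
    · simp [hst', hst]
    · simp
    · simp
    · simp
    · simp
    · trivial
    · trivial
    · simp
    · simpa using hU'
    · simp [hz]

lemma _root_.Cells.bijOn {g : ℕ → ℕ} {u : ℕ} {l : List (Fin m)} (h : Cells g u l) (hnd : l.Nodup) :
    Set.BijOn g (Set.Ico u (u + l.length)) ((fun e : Fin m => (e : ℕ)) '' {e | e ∈ l}) := by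
  have hg : ∀ k ∈ Set.Ico u (u + l.length), ∃ h : k - u < l.length, g k = l[k - u] := by
    rintro k ⟨h1, h2⟩
    have h3 : k - u < l.length := by omega
    exact ⟨h3, by rw [← h.getElem _ h3, Nat.add_sub_cancel' h1]⟩
  refine ⟨fun k hk => ?_, fun k hk k' hk' heq => ?_, ?_⟩
  · obtain ⟨h1, h2⟩ := hg k hk
    exact ⟨l[k - u], List.getElem_mem h1, h2.symm⟩
  · obtain ⟨h1, h2⟩ := hg k hk
    obtain ⟨h1', h2'⟩ := hg k' hk'
    have h3 : l[k - u] = l[k' - u] := Fin.ext (by rw [← h2, ← h2', heq])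
    have h4 := (hnd.getElem_inj_iff).1 h3
    have := hk.1
    have := hk'.1
    omega
  · rintro _ ⟨e, he, rfl⟩
    obtain ⟨i, hi, rfl⟩ := List.getElem_of_mem he
    exact ⟨u + i, ⟨by omega, by omega⟩, h.getElem i hi⟩

lemma containsHasseDiagram (h₀ : M.IsXmin X₀) (hrec : M.Recorded A B X₀ Y₀ Cs)
    (hd : ∀ x ∈ Y₀, M.Dead Y₀ x) (hs : M.TableInv X₀ A B Cs s)
    (ha : M.ArcsInv A Cs Cs.length 0 s) : ContainsHasseDiagram M s := by
  have hT₀ := not_isCycle_of_dead (hrec.route.stable h₀.1) hd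
  have hmem := mem_rotations_iff h₀ hrec.route hT₀
  have hsplit : ∀ i < Cs.length, ∃ l c r, Cs = l ++ c :: r ∧ l.length = i := fun i hi =>
    ⟨Cs.take i, Cs[i], Cs.drop (i + 1), by simp, by simp; omega⟩
  refine ⟨rotAt A Cs, ⟨?_, ?_, ?_⟩, ?_, ?_⟩
  · intro i hi
    rw [Set.mem_Iio, hs.n_eq] at hi
    obtain ⟨l, c, r, hl, rfl⟩ := hsplit i hi
    rw [rotAt_length hl, hmem]
    exact List.mem_map_of_mem (by simp [hl])
  · intro i hi j hj hij
    rw [Set.mem_Iio, hs.n_eq] at hi hj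
    obtain ⟨l, c, r, hl, rfl⟩ := hsplit i hi
    obtain ⟨l', c', r', hl', rfl⟩ := hsplit j hj
    rw [rotAt_length hl, rotAt_length hl'] at hij
    exact eq_of_rotOf_eq h₀ hrec hl hl' hij
  · intro R hR
    obtain ⟨c, hc, rfl⟩ := List.mem_map.1 ((hmem R).1 hR)
    obtain ⟨l, r, hl⟩ := List.append_of_mem hc
    refine ⟨l.length, ?_, rotAt_length hl⟩
    rw [Set.mem_Iio, hs.n_eq, hl]
    simp
  · intro i hi
    rw [hs.n_eq] at hi
    obtain ⟨l, c, r, hl, rfl⟩ := hsplit i hi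
    obtain ⟨Z, hZ, hnd, hlk⟩ := hrec.link l c r hl
    have hZs := hZ.stable h₀.1
    obtain ⟨h1, h2, h3, h4⟩ := hs.cells hl
    rw [rotAt_length hl, h1, h2]
    -- Distinct edges of a stable set belong to distinct workers, hence so do the edges that replace
    -- them.
    have hndA : (c.map A).Nodup := hnd.map_on fun x hx y hy hxy =>
      hZs.eq_of_wk (hlk x hx).mem (hlk y hy).mem (by
        rw [← (hlk x hx).wk_eq, ← (hlk y hy).wk_eq, hxy])
    have h5 := h4.bijOn hndA
    have h6 := h3.bijOn hnd
    rw [List.length_map] at h5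
    simpa [rotOf] using And.intro h5 h6
  · rw [hs.n_eq]
    convert ha using 1
    unfold ArcsInv
    congr! 2
    ext ⟨a, b⟩
    simp
    tauto

end CBM

end Machine

theorem proposition5p1 :
    ∃ (P : Program) (c : ℕ), ∀ (p q m : ℕ) (M : CBM p q m) (Xmin : Finset (Fin m)),
      M.IsXmin Xmin →
        ∃ (t : ℕ) (s : Memory),
          Exec M P (inputMemory M Xmin) t s ∧ t ≤ c * (m ^ 2 + 1) ∧
            ContainsHasseDiagram M s := by
  -- The total bound is `159 * m ^ 2 + 105 * m + 36`, and `m ≤ m ^ 2` gives `264 = 159 + 105`.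
  refine ⟨Prog.main, 264, fun p q m M X₀ h₀ => ?_⟩
  suffices h : Runs M Prog.main (inputMemory M X₀) (9 * m + 8 + ((2 * m + 1) * (34 * m + 24) + 1 +
      (m * (91 * m + 14) + 3))) (ContainsHasseDiagram M) by
    obtain ⟨t, s, ht, he, hs⟩ := h
    refine ⟨t, s, he, ht.trans ?_, hs⟩
    nlinarith [Nat.le_self_pow two_ne_zero m]
  -- As long as no rotation is recorded, the successor maps are arbitrary; `id` is a dummy.
  refine (CBM.runs_init (A := id) (B := id)).bind fun s₁ ⟨hrun, hI⟩ =>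
    (CBM.runs_phaseOne h₀.1 hI hrun).bind ?_
  rintro s₂ ⟨Y, K, A, B, Cs, hS, hd⟩
  exact (CBM.runs_phaseTwo h₀ hS.recd hd hS.tableInv).mono le_rfl fun s₃ ⟨hT, ha⟩ =>
    CBM.containsHasseDiagram h₀ hS.recd hd hT ha
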